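/- An $\mathcal{EL}$ concept expression is built by $C,D ::= \top \mid A \mid C\sqcap D\mid \exists r.C$ from countably infinite, disjoint sets of concept names $A$ and role names $r$. An $\mathcal{EL}_{\mathsf{lhs}}$ inclusion has the form $C\sqsubseteq A$ with $C$ an $\mathcal{EL}$ concept expression and $A$ a concept name; an $\mathcal{EL}_{\mathsf{lhs}}$ TBox is a finite set of such inclusions. The size of a concept expression is its length as a string (names have length one), $|C\sqsubseteq A|=|C|+|A|$, and $|\mathcal T|=\sum_{C\sqsubseteq A\in\mathcal T}(|C|+|A|)$. $\mathcal T\models C\sqsubseteq A$ means that every model of $\mathcal T$ satisfies $C^{\mathcal I}\subseteq A^{\mathcal I}$. Theorem. $\mathcal{EL}_{\mathsf{lhs}}$ TBoxes are polynomial time learnable using membership and equivalence queries. That is, there are a deterministic learning algorithm and a polynomial $p$ such that the following holds for every target $\mathcal{EL}_{\mathsf{lhs}}$ TBox $\mathcal T$. Initially the algorithm is told only the signature of $\mathcal T$ (the concept and role names that occur in it). It may ask membership queries "does $\mathcal T\models C\sqsubseteq A$ hold?" for $\mathcal{EL}_{\mathsf{lhs}}$ inclusions $C\sqsubseteq A$,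 and equivalence queries "is $\mathcal H\equiv\mathcal T$?" for $\mathcal{EL}_{\mathsf{lhs}}$ TBoxes $\mathcal H$; the latter are answered by "yes" if $\mathcal H\equiv \mathcal T$, and otherwise by an arbitrary counterexample, that is, an $\mathcal{EL}_{\mathsf{lhs}}$ inclusion that is entailed by exactly one of $\mathcal H$ and $\mathcal T$. However the counterexamples are chosen, the algorithm eventually halts and outputs an $\mathcal{EL}_{\mathsf{lhs}}$ TBox $\mathcal H$ with $\mathcal H\equiv\mathcal T$, and at every step of the computation the time used up to that step (each call to an oracle counts as one step) is at most $p(|\mathcal T|,n)$, where $n$ is the size of the largest counterexample seen so far ($n=0$ if there was none). -/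

import Mathlib

namespace ExactLearning

/-! ### The description logic `EL_lhs` -/

/-- Concept names: a countably infinite set. -/
abbrev ConceptName := ℕ

/-- Role names: a countably infinite set. Concept names and role names are kept apart by the
constructors that use them. -/
abbrev RoleName := ℕ

/-- `EL` concept expressions `C, D ::= ⊤ | A | C ⊓ D | ∃ r. C` (no inverse roles). -/
inductive ELConcept where
  | top
  | name (A : ConceptName)
  | conj (C D : ELConcept)
  | ex (r : RoleName) (C : ELConcept)
deriving DecidableEq

/-- Length of the string that represents a concept expression, where concept names and role names
have length one (`∃ r . C` has the three extra symbols `∃`, `r`, `.`; brackets are not counted,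
which only matters up to a constant factor). -/
def ELConcept.size : ELConcept → ℕ
  | top => 1
  | name _ => 1
  | conj C D => C.size + 1 + D.size
  | ex _ C => 3 + C.size

/-- The concept names that occur in a concept expression. -/
def ELConcept.conceptNames : ELConcept → Finset ConceptName
  | top => ∅
  | name A => {A}
  | conj C D => C.conceptNames ∪ D.conceptNames
  | ex _ C => C.conceptNames

/-- The role names that occur in a concept expression. -/
def ELConcept.roleNames : ELConcept → Finset RoleName
  | top => ∅
  | name _ => ∅
  | conj C D => C.roleNames ∪ D.roleNames
  | ex r C => insert r C.roleNames

/-- An `EL_lhs` concept inclusion `C ⊑ A`: an `EL` concept expression on the left, a concept name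
on the right. -/
structure CI where
  lhs : ELConcept
  rhs : ConceptName
deriving DecidableEq

/-- Size `|C| + |A|` of the inclusion `C ⊑ A`. -/
def CI.size (α : CI) : ℕ := α.lhs.size + 1

/-- An `EL_lhs` TBox: a finite set of `EL_lhs` concept inclusions. -/
abbrev TBox := Finset CI

/-- Size of a TBox: the sum of the sizes of its inclusions. -/
def TBox.size (T : TBox) : ℕ := ∑ α ∈ T, α.size

/-- The concept names in the signature of a TBox. -/
def TBox.conceptNames (T : TBox) : Finset ConceptName :=
  T.biUnion fun α => insert α.rhs α.lhs.conceptNames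

/-- The role names in the signature of a TBox. -/
def TBox.roleNames (T : TBox) : Finset RoleName :=
  T.biUnion fun α => α.lhs.roleNames

/-- Interpretations: a non-empty domain, a subset of it for every concept name and a binary
relation on it for every role name. -/
structure Interpretation where
  Dom : Type
  nonempty : Nonempty Dom
  concept : ConceptName → Set Dom
  role : RoleName → Set (Dom × Dom)

/-- The extension `C^I` of a concept expression in an interpretation. -/
def Interpretation.ext (I : Interpretation) : ELConcept → Set I.Dom
  | .top => Set.univ
  | .name A => I.concept A
  | .conj C D => I.ext C ∩ I.ext D
  | .ex r C => {d | ∃ d' ∈ I.ext C, (d, d') ∈ I.role r}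

/-- `I ⊨ C ⊑ A`. -/
def Interpretation.Satisfies (I : Interpretation) (α : CI) : Prop :=
  I.ext α.lhs ⊆ I.concept α.rhs

/-- `I` is a model of `T`. -/
def Interpretation.IsModel (I : Interpretation) (T : TBox) : Prop :=
  ∀ α ∈ T, I.Satisfies α

/-- `T ⊨ α`: every model of `T` satisfies `α`. -/
def TBox.Entails (T : TBox) (α : CI) : Prop :=
  ∀ I : Interpretation, I.IsModel T → I.Satisfies α

/-! ### Machine data

The machines below are programs of a deterministic imperative language on binary trees. The leaves
of a tree are `nil` or names. A name is a single symbol that programs can only copy and compare, in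
accordance with the convention that names have length one. -/

/-- A symbol for a concept name or for a role name. -/
inductive Name where
  | concept (A : ConceptName)
  | role (r : RoleName)
deriving DecidableEq

/-- Values of program variables. -/
inductive Data where
  | nil
  | atom (n : Name)
  | pair (a b : Data)
deriving DecidableEq

namespace Data

/-- Number of nodes of a tree (shared subtrees are counted every time they occur). -/
def size : Data → ℕ
  | nil => 1
  | atom _ => 1
  | pair a b => a.size + b.size + 1

/-- Truth values: `nil` is false, all else is true. -/
def ofBool : Bool → Data
  | false => nil
  | true => pair nil nil

/-- First component of a pair (`nil` for any other tree). -/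
def fst : Data → Data
  | pair a _ => a
  | _ => nil

/-- Second component of a pair (`nil` for any other tree). -/
def snd : Data → Data
  | pair _ b => b
  | _ => nil

/-- Is the tree a pair? -/
def isPair : Data → Bool
  | pair _ _ => true
  | _ => false

/-- The usual representation of lists by nested pairs. -/
def ofList : List Data → Data
  | [] => nil
  | a :: l => pair a (ofList l)

/-- Reads a list of trees. -/
def toList : Data → Option (List Data)
  | nil => some []
  | atom _ => none
  | pair a b => (toList b).map (a :: ·)

theorem toList_ofList (l : List Data) : (ofList l).toList = some l := by
  induction l with
  | nil => rfl
  | cons a l ih => simp [ofList, toList, ih]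

end Data

/-! ### Learning frameworks -/

/-- A learning framework `(X, L, μ)`: examples, concept representations, and the set of positive
examples of every concept representation. In addition: the sizes of examples and of concept
representations, their representation as machine data, and what a learner is told about the target
at the start (`Given l d` says that `d` is an admissible presentation of this information for the
target `l`). -/
structure LearningFramework where
  Example : Type
  Concept : Type
  μ : Concept → Set Example
  exampleSize : Example → ℕ
  conceptSize : Concept → ℕ
  encodeExample : Example → Data
  decodeExample : Data → Option Example
  decodeConcept : Data → Option Concept
  Given : Concept → Data → Prop

/-- The answers of the oracles in one learning session: `mem` answers membership queries and
`eqv k h` answers the equivalence query with hypothesis `h` if `k` equivalence queries were made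
before (`none` for "yes", `some x` for the counterexample `x`). As learners are deterministic, the
dependence on `k` covers oracles whose choice of a counterexample depends on everything that
happened before. -/
structure Oracle (F : LearningFramework) where
  mem : F.Example → Bool
  eqv : ℕ → F.Concept → Option F.Example

/-- The oracle answers truthfully for the target `l`. Nothing is assumed on which counterexample
in the symmetric difference is returned. -/
def Oracle.Truthful {F : LearningFramework} (O : Oracle F) (l : F.Concept) : Prop :=
  (∀ x, O.mem x = true ↔ x ∈ F.μ l) ∧
  ∀ k h, match O.eqv k h with
    | none => F.μ h = F.μ l
    | some x => x ∈ symmDiff (F.μ h) (F.μ l)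

/-! ### Programs with oracles and their running time -/

/-- Contents of the program variables. -/
abbrev Store := ℕ → Data

/-- Expressions. -/
inductive Expr where
  | var (x : ℕ)
  | nil
  | pair (e f : Expr)
  | fst (e : Expr)
  | snd (e : Expr)
  | isPair (e : Expr)
  | eq (e f : Expr)

/-- The value of an expression. -/
def Expr.eval (s : Store) : Expr → Data
  | var x => s x
  | nil => Data.nil
  | pair e f => Data.pair (e.eval s) (f.eval s)
  | fst e => (e.eval s).fst
  | snd e => (e.eval s).snd
  | isPair e => Data.ofBool (e.eval s).isPair
  | eq e f => Data.ofBool (decide (e.eval s = f.eval s))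

/-- The time needed to evaluate an expression: the sum of the sizes of the values of all its
subexpressions. In particular copying, building, and comparing trees is charged with their size. -/
def Expr.cost (s : Store) : Expr → ℕ
  | var x => (s x).size
  | nil => 1
  | pair e f => e.cost s + f.cost s + ((Expr.pair e f).eval s).size
  | fst e => e.cost s + ((Expr.fst e).eval s).size
  | snd e => e.cost s + ((Expr.snd e).eval s).size
  | isPair e => e.cost s + ((Expr.isPair e).eval s).size
  | eq e f => e.cost s + f.cost s + ((Expr.eq e f).eval s).size

/-- Programs: assignment, sequential composition, branching, loops, and queries. `mem x e` poses
the membership query given by the value of `e` and stores the answer in `x`. `eqv x e` poses the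
equivalence query given by the value of `e`; if the answer is "yes", it stores `nil` in `x`, and
otherwise the pair of `nil` and the counterexample. -/
inductive Program where
  | skip
  | assign (x : ℕ) (e : Expr)
  | seq (P Q : Program)
  | ite (e : Expr) (P Q : Program)
  | while (e : Expr) (P : Program)
  | mem (x : ℕ) (e : Expr)
  | eqv (x : ℕ) (e : Expr)

/-- A configuration: the programs that remain to be executed (one after the other), the store, the
time used so far, the number of equivalence queries so far, and the size of the largest
counterexample seen so far (`0` if there was none). -/
structure Config where
  code : List Program
  store : Store
  time : ℕ
  eqCalls : ℕ
  maxCex : ℕ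

/-- One step of computation. There is no next configuration if nothing remains to be executed (the
program has halted) or if a query is posed that represents no example or concept (the program is
stuck and never halts). Posing a query costs one step plus the time to write it down. -/
def step {F : LearningFramework} (O : Oracle F) (c : Config) : Option Config :=
  match c.code with
  | [] => none
  | .skip :: K => some { c with code := K, time := c.time + 1 }
  | .assign x e :: K =>
      some { c with
        code := K
        store := Function.update c.store x (e.eval c.store)
        time := c.time + 1 + e.cost c.store }
  | .seq P Q :: K => some { c with code := P :: Q :: K, time := c.time + 1 }
  | .ite e P Q :: K =>
      some { c with
        code := (if e.eval c.store = Data.nil then Q else P) :: K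
        time := c.time + 1 + e.cost c.store }
  | .while e P :: K =>
      some { c with
        code := if e.eval c.store = Data.nil then K else P :: .while e P :: K
        time := c.time + 1 + e.cost c.store }
  | .mem x e :: K =>
      (F.decodeExample (e.eval c.store)).map fun q =>
        { c with
          code := K
          store := Function.update c.store x (Data.ofBool (O.mem q))
          time := c.time + 1 + e.cost c.store }
  | .eqv x e :: K =>
      (F.decodeConcept (e.eval c.store)).map fun h =>
        match O.eqv c.eqCalls h with
        | none =>
          { c with
            code := K
            store := Function.update c.store x Data.nil
            time := c.time + 1 + e.cost c.store
            eqCalls := c.eqCalls + 1 }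
        | some q =>
          { code := K
            store := Function.update c.store x (Data.pair Data.nil (F.encodeExample q))
            time := c.time + 1 + e.cost c.store
            eqCalls := c.eqCalls + 1
            maxCex := max c.maxCex (F.exampleSize q) }

/-- The start configuration: variable `0` holds what the learner is told, all other variables
hold `nil`. -/
def Config.init (P : Program) (d : Data) : Config where
  code := [P]
  store := Function.update (fun _ => Data.nil) 0 d
  time := 0
  eqCalls := 0
  maxCex := 0

/-- The configuration after `n` steps (a configuration without successor is kept). -/
def run {F : LearningFramework} (O : Oracle F) (P : Program) (d : Data) (n : ℕ) : Config :=
  (fun c => (step O c).getD c)^[n] (Config.init P d)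

/-- Polynomial time learnability with membership and equivalence queries: there is a program that,
for every target `l` and all truthful oracles, halts with a concept representation `h` in variable
`0` such that `μ h = μ l`, and such that at every step the time used up to that step is bounded by
a fixed polynomial in the size of the target and the size of the largest counterexample seen so
far. -/
def LearningFramework.PolyTimeLearnable (F : LearningFramework) : Prop :=
  ∃ (P : Program) (p : MvPolynomial (Fin 2) ℕ),
    ∀ (l : F.Concept) (d : Data), F.Given l d →
      ∀ O : Oracle F, O.Truthful l →
        (∃ n h, (run O P d n).code = [] ∧
          F.decodeConcept ((run O P d n).store 0) = some h ∧ F.μ h = F.μ l) ∧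
        ∀ n, (run O P d n).time ≤
          MvPolynomial.eval ![F.conceptSize l, (run O P d n).maxCex] p

/-! ### The learning framework of `EL_lhs` TBoxes -/

/-- Concept expressions as machine data. -/
def ELConcept.encode : ELConcept → Data
  | top => .nil
  | name A => .atom (.concept A)
  | conj C D => .pair .nil (.pair C.encode D.encode)
  | ex r C => .pair (.atom (.role r)) C.encode

/-- Reads a concept expression. -/
def ELConcept.decode : Data → Option ELConcept
  | .nil => some top
  | .atom (.concept A) => some (name A)
  | .pair .nil (.pair a b) =>
      (decode a).bind fun C => (decode b).map fun D => conj C D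
  | .pair (.atom (.role r)) a => (decode a).map (ex r)
  | _ => none

theorem ELConcept.decode_encode (C : ELConcept) : decode C.encode = some C := by
  induction C with
  | top => simp [encode, decode]
  | name A => simp [encode, decode]
  | conj C D ihC ihD => simp [encode, decode, ihC, ihD]
  | ex r C ih => simp [encode, decode, ih]

/-- Concept inclusions as machine data. -/
def CI.encode (α : CI) : Data := .pair α.lhs.encode (.atom (.concept α.rhs))

/-- Reads a concept inclusion. -/
def CI.decode : Data → Option CI
  | .pair a (.atom (.concept A)) => (ELConcept.decode a).map fun C => ⟨C, A⟩
  | _ => none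

theorem CI.decode_encode (α : CI) : decode α.encode = some α := by
  simp [encode, decode, ELConcept.decode_encode]

/-- Reads a TBox from a list of concept inclusions. -/
def TBox.decode (d : Data) : Option TBox :=
  d.toList.bind fun l => (l.mapM CI.decode).map List.toFinset

/-- `d` presents the signature of `T`: it is the pair of a list of the concept names and a list of
the role names that occur in `T`, both without repetitions and in any order. -/
def TBox.PresentsSignature (T : TBox) (d : Data) : Prop :=
  ∃ (cs : List ConceptName) (rs : List RoleName),
    cs.Nodup ∧ cs.toFinset = T.conceptNames ∧ rs.Nodup ∧ rs.toFinset = T.roleNames ∧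
    d = .pair (.ofList (cs.map fun A => .atom (.concept A)))
      (.ofList (rs.map fun r => .atom (.role r)))

/-- The learning framework of `EL_lhs`: examples are `EL_lhs` concept inclusions, concept
representations are `EL_lhs` TBoxes, and `α` is a positive example for `T` iff `T ⊨ α`. The
signature of the target is known to the learner. -/
def elLhs : LearningFramework where
  Example := CI
  Concept := TBox
  μ T := {α | T.Entails α}
  exampleSize := CI.size
  conceptSize := TBox.size
  encodeExample := CI.encode
  decodeExample := CI.decode
  decodeConcept := TBox.decode
  Given := TBox.PresentsSignature

end ExactLearning

namespace ExactLearning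

open Polynomial

/-! ### Execution of programs without equivalence queries -/

/-! The learner is a tree version of the Angluin–Frazier–Pitt algorithm for Horn theories. A concept
expression is read as a labelled tree, `D.covers C` says that `C` maps homomorphically to `D`, root
to root, and `prod` is the product of trees. The learner keeps a list of trees. Its hypothesis
consists of all `C ⊑ B` with `C` in the list and `B` a name of the signature that the target entails
at `C`. Such a hypothesis follows from the target, so every counterexample is entailed by the target
only.

Given a counterexample, there is a node of its left-hand side with the following property: if all
proper descendants are closed under the target (by membership queries) and the node itself under the
hypothesis, then the target still entails a name that is missing at the node
(`Session.exists_violated_candidate`). Otherwise, going up from the leaves, the hypothesis would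
entail the counterexample. In a tree that is closed below the root, such a violation is due to a
single inclusion of the target that applies at the root (`InnerClosed.exists_violated`, by a
canonical model). Subtrees are now removed as long as the root remains violated. In the resulting
minimal tree the image of the left-hand side of that inclusion uses every edge, so the number of
edges is bounded by the size of the target, however large the counterexample was
(`edges_le_of_covers`, `Session.edges_le`).

The minimal tree `D` refines the first `C` in the list such that the product of `C` and `D` is still
violated and `C` does not map to `D`: the minimised product replaces `C`. If there is no such `C`,
then `D` is appended. A refinement removes labels of the root or, if these are kept, adds edges or,
if the number of edges is kept as well, removes labels elsewhere (`Session.refine_spec`). Hence a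
position of the list is refined only polynomially often. The invariant `LearnInv` says that an
inclusion violated in one tree is not applicable in an earlier one. So different trees violate
different inclusions, and the list is no longer than the target (`Session.length_le`). Together this
bounds the number of counterexamples (`Session.learn_inv`).

For the running time, `PT` is a calculus of functions that programs compute in polynomial time with
a membership oracle, closed under composition, loops and bounded recursion. All functions of the
learner belong to it. As the trees are bounded in terms of the target, one round takes time
polynomial in the target and the largest counterexample so far. In `reaches_loop` every earlier
round is charged at the current rate, which only grows; this gives the bound at every single step.
-/

/-- The successor configuration, where configurations without successor are kept. -/
def next (O : Oracle elLhs) (c : Config) : Config := (step O c).getD c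

/-- The program `P` transforms the store `s` into `s'` in time `t` without posing an equivalence
query, whatever remains to be executed afterwards. -/
def Runs (O : Oracle elLhs) (P : Program) (s s' : Store) (t : ℕ) : Prop :=
  ∀ K t₀ e m, ∃ n, (next O)^[n] ⟨P :: K, s, t₀, e, m⟩ = ⟨K, s', t₀ + t, e, m⟩

namespace Runs

variable {O : Oracle elLhs} {P Q : Program} {s s' s'' : Store} {t t' : ℕ}

theorem assign (O : Oracle elLhs) (s : Store) (x : ℕ) (e : Expr) :
    Runs O (.assign x e) s (Function.update s x (e.eval s)) (1 + e.cost s) :=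
  fun K t₀ e' m => ⟨1, by simp [next, step, Nat.add_assoc]⟩

theorem prepend {c c' c'' : Config} (h : next O c = c') (h' : ∃ n, (next O)^[n] c' = c'') :
    ∃ n, (next O)^[n] c = c'' := by
  obtain ⟨n, hn⟩ := h'
  exact ⟨n + 1, by rw [Function.iterate_succ_apply, h, hn]⟩

theorem chain {c c' c'' : Config} (h : ∃ n, (next O)^[n] c = c')
    (h' : ∃ n, (next O)^[n] c' = c'') : ∃ n, (next O)^[n] c = c'' := by
  obtain ⟨n, hn⟩ := h
  obtain ⟨n', hn'⟩ := h'
  exact ⟨n' + n, by rw [Function.iterate_add_apply, hn, hn']⟩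

theorem seq (h : Runs O P s s' t) (h' : Runs O Q s' s'' t') :
    Runs O (.seq P Q) s s'' (1 + t + t') := by
  intro K t₀ e m
  refine prepend (c' := ⟨P :: Q :: K, s, t₀ + 1, e, m⟩) rfl ?_
  have := chain (h (Q :: K) (t₀ + 1) e m) (h' K _ e m)
  simpa only [Nat.add_assoc] using this

theorem ite_true {b : Expr} (hb : b.eval s ≠ Data.nil) (h : Runs O P s s' t) :
    Runs O (.ite b P Q) s s' (1 + b.cost s + t) := by
  intro K t₀ e m
  refine prepend (c' := ⟨P :: K, s, t₀ + 1 + b.cost s, e, m⟩) (by simp [next, step, hb]) ?_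
  simpa only [Nat.add_assoc] using h K (t₀ + 1 + b.cost s) e m

theorem ite_false {b : Expr} (hb : b.eval s = Data.nil) (h : Runs O Q s s' t) :
    Runs O (.ite b P Q) s s' (1 + b.cost s + t) := by
  intro K t₀ e m
  refine prepend (c' := ⟨Q :: K, s, t₀ + 1 + b.cost s, e, m⟩) (by simp [next, step, hb]) ?_
  simpa only [Nat.add_assoc] using h K (t₀ + 1 + b.cost s) e m

theorem while_false {b : Expr} (hb : b.eval s = Data.nil) :
    Runs O (.while b P) s s (1 + b.cost s) :=
  fun K t₀ e m => ⟨1, by simp [next, step, hb, Nat.add_assoc]⟩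

theorem while_true {b : Expr} (hb : b.eval s ≠ Data.nil) (h : Runs O P s s' t)
    (h' : Runs O (.while b P) s' s'' t') :
    Runs O (.while b P) s s'' (1 + b.cost s + t + t') := by
  intro K t₀ e m
  refine prepend (c' := ⟨P :: .while b P :: K, s, t₀ + 1 + b.cost s, e, m⟩)
    (by simp [next, step, hb]) ?_
  have := chain (h (.while b P :: K) (t₀ + 1 + b.cost s) e m) (h' K _ e m)
  simpa only [Nat.add_assoc] using this

theorem mem {x : ℕ} {b : Expr} {α : CI} (hb : b.eval s = α.encode) :
    Runs O (.mem x b) s (Function.update s x (Data.ofBool (O.mem α))) (1 + b.cost s) := by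
  intro K t₀ e m
  have hd : elLhs.decodeExample α.encode = some α := CI.decode_encode α
  refine ⟨1, ?_⟩
  simp only [Function.iterate_one, next, step]
  rw [hb, hd, ← Nat.add_assoc]
  rfl

end Runs

/-! ### Polynomials -/

theorem eval_mono (p : ℕ[X]) {m n : ℕ} (h : m ≤ n) : p.eval m ≤ p.eval n := by
  rw [Polynomial.eval_eq_sum, Polynomial.eval_eq_sum]
  exact Finset.sum_le_sum fun i _ => Nat.mul_le_mul_left _ (Nat.pow_le_pow_left h i)

/-! ### Encodings -/

/-- Types whose elements are represented by machine data. -/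
class Enc (α : Type) where
  enc : α → Data
  -- Injectivity makes the equality test of the machine decide equality of the represented elements.
  inj : Function.Injective enc


/-- The size of the representation. -/
def esize {α : Type} [Enc α] (a : α) : ℕ := (Enc.enc a).size

theorem Data.size_pos (d : Data) : 1 ≤ d.size := by cases d <;> simp [Data.size]

theorem esize_pos {α : Type} [Enc α] (a : α) : 1 ≤ esize a := Data.size_pos _

instance : Enc Bool where
  enc := Data.ofBool
  inj := by intro a b; cases a <;> cases b <;> simp [Data.ofBool]

/-- Concept names and role names are both natural numbers, so this instance takes up the type; role
names are represented through the wrapper `Role`. -/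
instance : Enc ConceptName where
  enc A := .atom (.concept A)
  inj := by intro a b h; simpa using h

/-- Role names, as a type with its own representation. -/
structure Role where
  name : RoleName
deriving DecidableEq

instance : Enc Role where
  enc r := .atom (.role r.name)
  inj := by rintro ⟨a⟩ ⟨b⟩ h; simpa using h

instance {α β : Type} [Enc α] [Enc β] : Enc (α × β) where
  enc p := .pair (Enc.enc p.1) (Enc.enc p.2)
  inj := by
    rintro ⟨a, b⟩ ⟨a', b'⟩ h
    simp only [Data.pair.injEq] at h
    rw [Enc.inj h.1, Enc.inj h.2]

theorem Data.ofList_injective : Function.Injective Data.ofList := fun a b h => by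
  have := congrArg Data.toList h
  simpa [Data.toList_ofList] using this

instance {α : Type} [Enc α] : Enc (List α) where
  enc l := .ofList (l.map Enc.enc)
  inj := Data.ofList_injective.comp (List.map_injective_iff.2 Enc.inj)

theorem ELConcept.encode_injective : Function.Injective ELConcept.encode := fun a b h => by
  have := congrArg ELConcept.decode h
  simpa [ELConcept.decode_encode] using this

instance : Enc ELConcept := ⟨ELConcept.encode, ELConcept.encode_injective⟩

instance : Enc CI where
  enc := CI.encode
  inj a b h := by
    have := congrArg CI.decode h
    simpa [CI.decode_encode] using this

section esize
variable {α β : Type} [Enc α] [Enc β]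

@[simp] theorem esize_pair (p : α × β) : esize p = esize p.1 + esize p.2 + 1 := rfl
@[simp] theorem esize_nil : esize ([] : List α) = 1 := rfl
@[simp] theorem esize_cons (a : α) (l : List α) : esize (a :: l) = esize a + esize l + 1 := rfl
@[simp] theorem esize_name (A : ConceptName) : esize A = 1 := rfl
theorem esize_bool_le (b : Bool) : esize b ≤ 3 := by cases b <;> decide
@[simp] theorem esize_top : esize ELConcept.top = 1 := rfl
@[simp] theorem esize_cname (A : ConceptName) : esize (ELConcept.name A) = 1 := rfl
@[simp] theorem esize_conj (C D : ELConcept) :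
    esize (C.conj D) = esize C + esize D + 3 := by
  change 1 + (C.encode.size + D.encode.size + 1) + 1 = C.encode.size + D.encode.size + 3
  omega
@[simp] theorem esize_ex (r : RoleName) (C : ELConcept) : esize (C.ex r) = esize C + 2 := by
  change 1 + C.encode.size + 1 = C.encode.size + 2
  omega
@[simp] theorem esize_CI (α : CI) : esize α = esize α.lhs + 2 := rfl
@[simp] theorem esize_append (l m : List α) : esize (l ++ m) + 1 = esize l + esize m := by
  induction l with
  | nil => simp [Nat.add_comm]
  | cons a l ih => simp; omega

theorem length_lt_esize (l : List α) : l.length < esize l := by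
  induction l with
  | nil => simp
  | cons a l ih => simp; omega

theorem esize_le_of_mem {a : α} {l : List α} (h : a ∈ l) : esize a ≤ esize l := by
  induction l with
  | nil => simp at h
  | cons b l ih =>
    rcases List.mem_cons.1 h with rfl | h
    · simp; omega
    · have := ih h; simp; omega

theorem esize_list_le (l : List α) (b : ℕ) (h : ∀ a ∈ l, esize a ≤ b) :
    esize l ≤ l.length * (b + 1) + 1 := by
  induction l with
  | nil => simp
  | cons a l ih =>
    have h1 := h a (by simp)
    have h2 := ih fun c hc => h c (by simp [hc])
    simp [Nat.add_mul] at h2 ⊢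
    omega

/-- Converts string length, in which counterexamples are measured, into the size of machine data, in
which time is measured. A conjunction has three extra nodes for one extra symbol, whence the factor.
-/
theorem esize_concept_le (C : ELConcept) : esize C ≤ 3 * C.size := by
  induction C with
  | top => simp [ELConcept.size]
  | name A => simp [ELConcept.size]
  | conj C D ihC ihD => simp [ELConcept.size]; omega
  | ex r C ih => simp [ELConcept.size]; omega

end esize

/-! ### Polynomial time functions -/

/-- The possible answers of a membership oracle. -/
abbrev Orc := CI → Bool

/-- Replaces all variables of an expression by the variable `k`. -/
def Expr.atVar (k : ℕ) : Expr → Expr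
  | var _ => var k
  | nil => nil
  | pair e f => pair (e.atVar k) (f.atVar k)
  | fst e => fst (e.atVar k)
  | snd e => snd (e.atVar k)
  | isPair e => isPair (e.atVar k)
  | eq e f => eq (e.atVar k) (f.atVar k)

theorem Expr.eval_atVar (e : Expr) (k : ℕ) (s : Store) :
    (e.atVar k).eval s = e.eval fun _ => s k := by
  induction e <;> simp_all [atVar, eval]

theorem Expr.cost_atVar (e : Expr) (k : ℕ) (s : Store) :
    (e.atVar k).cost s = e.cost fun _ => s k := by
  have := Expr.eval_atVar
  induction e <;> simp_all [atVar, cost, eval]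

theorem Expr.size_eval_le_cost (e : Expr) (s : Store) : (e.eval s).size ≤ e.cost s := by
  cases e <;> simp [eval, cost, Data.size]

theorem Data.size_fst_le (d : Data) : d.fst.size ≤ d.size := by
  cases d <;> simp [fst, size]; omega

theorem Data.size_snd_le (d : Data) : d.snd.size ≤ d.size := by
  cases d <;> simp [snd, size]; omega

theorem Data.size_ofBool_le (b : Bool) : (Data.ofBool b).size ≤ 3 := by cases b <;> decide

/-- The value of an expression is no larger than its cost, so each constructor adds at most a
multiple of the costs of its operands and a constant. The expression being fixed, evaluation takes
linear time. -/
theorem Expr.exists_cost_le (e : Expr) : ∃ c, ∀ d : Data, (e.cost fun _ => d) ≤ c * d.size := by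
  induction e with
  | var x => exact ⟨1, fun d => by simp [cost]⟩
  | nil => exact ⟨1, fun d => by have := d.size_pos; simp [cost]; omega⟩
  | pair e f ihe ihf =>
    obtain ⟨c, hc⟩ := ihe
    obtain ⟨c', hc'⟩ := ihf
    refine ⟨2 * c + 2 * c' + 1, fun d => ?_⟩
    have h1 := e.size_eval_le_cost fun _ => d
    have h2 := f.size_eval_le_cost fun _ => d
    have := hc d
    have := hc' d
    have := d.size_pos
    simp only [cost, eval, Data.size, Nat.add_mul, Nat.mul_assoc]
    omega
  | fst e ih =>
    obtain ⟨c, hc⟩ := ih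
    refine ⟨2 * c, fun d => ?_⟩
    have := e.size_eval_le_cost fun _ => d
    have := (e.eval fun _ => d).size_fst_le
    have := hc d
    simp only [cost, eval, Nat.mul_assoc]
    omega
  | snd e ih =>
    obtain ⟨c, hc⟩ := ih
    refine ⟨2 * c, fun d => ?_⟩
    have := e.size_eval_le_cost fun _ => d
    have := (e.eval fun _ => d).size_snd_le
    have := hc d
    simp only [cost, eval, Nat.mul_assoc]
    omega
  | isPair e ih =>
    obtain ⟨c, hc⟩ := ih
    refine ⟨c + 3, fun d => ?_⟩
    have := Data.size_ofBool_le (e.eval fun _ => d).isPair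
    have := hc d
    have := d.size_pos
    simp only [cost, eval, Nat.add_mul]
    omega
  | eq e f ihe ihf =>
    obtain ⟨c, hc⟩ := ihe
    obtain ⟨c', hc'⟩ := ihf
    refine ⟨c + c' + 3, fun d => ?_⟩
    have := Data.size_ofBool_le (decide ((e.eval fun _ => d) = f.eval fun _ => d))
    have := hc d
    have := hc' d
    have := d.size_pos
    simp only [cost, eval, Nat.add_mul]
    omega

variable {α β γ δ : Type} [Enc α] [Enc β] [Enc γ] [Enc δ]

/-- The specification of a program that computes `f` on the arguments in `S`: the argument is
expected and the value is delivered in variable `k`, variables below `k` are preserved, and time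
and the size of the value are bounded by `p`. -/
def ComputesOn (S : Orc → Set α) (f : Orc → α → β) (P : ℕ → Program) (p : ℕ[X]) : Prop :=
  ∀ (O : Oracle elLhs) (k : ℕ) (s : Store) (a : α), a ∈ S O.mem → s k = Enc.enc a →
    ∃ s' t, Runs O (P k) s s' t ∧ t ≤ p.eval (esize a) ∧ s' k = Enc.enc (f O.mem a) ∧
      (∀ j < k, s' j = s j) ∧ esize (f O.mem a) ≤ p.eval (esize a)

/-- `f` is computable in polynomial time on `S`, with the help of a membership oracle. -/
def PTOn (S : Orc → Set α) (f : Orc → α → β) : Prop := ∃ P p, ComputesOn S f P p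

/-- `f` is computable in polynomial time, with the help of a membership oracle. -/
def PT (f : Orc → α → β) : Prop := PTOn (fun _ => Set.univ) f

theorem PTOn.mono {S S' : Orc → Set α} {f : Orc → α → β} (h : PTOn S f) (hS : ∀ O, S' O ⊆ S O) : PTOn S' f := by
  obtain ⟨P, p, hP⟩ := h
  exact ⟨P, p, fun O k s a ha => hP O k s a (hS _ ha)⟩

theorem PT.on {f : Orc → α → β} (h : PT f) (S : Orc → Set α) : PTOn S f := h.mono fun _ => Set.subset_univ _

theorem PTOn.congr {S : Orc → Set α} {f g : Orc → α → β} (h : PTOn S f)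
    (hfg : ∀ O, ∀ a ∈ S O, g O a = f O a) : PTOn S g := by
  obtain ⟨P, p, hP⟩ := h
  refine ⟨P, p, fun O k s a ha hk => ?_⟩
  rw [hfg _ a ha]
  exact hP O k s a ha hk

theorem PT.congr {f g : Orc → α → β} (h : PT f) (hfg : ∀ O a, g O a = f O a) : PT g :=
  PTOn.congr h fun O a _ => hfg O a

/-- Encodings are chosen such that constructors and projections are single expressions. The
elementary functions enter the calculus through this lemma. -/
theorem PTOn.of_expr {S : Orc → Set α} {f : Orc → α → β} (e : Expr)
    (h : ∀ O, ∀ a ∈ S O, (e.eval fun _ => Enc.enc a) = Enc.enc (f O a)) : PTOn S f := by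
  obtain ⟨c, hc⟩ := e.exists_cost_le
  refine ⟨fun k => .assign k (e.atVar k), C c * X + 1, fun O k s a ha hk => ?_⟩
  refine ⟨_, _, Runs.assign O s k _, ?_, ?_, ?_, ?_⟩
  · have := hc (Enc.enc a)
    simp only [Expr.cost_atVar, hk, eval_add, eval_mul, eval_C, eval_X, eval_one, esize]
    omega
  · simp [Expr.eval_atVar, hk, h O.mem a ha]
  · intro j hj
    simp [hj.ne]
  · have h1 := e.size_eval_le_cost fun _ => Enc.enc a
    have h2 := hc (Enc.enc a)
    rw [h O.mem a ha] at h1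
    simp only [eval_add, eval_mul, eval_C, eval_X, eval_one]
    simp only [esize]
    omega

theorem PT.of_expr {f : Orc → α → β} (e : Expr)
    (h : ∀ O a, (e.eval fun _ => Enc.enc a) = Enc.enc (f O a)) : PT f :=
  PTOn.of_expr e fun O a _ => h O a

theorem PTOn.comp {S : Orc → Set α} {g : Orc → β → γ} {f : Orc → α → β} (hg : PT g) (hf : PTOn S f) :
    PTOn S fun O a => g O (f O a) := by
  obtain ⟨P, p, hP⟩ := hf
  obtain ⟨Q, q, hQ⟩ := hg
  refine ⟨fun k => .seq (P k) (Q k), 1 + p + q.comp p, fun O k s a ha hk => ?_⟩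
  obtain ⟨s1, t1, r1, ht1, hv1, hp1, hs1⟩ := hP O k s a ha hk
  obtain ⟨s2, t2, r2, ht2, hv2, hp2, hs2⟩ := hQ O k s1 _ trivial hv1
  have := eval_mono q hs1
  refine ⟨s2, _, r1.seq r2, ?_, hv2, fun j hj => (hp2 j hj).trans (hp1 j hj), ?_⟩
  all_goals simp only [eval_add, eval_one, eval_comp]; omega

theorem PT.comp {g : Orc → β → γ} {f : Orc → α → β} (hg : PT g) (hf : PT f) :
    PT fun O a => g O (f O a) := PTOn.comp hg hf

theorem PTOn.pair {S : Orc → Set α} {f : Orc → α → β} {g : Orc → α → γ} (hf : PTOn S f)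
    (hg : PTOn S g) : PTOn S fun O a => (f O a, g O a) := by
  obtain ⟨P, p, hP⟩ := hf
  obtain ⟨Q, q, hQ⟩ := hg
  -- The argument stays in variable `k`, and the components are computed in variables above it,
  -- because `P (k + 1)` and `Q (k + 2)` preserve all lower ones.
  refine ⟨fun k => .seq (.assign (k + 1) (.var k)) (.seq (P (k + 1)) (.seq
    (.assign (k + 2) (.var k)) (.seq (Q (k + 2))
      (.assign k (.pair (.var (k + 1)) (.var (k + 2))))))),
    3 * p + 3 * q + 2 * X + 8, fun O k s a ha hk => ?_⟩
  obtain ⟨s1, t1, r1, ht1, hv1, hp1, hs1⟩ := hP O (k + 1)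
    (Function.update s (k + 1) (Enc.enc a)) a ha (by simp)
  have hk1 : s1 k = Enc.enc a := by simp [hp1 k (by omega), hk]
  obtain ⟨s2, t2, r2, ht2, hv2, hp2, hs2⟩ := hQ O (k + 2)
    (Function.update s1 (k + 2) (Enc.enc a)) a ha (by simp)
  have hk2 : s2 (k + 1) = Enc.enc (f O.mem a) := by simp [hp2 (k + 1) (by omega), hv1]
  have e1 := Runs.assign O s (k + 1) (.var k)
  have e2 := Runs.assign O s1 (k + 2) (.var k)
  have e3 := Runs.assign O s2 k (.pair (.var (k + 1)) (.var (k + 2)))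
  simp only [Expr.eval, Expr.cost, hk, hk1, hk2, hv2] at e1 e2 e3
  refine ⟨_, _, e1.seq (r1.seq (e2.seq (r2.seq e3))), ?_, by simp; rfl, fun j hj => ?_, ?_⟩
  · simp only [esize] at *
    simp only [Data.size, eval_add, eval_mul, eval_X, eval_ofNat]
    omega
  · have h1 := hp2 j (by omega)
    have h2 := hp1 j (by omega)
    rw [Function.update_of_ne (by omega)] at h1 h2
    rw [Function.update_of_ne (by omega), h1, h2]
  · simp only [esize_pair, eval_add, eval_mul, eval_X, eval_ofNat]
    omega

theorem PT.pair {f : Orc → α → β} {g : Orc → α → γ} (hf : PT f) (hg : PT g) :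
    PT fun O a => (f O a, g O a) := PTOn.pair hf hg

/-- Case distinction: it suffices to compute `f` separately where `b` holds and where it fails. -/
theorem PTOn.split {S : Orc → Set α} {b : Orc → α → Bool} {f : Orc → α → β} (hb : PT b)
    (hf : PTOn (fun O => {a | a ∈ S O ∧ b O a = true}) f)
    (hg : PTOn (fun O => {a | a ∈ S O ∧ b O a = false}) f) : PTOn S f := by
  obtain ⟨B, r, hB⟩ := hb
  obtain ⟨P, p, hP⟩ := hf
  obtain ⟨Q, q, hQ⟩ := hg
  refine ⟨fun k => .seq (.assign (k + 1) (.var k)) (.seq (B (k + 1))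
    (.ite (.var (k + 1)) (P k) (Q k))), p + q + 2 * r + X + 8, fun O k s a ha hk => ?_⟩
  obtain ⟨s1, t1, r1, ht1, hv1, hp1, hs1⟩ := hB O (k + 1)
    (Function.update s (k + 1) (Enc.enc a)) a trivial (by simp)
  have hk1 : s1 k = Enc.enc a := by simp [hp1 k (by omega), hk]
  have hp : ∀ j < k, s1 j = s j := fun j hj => by
    rw [hp1 j (by omega), Function.update_of_ne (by omega)]
  have e1 := Runs.assign O s (k + 1) (.var k)
  simp only [Expr.eval, Expr.cost, hk] at e1
  have hc : (Expr.var (k + 1)).cost s1 = esize (b O.mem a) := by simp [Expr.cost, hv1, esize]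
  cases hba : b O.mem a with
  | true =>
    obtain ⟨s2, t2, r2, ht2, hv2, hp2, hs2⟩ := hP O k s1 a ⟨ha, hba⟩ hk1
    refine ⟨s2, _, e1.seq (r1.seq (Runs.ite_true ?_ r2)), ?_, hv2,
      fun j hj => (hp2 j hj).trans (hp j hj), ?_⟩
    · simp only [Expr.eval, hv1, hba]
      exact Data.noConfusion
    · rw [hc]
      simp only [esize] at *
      simp only [eval_add, eval_mul, eval_X, eval_ofNat]
      omega
    · simp only [eval_add, eval_mul, eval_X, eval_ofNat]
      omega
  | false =>
    obtain ⟨s2, t2, r2, ht2, hv2, hp2, hs2⟩ := hQ O k s1 a ⟨ha, hba⟩ hk1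
    refine ⟨s2, _, e1.seq (r1.seq (Runs.ite_false ?_ r2)), ?_, hv2,
      fun j hj => (hp2 j hj).trans (hp j hj), ?_⟩
    · simp only [Expr.eval, hv1, hba]
      rfl
    · rw [hc]
      simp only [esize] at *
      simp only [eval_add, eval_mul, eval_X, eval_ofNat]
      omega
    · simp only [eval_add, eval_mul, eval_X, eval_ofNat]
      omega

theorem PT.ite {b : Orc → α → Bool} {f g : Orc → α → β} (hb : PT b)
    (hf : PT f) (hg : PT g) : PT fun O a => if b O a then f O a else g O a :=
  PTOn.split hb ((hf.on _).congr fun O a ha => by simp [ha.2])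
    ((hg.on _).congr fun O a ha => by simp [ha.2])

theorem PT.oracle : PT fun O (α : CI) => O α := by
  refine ⟨fun k => .mem k (.var k), X + 3, fun O k s a _ hk => ?_⟩
  refine ⟨_, _, Runs.mem (α := a) hk, ?_, ?_, ?_, ?_⟩
  · simp only [Expr.cost, hk, esize, eval_add, eval_X, eval_ofNat]
    omega
  · simp; rfl
  · intro j hj
    simp [hj.ne]
  · have := esize_bool_le (O.mem a)
    simp only [eval_add, eval_X, eval_ofNat]
    omega

/-- Loops with polynomially many rounds and polynomially bounded intermediate results. -/
theorem PT.loop {f init : Orc → α → β} {test : Orc → β → Bool} {body : Orc → β → β}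
    (hinit : PT init) (htest : PT test) (hbody : PT body) (p q : ℕ[X])
    (h : ∀ O a, ∃ n ≤ p.eval (esize a), f O a = (body O)^[n] (init O a) ∧
      test O (f O a) = false ∧ (∀ i < n, test O ((body O)^[i] (init O a)) = true) ∧
      ∀ i ≤ n, esize ((body O)^[i] (init O a)) ≤ q.eval (esize a)) : PT f := by
  obtain ⟨I, pi, hI⟩ := hinit
  obtain ⟨B, pb, hB⟩ := hbody
  obtain ⟨T, pt, hT⟩ := htest
  -- The test works on a copy in variable `k + 1`, so that the state of the loop in `k` survives.
  let Tst : ℕ → Program := fun k => .seq (.assign (k + 1) (.var k)) (T (k + 1))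
  have htst : ∀ (O : Oracle elLhs) (k : ℕ) (s : Store) (b : β), s k = Enc.enc b →
      ∃ s' t, Runs O (Tst k) s s' t ∧ t ≤ 2 + esize b + pt.eval (esize b) ∧ s' k = Enc.enc b ∧
        s' (k + 1) = Enc.enc (test O.mem b) ∧ (∀ j < k, s' j = s j) := by
    intro O k s b hk
    obtain ⟨s1, t1, r1, ht1, hv1, hp1, -⟩ := hT O (k + 1)
      (Function.update s (k + 1) (Enc.enc b)) b trivial (by simp)
    have e1 := Runs.assign O s (k + 1) (.var k)
    simp only [Expr.eval, Expr.cost, hk] at e1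
    refine ⟨s1, _, e1.seq r1, ?_, by simp [hp1 k (by omega), hk], hv1, fun j hj => ?_⟩
    · simp only [esize] at *
      omega
    · rw [hp1 j (by omega), Function.update_of_ne (by omega)]
  let cb : ℕ[X] := pb + pt + X + 8
  -- As `M` bounds all states, each of the `n` rounds costs at most `cb.eval M`. The final failing
  -- test costs one step and the size of a truth value, which is at most three.
  have hloop : ∀ (O : Oracle elLhs) (k M : ℕ) (n : ℕ) (s : Store) (b : β), s k = Enc.enc b →
      s (k + 1) = Enc.enc (test O.mem b) → test O.mem ((body O.mem)^[n] b) = false →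
      (∀ i < n, test O.mem ((body O.mem)^[i] b) = true) →
      (∀ i ≤ n, esize ((body O.mem)^[i] b) ≤ M) →
      ∃ s' t, Runs O (.while (.var (k + 1)) (.seq (B k) (Tst k))) s s' t ∧
        t ≤ n * cb.eval M + 4 ∧ s' k = Enc.enc ((body O.mem)^[n] b) ∧
        ∀ j < k, s' j = s j := by
    intro O k M n
    induction n with
    | zero =>
      intro s b hk hk1 hf _ _
      rw [Function.iterate_zero, id] at hf
      refine ⟨s, _, Runs.while_false ?_, ?_, hk, fun _ _ => rfl⟩
      · simp only [Expr.eval, hk1, hf]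
        rfl
      · have := esize_bool_le (test O.mem b)
        simp only [Expr.cost, hk1]
        simp only [esize] at this
        omega
    | succ n ih =>
      intro s b hk hk1 hf ht hM
      have h0 : test O.mem b = true := ht 0 (by omega)
      obtain ⟨s1, t1, r1, ht1, hv1, hp1, -⟩ := hB O k s b trivial hk
      obtain ⟨s2, t2, r2, ht2, hv2, hw2, hp2⟩ := htst O k s1 _ hv1
      obtain ⟨s3, t3, r3, ht3, hv3, hp3⟩ := ih s2 (body O.mem b) hv2 hw2 hf
        (fun i hi => ht (i + 1) (by omega)) fun i hi => hM (i + 1) (by omega)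
      refine ⟨s3, _, Runs.while_true ?_ (r1.seq r2) r3, ?_, hv3, fun j hj => ?_⟩
      · simp only [Expr.eval, hk1, h0]
        exact Data.noConfusion
      · have hb0 : esize b ≤ M := hM 0 (by omega)
        have hb1 : esize (body O.mem b) ≤ M := hM 1 (by omega)
        have h1 := eval_mono pb hb0
        have h2 := eval_mono pt hb1
        have h3 := esize_bool_le (test O.mem b)
        simp only [Expr.cost, hk1]
        simp only [esize] at *
        simp only [cb, eval_add, eval_X, eval_ofNat, Nat.add_mul, Nat.one_mul] at *
        omega
      · rw [hp3 j hj, hp2 j hj, hp1 j hj]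
  refine ⟨fun k => .seq (I k) (.seq (Tst k) (.while (.var (k + 1)) (.seq (B k) (Tst k)))),
    pi + q + pt.comp q + p * cb.comp q + 8, fun O k s a _ hk => ?_⟩
  obtain ⟨n, hn, hfn, hff, htt, hq⟩ := h O.mem a
  obtain ⟨s1, t1, r1, ht1, hv1, hp1, -⟩ := hI O k s a trivial hk
  obtain ⟨s2, t2, r2, ht2, hv2, hw2, hp2⟩ := htst O k s1 _ hv1
  obtain ⟨s3, t3, r3, ht3, hv3, hp3⟩ := hloop O k (q.eval (esize a)) n s2 _ hv2 hw2
    (by rwa [← hfn]) htt hq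
  have h0 : esize (init O.mem a) ≤ q.eval (esize a) := hq 0 (by omega)
  have h1 := eval_mono pt h0
  have h2 := Nat.mul_le_mul_right (cb.eval (q.eval (esize a))) hn
  refine ⟨s3, _, r1.seq (r2.seq r3), ?_, by rw [hv3, hfn],
    fun j hj => by rw [hp3 j hj, hp2 j hj, hp1 j hj], ?_⟩
  · simp only [eval_add, eval_mul, eval_comp, eval_ofNat]
    omega
  · have := hq n le_rfl
    rw [← hfn] at this
    simp only [eval_add, eval_mul, eval_comp, eval_ofNat]
    omega

theorem PTOn.exists_size_le {S : Orc → Set α} {f : Orc → α → β} (h : PTOn S f) :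
    ∃ p : ℕ[X], ∀ (O : Oracle elLhs), ∀ a ∈ S O.mem, esize (f O.mem a) ≤ p.eval (esize a) := by
  obtain ⟨P, p, hP⟩ := h
  refine ⟨p, fun O a ha => ?_⟩
  obtain ⟨-, -, -, -, -, -, h⟩ := hP O 0 (fun _ => Enc.enc a) a ha rfl
  exact h

theorem PT.exists_size_le {f : Orc → α → β} (h : PT f) :
    ∃ p : ℕ[X], ∀ O a, esize (f O a) ≤ p.eval (esize a) := by
  obtain ⟨p, hp⟩ := PTOn.exists_size_le h
  -- Only membership answers matter for the value, so `O` can be completed by any equivalence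
  -- oracle.
  exact ⟨p, fun O a => hp ⟨O, fun _ _ => none⟩ a trivial⟩

end ExactLearning

namespace ExactLearning

open Polynomial

variable {α β γ δ : Type} [Enc α] [Enc β] [Enc γ] [Enc δ]

/-- It suffices to compute the value from the parts of the argument. -/
theorem PTOn.of_parts {S : Orc → Set α} {f : Orc → α → β} {h : Orc → δ → β} (hh : PT h) (e : Expr)
    (H : ∀ O, ∀ a ∈ S O, ∃ d, (e.eval fun _ => Enc.enc a) = Enc.enc d ∧ f O a = h O d) :
    PTOn S f := by
  classical
  by_cases hne : Nonempty δ
  · let part : Orc → α → δ := fun O a =>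
      if ha : a ∈ S O then (H O a ha).choose else Classical.choice hne
    have hp : PTOn S part := PTOn.of_expr e fun O a ha => by
      simp only [part, ha, dif_pos]
      exact (H O a ha).choose_spec.1
    refine (PTOn.comp hh hp).congr fun O a ha => ?_
    simp only [part, ha, dif_pos]
    exact (H O a ha).choose_spec.2
  -- Without possible parts there is no admissible argument, and any program will do.
  · exact ⟨fun _ => .skip, 0, fun O k s a ha _ => (hne ⟨(H O.mem a ha).choose⟩).elim⟩

/-! ### Basic operations: projections, Booleans, case distinction on lists -/

namespace PT

theorem id : PT fun _ (a : α) => a := PT.of_expr (.var 0) fun _ _ => rfl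

theorem fst' : PT fun _ (p : α × β) => p.1 := PT.of_expr (.fst (.var 0)) fun _ _ => rfl

theorem snd' : PT fun _ (p : α × β) => p.2 := PT.of_expr (.snd (.var 0)) fun _ _ => rfl

theorem fst {f : Orc → α → β × γ} (h : PT f) : PT fun O a => (f O a).1 := fst'.comp h

theorem snd {f : Orc → α → β × γ} (h : PT f) : PT fun O a => (f O a).2 := snd'.comp h

theorem comp₂ {g : Orc → β → γ → δ} {f : Orc → α → β} {h : Orc → α → γ}
    (hg : PT fun O (p : β × γ) => g O p.1 p.2) (hf : PT f) (hh : PT h) :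
    PT fun O a => g O (f O a) (h O a) := hg.comp (hf.pair hh)

theorem nil : PT fun _ (_ : α) => ([] : List β) := PT.of_expr .nil fun _ _ => rfl

theorem true : PT fun _ (_ : α) => true := PT.of_expr (.pair .nil .nil) fun _ _ => rfl

theorem false : PT fun _ (_ : α) => false := PT.of_expr .nil fun _ _ => rfl

theorem cons {f : Orc → α → β} {g : Orc → α → List β} (hf : PT f) (hg : PT g) :
    PT fun O a => f O a :: g O a :=
  PT.comp (g := fun _ (p : β × List β) => p.1 :: p.2)
    (PT.of_expr (.pair (.fst (.var 0)) (.snd (.var 0))) fun _ _ => rfl) (hf.pair hg)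

theorem decide_eq [DecidableEq β] {f g : Orc → α → β} (hf : PT f) (hg : PT g) :
    PT fun O a => decide (f O a = g O a) :=
  PT.comp (g := fun _ (p : β × β) => decide (p.1 = p.2))
    (PT.of_expr (.eq (.fst (.var 0)) (.snd (.var 0))) fun _ p => by
      change Data.ofBool (decide (Enc.enc p.1 = Enc.enc p.2)) = Data.ofBool _
      simp [Enc.inj.eq_iff]) (hf.pair hg)

theorem and {f g : Orc → α → Bool} (hf : PT f) (hg : PT g) : PT fun O a => f O a && g O a :=
  (hf.ite hg PT.false).congr fun O a => by cases f O a <;> rfl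

theorem or {f g : Orc → α → Bool} (hf : PT f) (hg : PT g) : PT fun O a => f O a || g O a :=
  (hf.ite PT.true hg).congr fun O a => by cases f O a <;> rfl

theorem not {f : Orc → α → Bool} (hf : PT f) : PT fun O a => !f O a :=
  (hf.ite PT.false PT.true).congr fun O a => by cases f O a <;> rfl

/-- The stack machine for recursion has no result before it halts, so it keeps the result in a list
that is empty until then. Here the list is unwrapped. -/
theorem of_singleton {f : Orc → α → β} (h : PT fun O a => [f O a]) : PT f :=
  let ⟨P, p, hP⟩ := PTOn.comp (S := fun _ => Set.univ) PT.id h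
  ⟨fun k => .seq (P k) (.assign k (.fst (.var k))), p + p + p + 3, fun O k s a _ hk => by
    obtain ⟨s1, t1, r1, ht1, hv1, hp1, hs1⟩ := hP O k s a trivial hk
    have e1 := Runs.assign O s1 k (.fst (.var k))
    simp only [Expr.eval, Expr.cost, hv1] at e1
    change esize (f O.mem a) + 1 + 1 ≤ _ at hs1
    refine ⟨_, _, r1.seq e1, ?_, by simp; rfl, fun j hj => by simp [hj.ne, hp1 j hj], ?_⟩
    · change 1 + t1 + (1 + (esize (f O.mem a) + 1 + 1 + esize (f O.mem a))) ≤ _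
      simp only [eval_add, eval_ofNat]
      omega
    · simp only [eval_add, eval_ofNat]
      omega⟩

/-- A non-empty list is represented by a pair and the empty list by `nil`, so the pair test decides.
The context that both branches need is passed along in `c`. -/
theorem list_cases {f : Orc → γ → List β → δ} {c : Orc → α → γ} {l : Orc → α → List β}
    (hc : PT c) (hl : PT l) (hnil : PT fun O c => f O c [])
    (hcons : PT fun O (p : γ × β × List β) => f O p.1 (p.2.1 :: p.2.2)) :
    PT fun O a => f O (c O a) (l O a) := by
  refine PT.comp (g := fun O (p : γ × List β) => f O p.1 p.2) ?_ (hc.pair hl)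
  refine PTOn.split (b := fun _ p => !p.2.isEmpty)
    (PT.of_expr (.isPair (.snd (.var 0))) ?_) ?_ ?_
  · rintro O ⟨c, _ | ⟨a, l⟩⟩ <;> rfl
  · refine PTOn.of_parts hcons (.var 0) ?_
    rintro O ⟨c, _ | ⟨a, l⟩⟩ h
    · simp at h
    · exact ⟨(c, a, l), rfl, rfl⟩
  · refine (PT.comp hnil fst').on _ |>.congr ?_
    rintro O ⟨c, _ | ⟨a, l⟩⟩ h
    · rfl
    · simp at h

end PT

/-! ### Recursion -/

section Recursion

variable (sub : Orc → α → List α) (g : Orc → α → List β → β)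

/-- One step of the stack machine that computes `f x = g x (map f (sub x)).reverse`. An element
of the stack consists of an argument, the arguments of the recursive calls still to be made for
it, and the values of those already made. The second component receives the result. -/
def recStep (O : Orc) (s : List (α × List α × List β) × List β) :
    List (α × List α × List β) × List β :=
  match s with
  | ([], res) => ([], res)
  | ((x, [], vs) :: [], _) => ([], [g O x vs])
  | ((x, [], vs) :: (x', p, vs') :: F, res) => ((x', p, g O x vs :: vs') :: F, res)
  | ((x, y :: p, vs) :: F, res) => ((y, sub O y, []) :: (x, p, vs) :: F, res)

variable {sub g}

/-- The nested case distinctions follow the definition of `recStep`: on the stack, on the pending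
calls of its top element, and on the rest of the stack. -/
theorem PT.recStep (hsub : PT sub) (hg : PT fun O (p : α × List β) => g O p.1 p.2) :
    PT (recStep sub g) := by
  refine PT.congr (list_cases (f := fun O (res : List β) (F : List (α × List α × List β)) =>
    ExactLearning.recStep sub g O (F, res)) (c := fun _ (s : List (α × List α × List β) × List β) => s.2) (l := fun _ s => s.1)
    (snd id) (fst id) ?_ ?_) fun O s => rfl
  · exact nil.pair id
  · refine PT.congr (list_cases
      (f := fun O (c : (List β × List (α × List α × List β)) × α × List β) (p : List α) =>
        ExactLearning.recStep sub g O ((c.2.1, p, c.2.2) :: c.1.2, c.1.1))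
      (c := fun _ (p : List β × (α × List α × List β) × List (α × List α × List β)) =>
        ((p.1, p.2.2), (p.2.1.1, p.2.1.2.2))) (l := fun _ p => p.2.1.2.1)
      (((fst id).pair (snd (snd id))).pair
        ((fst (fst (snd id))).pair (snd (snd (fst (snd id)))))) (fst (snd (fst (snd id)))) ?_ ?_)
      fun O s => rfl
    · refine PT.congr (list_cases
        (f := fun O (c : (α × List β) × List β) (F : List (α × List α × List β)) =>
          ExactLearning.recStep sub g O ((c.1.1, [], c.1.2) :: F, c.2))
        (c := fun _ (p : (List β × List (α × List α × List β)) × α × List β) => (p.2, p.1.1)) (l := fun _ p => p.1.2)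
        (PT.pair (snd id) (fst (fst id))) (snd (fst id)) ?_ ?_) fun O s => rfl
      · exact PT.pair nil (cons (hg.comp₂ (fst (fst id)) (snd (fst id))) nil)
      · exact (cons ((fst (fst (snd id))).pair ((fst (snd (fst (snd id)))).pair
          (cons (hg.comp₂ (fst (fst (fst id))) (snd (fst (fst id)))) (snd (snd (fst (snd id)))))))
            (snd (snd id))).pair (snd (fst id))
    · exact (cons ((fst (snd id)).pair ((hsub.comp (fst (snd id))).pair nil))
        (cons ((fst (snd (fst id))).pair ((snd (snd id)).pair (snd (snd (fst id)))))
          (snd (fst (fst id))))).pair (fst (fst (fst id)))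

/-- The elements of the stack `F` below an element with argument `y` belong to the recursive
evaluation of `f` at `x₀`, and the topmost of them waits for the value of `f` at `y`. -/
def Waits (sub : α → List α) (f : α → β) (N : ℕ) (x₀ : α) : α → List (α × List α × List β) → Prop
  | y, [] => y = x₀
  | y, (x, p, vs) :: F => (∃ d, sub x = d ++ y :: p ∧ vs = (d.map f).reverse) ∧
      esize x ≤ N ∧ Waits sub f N x₀ x F

/-- The invariant of the stack machine. -/
def RecInv (sub : α → List α) (f : α → β) (N : ℕ) (x₀ : α) :
    List (α × List α × List β) × List β → Prop
  | ([], res) => res = [f x₀]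
  | ((x, p, vs) :: F, _) => (∃ d, sub x = d ++ p ∧ vs = (d.map f).reverse) ∧
      esize x ≤ N ∧ Waits sub f N x₀ x F

/-- A bound on the number of steps that remain to be made. -/
def recWork (cnt : α → ℕ) (F : List (α × List α × List β)) : ℕ :=
  (F.map fun e => 1 + (e.2.1.map fun y => 2 * cnt y).sum).sum

/-- A push trades the summand `2 * cnt y` for one plus twice the counts of the calls made by `y`,
which is less by `hcnt`; a pop removes the one of the finished element. The state grows by a list of
calls or a value, up to a constant. -/
theorem recStep_spec {O : Orc} {f : α → β} {cnt : α → ℕ} {N Q B : ℕ} {x₀ : α}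
    (hf : ∀ x, f x = g O x ((sub O x).map f).reverse)
    (hcnt : ∀ x, 1 + ((sub O x).map cnt).sum ≤ cnt x)
    (hs : ∀ x, ∀ y ∈ sub O x, esize y ≤ esize x)
    (hQ : ∀ x, esize x ≤ N → esize (f x) ≤ Q) (hB : ∀ x, esize x ≤ N → esize (sub O x) ≤ B)
    (s : List (α × List α × List β) × List β) (hI : RecInv (sub O) f N x₀ s) (hne : s.1 ≠ []) :
    RecInv (sub O) f N x₀ (recStep sub g O s) ∧
      recWork cnt (recStep sub g O s).1 < recWork cnt s.1 ∧
      esize (recStep sub g O s) ≤ esize s + (N + Q + B + 8) := by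
  obtain ⟨F, res⟩ := s
  match F, hne with
  | (x, [], vs) :: [], _ =>
    obtain ⟨⟨d, hd, rfl⟩, hx, hw⟩ := hI
    have hw : x = x₀ := hw
    have hv : g O x (d.map f).reverse = f x := by rw [hf x, hd, List.append_nil]
    have := hQ x hx
    refine ⟨?_, ?_, ?_⟩
    · subst hw; simp [recStep, RecInv, hv]
    · simp [recStep, recWork]
    · simp [recStep, hv]
      omega
  | (x, [], vs) :: (x', p, vs') :: F, _ =>
    obtain ⟨⟨d, hd, rfl⟩, hx, ⟨d', hd', rfl⟩, hx', hw⟩ := hI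
    have hv : g O x (d.map f).reverse = f x := by rw [hf x, hd, List.append_nil]
    have := hQ x hx
    refine ⟨⟨⟨d' ++ [x], by simp [hd'], by simp [hv]⟩, hx', hw⟩, ?_, ?_⟩
    · simp [recStep, recWork]
    · simp [recStep, hv]
      omega
  | (x, y :: p, vs) :: F, _ =>
    obtain ⟨⟨d, hd, rfl⟩, hx, hw⟩ := hI
    have hy : esize y ≤ N := (hs x y (by simp [hd])).trans hx
    have := hB y hy
    refine ⟨⟨⟨[], rfl, rfl⟩, hy, ⟨d, hd, rfl⟩, hx, hw⟩, ?_, ?_⟩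
    · have := hcnt y
      simp only [recStep, recWork, List.map_cons, List.sum_cons, List.sum_map_mul_left]
      omega
    · simp [recStep]
      omega

/-- Recursive functions are computable in polynomial time if the number of recursive calls and
the sizes of all values are polynomially bounded and arguments do not grow. -/
theorem PT.recursion_reverse {f : Orc → α → β} (hsub : PT sub)
    (hg : PT fun O (p : α × List β) => g O p.1 p.2)
    (hf : ∀ O x, f O x = g O x ((sub O x).map (f O)).reverse)
    (hs : ∀ O x, ∀ y ∈ sub O x, esize y ≤ esize x)
    (cnt : Orc → α → ℕ) (hcnt : ∀ O x, 1 + ((sub O x).map (cnt O)).sum ≤ cnt O x)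
    (p q : ℕ[X]) (hp : ∀ O x, cnt O x ≤ p.eval (esize x))
    (hq : ∀ O x, esize (f O x) ≤ q.eval (esize x)) : PT f := by
  obtain ⟨r, hr⟩ := hsub.exists_size_le
  refine PT.of_singleton (PT.snd (β := List (α × List α × List β))
    (f := fun O x => ([], [f O x])) ?_)
  refine PT.loop (init := fun O x => ([(x, sub O x, [])], [])) (body := ExactLearning.recStep sub g)
    (test := fun _ s => !s.1.isEmpty)
    ((cons (id.pair (hsub.pair nil)) nil).pair nil) ?_ (PT.recStep hsub hg)
    -- The initial stack has work at most `2 * cnt`, which bounds the number of steps. A state is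
    -- bounded by the initial one plus the number of steps times the growth per step.
    (2 * p) ((2 * X + r + 8) + 2 * p * (X + q + r + 8)) ?_
  · refine list_cases (f := fun _ (_ : Bool) l => !l.isEmpty) PT.false (fst id) PT.false PT.true
  intro O x₀
  set N := esize x₀
  set s₀ : List (α × List α × List β) × List β := ([(x₀, sub O x₀, [])], [])
  set Δ := N + q.eval N + r.eval N + 8
  have key : ∀ n s, RecInv (sub O) (f O) N x₀ s → recWork (cnt O) s.1 ≤ n →
      ∃ m ≤ n, (ExactLearning.recStep sub g O)^[m] s = ([], [f O x₀]) ∧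
        (∀ i < m, ((ExactLearning.recStep sub g O)^[i] s).1 ≠ []) ∧
        ∀ i ≤ m, esize ((ExactLearning.recStep sub g O)^[i] s) ≤ esize s + i * Δ := by
    intro n
    induction n with
    | zero =>
      rintro ⟨F, res⟩ hI hw
      cases F with
      | nil =>
        obtain rfl : res = _ := hI
        exact ⟨0, le_rfl, rfl, by simp, by simp⟩
      | cons e F => simp [recWork] at hw
    | succ n ih =>
      rintro ⟨F, res⟩ hI hw
      cases F with
      | nil =>
        obtain rfl : res = _ := hI
        exact ⟨0, by omega, rfl, by simp, by simp⟩
      | cons e F =>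
        obtain ⟨h1, h2, h3⟩ := recStep_spec (g := g) (cnt := cnt O) (Q := q.eval N) (B := r.eval N)
          (hf O) (hcnt O) (hs O)
          (fun x hx => (hq O x).trans (eval_mono q hx))
          (fun x hx => (hr O x).trans (eval_mono r hx)) (e :: F, res) hI (by simp)
        obtain ⟨m, hm, hm1, hm2, hm3⟩ := ih _ h1 (by omega)
        refine ⟨m + 1, by omega, hm1, ?_, ?_⟩
        · rintro (_ | i) hi
          · simp
          · exact hm2 i (by omega)
        · rintro (_ | i) hi
          · simp
          · have := hm3 i (by omega)
            rw [Function.iterate_succ_apply, Nat.add_mul, Nat.one_mul]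
            change _ ≤ _ + (N + q.eval N + r.eval N + 8) at h3
            omega
  have hw₀ : recWork (cnt O) s₀.1 ≤ 2 * cnt O x₀ := by
    have := hcnt O x₀
    simp only [s₀, recWork, List.map_cons, List.sum_cons, List.sum_map_mul_left, List.map_nil,
      List.sum_nil]
    omega
  have hpN : cnt O x₀ ≤ p.eval N := hp O x₀
  obtain ⟨m, hm, hm1, hm2, hm3⟩ := key _ s₀ ⟨⟨[], rfl, rfl⟩, le_rfl, rfl⟩ hw₀
  have hpN := hp O x₀
  refine ⟨m, ?_, hm1.symm, rfl, fun i hi => ?_, fun i hi => (hm3 i hi).trans ?_⟩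
  · simp only [eval_mul, eval_ofNat]
    omega
  · have := hm2 i hi
    cases h : ((ExactLearning.recStep sub g O)^[i] s₀).1 with
    | nil => exact absurd h this
    | cons a l => rfl
  · have h1 : i * Δ ≤ 2 * p.eval N * Δ := Nat.mul_le_mul_right _ (by omega)
    have h2 : esize (sub O x₀) ≤ r.eval N := hr O x₀
    have h3 : esize s₀ = N + esize (sub O x₀) + 7 := by simp [s₀, N]; omega
    simp only [eval_mul, eval_ofNat, eval_add, eval_X]
    change _ + i * Δ ≤ _ + 2 * p.eval N * Δ
    omega

end Recursion

end ExactLearning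

namespace ExactLearning

open Polynomial

variable {α β γ δ ε : Type} [Enc α] [Enc β] [Enc γ] [Enc δ] [Enc ε]

/-! ### Functions on lists and recursion on concept expressions -/

namespace PT

theorem headD {l : Orc → α → List β} {d : Orc → α → β} (hl : PT l) (hd : PT d) :
    PT fun O a => (l O a).headD (d O a) :=
  list_cases (f := fun _ (d : β) l => l.headD d) hd hl id (fst (snd id))

theorem tail {l : Orc → α → List β} (hl : PT l) : PT fun O a => (l O a).tail :=
  list_cases (f := fun _ (_ : Bool) l => l.tail) PT.true hl nil (snd (snd id))

/-- Primitive recursion on lists. -/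
theorem list_rec {f : Orc → γ → List α → β} {z : Orc → γ → β}
    {k : Orc → γ → α → List α → β → β} (hz : PT z)
    (hk : PT fun O (p : γ × α × List α × β) => k O p.1 p.2.1 p.2.2.1 p.2.2.2)
    (hnil : ∀ O c, f O c [] = z O c) (hcons : ∀ O c a l, f O c (a :: l) = k O c a l (f O c l))
    (q : ℕ[X]) (hq : ∀ O c l, esize (f O c l) ≤ q.eval (esize c + esize l))
    {c : Orc → δ → γ} {l : Orc → δ → List α} (hc : PT c) (hl : PT l) :
    PT fun O a => f O (c O a) (l O a) := by
  refine PT.comp₂ (g := f) ?_ hc hl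
  let sub : Orc → γ × List α → List (γ × List α) := fun _ x =>
    (fun (c : γ) l => match l with | [] => [] | _ :: l => [(c, l)]) x.1 x.2
  -- The list in the context holds the value of the single recursive call; the default in `headD`
  -- only makes `g` total.
  let g : Orc → γ × List α → List β → β := fun O x vs =>
    (fun (c : γ × List β) l => match l with
      | [] => z O c.1
      | a :: l => k O c.1 a l (c.2.headD (z O c.1))) (x.1, vs) x.2
  refine recursion_reverse (sub := sub) (g := g) ?_ ?_ ?_ ?_ (fun _ x => esize x.2) ?_ X
    q (fun O x => ?_) (fun O x => (hq O _ _).trans (eval_mono q ?_))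
  · exact list_cases (f := fun _ (c : γ) (l : List α) =>
      match l with | [] => [] | _ :: l => [(c, l)]) (fst id) (snd id) nil
      (cons ((fst id).pair (snd (snd id))) nil)
  · refine list_cases (f := fun O (c : γ × List β) (l : List α) => match l with
      | [] => z O c.1
      | a :: l => k O c.1 a l (c.2.headD (z O c.1)))
      (c := fun _ (p : (γ × List α) × List β) => (p.1.1, p.2))
      ((fst (fst id)).pair (snd id)) (snd (fst id)) (hz.comp (fst id)) ?_
    exact hk.comp ((fst (fst id)).pair ((fst (snd id)).pair ((snd (snd id)).pair
      (headD (snd (fst id)) (hz.comp (fst (fst id)))))))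
  · rintro O ⟨c, _ | ⟨a, l⟩⟩
    · simp [g, hnil]
    · simp [g, sub, hcons]
  · rintro O ⟨c, _ | ⟨a, l⟩⟩ y hy
    · simp [sub] at hy
    · obtain rfl : y = (c, l) := by simpa [sub] using hy
      simp
      omega
  · rintro O ⟨c, _ | ⟨a, l⟩⟩
    · simp [sub]
    · have := esize_pos a
      simp [sub]
      omega
  · simp
    omega
  · simp

theorem append {l m : Orc → α → List β} (hl : PT l) (hm : PT m) : PT fun O a => l O a ++ m O a :=
  list_rec (f := fun _ (m : List β) l => l ++ m) (z := fun _ m => m) (k := fun _ _ a _ r => a :: r)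
    id (cons (fst (snd id)) (snd (snd (snd id)))) (fun _ _ => rfl) (fun _ _ _ _ => rfl) X
    (fun _ m l => by have := esize_append l m; simp; omega) hm hl

theorem esize_reverse (l : List α) : esize l.reverse = esize l := by
  induction l with
  | nil => rfl
  | cons a l ih =>
    have := esize_append l.reverse [a]
    rw [List.reverse_cons]
    simp only [esize_cons, esize_nil] at this ⊢
    omega

theorem reverse {l : Orc → α → List β} (hl : PT l) : PT fun O a => (l O a).reverse :=
  list_rec (f := fun _ (_ : Bool) (l : List β) => l.reverse) (z := fun _ _ => [])
    (k := fun _ _ a _ r => r ++ [a]) nil (append (snd (snd (snd id))) (cons (fst (snd id)) nil))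
    (fun _ _ => rfl) (fun _ _ _ _ => by simp) X
    (fun _ m l => by have := esize_reverse l; simp; omega) PT.true hl

theorem map {l : Orc → α → List β} {k : Orc → α → β → γ} (hl : PT l)
    (hk : PT fun O (p : α × β) => k O p.1 p.2) : PT fun O a => (l O a).map (k O a) := by
  obtain ⟨p, hp⟩ := hk.exists_size_le
  refine list_rec (f := fun O (a : α) (l : List β) => l.map (k O a)) (z := fun _ _ => [])
    (k := fun O a b _ r => k O a b :: r) nil
    (cons (hk.comp₂ (fst id) (fst (snd id))) (snd (snd (snd id))))
    -- The number of elements times the largest possible value; `X + 1` accounts for the node that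
    -- pairs the context with an element.
    (fun _ _ => rfl) (fun _ _ _ _ => by simp) (X * (p.comp (X + 1) + 1) + 1)
    (fun O a l => ?_) id hl
  refine (esize_list_le _ (p.eval (esize a + esize l + 1)) ?_).trans ?_
  · intro c hc
    obtain ⟨b, hb, rfl⟩ := List.mem_map.1 hc
    refine (hp O (a, b)).trans (eval_mono p ?_)
    have := esize_le_of_mem hb
    simp
    omega
  · have := length_lt_esize l
    simp only [List.length_map, eval_add, eval_mul, eval_X, eval_comp, eval_one]
    gcongr
    omega

theorem esize_filter_le (l : List α) (f : α → Bool) : esize (l.filter f) ≤ esize l := by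
  induction l with
  | nil => simp
  | cons a l ih =>
    rw [List.filter_cons]
    split <;> simp <;> omega

theorem filter {l : Orc → α → List β} {k : Orc → α → β → Bool} (hl : PT l)
    (hk : PT fun O (p : α × β) => k O p.1 p.2) : PT fun O a => (l O a).filter (k O a) :=
  list_rec (f := fun O (a : α) (l : List β) => l.filter (k O a)) (z := fun _ _ => [])
    (k := fun O a b _ r => if k O a b then b :: r else r) nil
    (ite (hk.comp₂ (fst id) (fst (snd id))) (cons (fst (snd id)) (snd (snd (snd id))))
      (snd (snd (snd id)))) (fun _ _ => rfl) (fun _ _ _ _ => List.filter_cons) X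
    (fun O a l => by have := esize_filter_le l (k O a); simp; omega) id hl

theorem any {l : Orc → α → List β} {k : Orc → α → β → Bool} (hl : PT l)
    (hk : PT fun O (p : α × β) => k O p.1 p.2) : PT fun O a => (l O a).any (k O a) :=
  list_rec (f := fun O (a : α) (l : List β) => l.any (k O a)) (z := fun _ _ => Bool.false)
    (k := fun O a b _ r => k O a b || r) PT.false
    (or (hk.comp₂ (fst id) (fst (snd id))) (snd (snd (snd id))))
    (fun _ _ => rfl) (fun _ _ _ _ => by simp) 3
    (fun O a l => by simpa using esize_bool_le _) id hl

theorem all {l : Orc → α → List β} {k : Orc → α → β → Bool} (hl : PT l)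
    (hk : PT fun O (p : α × β) => k O p.1 p.2) : PT fun O a => (l O a).all (k O a) :=
  (not (any hl (not hk))).congr fun O a => by rw [List.all_eq_not_any_not]

theorem mem [DecidableEq β] {b : Orc → α → β} {l : Orc → α → List β} (hb : PT b) (hl : PT l) :
    PT fun O a => decide (b O a ∈ l O a) :=
  (any (k := fun O a c => decide (c = b O a)) hl (decide_eq (snd id) (hb.comp (fst id)))).congr fun O a => by
    rw [Bool.eq_iff_iff]; simp

theorem flatMap {l : Orc → α → List β} {k : Orc → α → β → List γ} (hl : PT l)
    (hk : PT fun O (p : α × β) => k O p.1 p.2) : PT fun O a => (l O a).flatMap (k O a) := by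
  obtain ⟨p, hp⟩ := hk.exists_size_le
  refine list_rec (f := fun O (a : α) (l : List β) => l.flatMap (k O a)) (z := fun _ _ => [])
    (k := fun O a b _ r => k O a b ++ r) nil
    (append (hk.comp₂ (fst id) (fst (snd id))) (snd (snd (snd id))))
    (fun _ _ => rfl) (fun _ _ _ _ => by simp) (X * p.comp (X + 1) + 1)
    (fun O a l => ?_) id hl
  have key : ∀ N, ∀ m : List β, (∀ b ∈ m, esize b ≤ N) →
      esize (m.flatMap (k O a)) ≤ m.length * p.eval (esize a + N + 1) + 1 := by
    intro N m
    induction m with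
    | nil => simp
    | cons b m ih =>
      intro h
      have h1 := ih fun c hc => h c (by simp [hc])
      have h2 := esize_append (k O a b) (m.flatMap (k O a))
      have h3 := (hp O (a, b)).trans (eval_mono p (n := esize a + N + 1)
        (by have := h b (by simp); simp; omega))
      simp only [List.flatMap_cons, List.length_cons, Nat.add_mul, Nat.one_mul] at *
      omega
  refine (key (esize l) l fun b hb => esize_le_of_mem hb).trans ?_
  have := length_lt_esize l
  simp only [eval_add, eval_mul, eval_X, eval_comp, eval_one]
  gcongr
  omega

/-- Iteration of a function, with the length of a list as the number of iterations. -/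
theorem iterate {f : Orc → γ → β → β} {z : Orc → γ → β}
    (hf : PT fun O (p : γ × β) => f O p.1 p.2) (hz : PT z)
    (q : ℕ[X]) (hq : ∀ O c n, esize ((f O c)^[n] (z O c)) ≤ q.eval (esize c))
    {c : Orc → α → γ} {l : Orc → α → List δ} (hc : PT c) (hl : PT l) :
    PT fun O a => (f O (c O a))^[(l O a).length] (z O (c O a)) :=
  list_rec (f := fun O (c : γ) (l : List δ) => (f O c)^[l.length] (z O c)) (z := z)
    (k := fun O c _ _ r => f O c r) hz (hf.comp₂ (fst id) (snd (snd (snd id))))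
    (fun _ _ => rfl) (fun _ _ _ _ => by simp [Function.iterate_succ_apply']) q
    (fun O c l => (hq O c _).trans (eval_mono q (by omega))) hc hl

theorem recursion {sub : Orc → α → List α} {g : Orc → α → List β → β} {f : Orc → α → β}
    (hsub : PT sub) (hg : PT fun O (p : α × List β) => g O p.1 p.2)
    (hf : ∀ O x, f O x = g O x ((sub O x).map (f O)))
    (hs : ∀ O x, ∀ y ∈ sub O x, esize y ≤ esize x)
    (cnt : Orc → α → ℕ) (hcnt : ∀ O x, 1 + ((sub O x).map (cnt O)).sum ≤ cnt O x)
    (p q : ℕ[X]) (hp : ∀ O x, cnt O x ≤ p.eval (esize x))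
    (hq : ∀ O x, esize (f O x) ≤ q.eval (esize x)) : PT f :=
  recursion_reverse (g := fun O x vs => g O x vs.reverse) hsub
    (hg.comp₂ (fst id) (reverse (snd id))) (fun O x => by rw [List.reverse_reverse, hf]) hs cnt hcnt
    p q hp hq

/-! ### Concept expressions -/

theorem name {f : Orc → α → ConceptName} (hf : PT f) : PT fun O a => ELConcept.name (f O a) :=
  PT.comp (g := fun _ A => ELConcept.name A) (PT.of_expr (.var 0) fun _ _ => rfl) hf

theorem top : PT fun _ (_ : α) => ELConcept.top := PT.of_expr .nil fun _ _ => rfl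

theorem conj {f g : Orc → α → ELConcept} (hf : PT f) (hg : PT g) :
    PT fun O a => (f O a).conj (g O a) :=
  PT.comp (g := fun _ (p : ELConcept × ELConcept) => p.1.conj p.2)
    (PT.of_expr (.pair .nil (.var 0)) fun _ _ => rfl) (hf.pair hg)

theorem ex {f : Orc → α → Role} {g : Orc → α → ELConcept} (hf : PT f) (hg : PT g) :
    PT fun O a => (g O a).ex (f O a).name :=
  PT.comp (g := fun _ (p : Role × ELConcept) => p.2.ex p.1.name)
    (PT.of_expr (.var 0) fun _ _ => rfl) (hf.pair hg)

theorem ci {f : Orc → α → ELConcept} {g : Orc → α → ConceptName} (hf : PT f) (hg : PT g) :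
    PT fun O a => CI.mk (f O a) (g O a) :=
  PT.comp (g := fun _ (p : ELConcept × ConceptName) => CI.mk p.1 p.2)
    (PT.of_expr (.var 0) fun _ _ => rfl) (hf.pair hg)

theorem query {f : Orc → α → ELConcept} {g : Orc → α → ConceptName} (hf : PT f) (hg : PT g) :
    PT fun O a => O ⟨f O a, g O a⟩ := PT.oracle.comp (ci hf hg)

/-- The constructors are told apart by machine tests: conjunctions and existential restrictions are
pairs, and among these the conjunctions have first component `nil`; among the leaves, `nil` is `⊤`.
-/
theorem concept_cases {f : Orc → γ → ELConcept → δ} {c : Orc → α → γ} {C : Orc → α → ELConcept}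
    (hc : PT c) (hC : PT C) (htop : PT fun O c => f O c .top)
    (hname : PT fun O (p : γ × ConceptName) => f O p.1 (.name p.2))
    (hconj : PT fun O (p : γ × ELConcept × ELConcept) => f O p.1 (.conj p.2.1 p.2.2))
    (hex : PT fun O (p : γ × Role × ELConcept) => f O p.1 (.ex p.2.1.name p.2.2)) :
    PT fun O a => f O (c O a) (C O a) := by
  refine PT.comp (g := fun O (p : γ × ELConcept) => f O p.1 p.2) ?_ (hc.pair hC)
  refine PTOn.split (b := fun _ p => match p.2 with | .conj _ _ => .true | .ex _ _ => .true | _ => .false)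
    (PT.of_expr (.isPair (.snd (.var 0))) ?_)
    (PTOn.split (b := fun _ p => match p.2 with | .ex _ _ => .false | _ => .true)
      (PT.of_expr (.eq .nil (.fst (.snd (.var 0)))) ?_) ?_ ?_)
    (PTOn.split (b := fun _ p => match p.2 with | .top => .true | _ => .false)
      (PT.of_expr (.eq .nil (.snd (.var 0))) ?_) ?_ ?_)
  · rintro O ⟨c, _ | _ | _ | _⟩ <;> rfl
  · rintro O ⟨c, _ | _ | _ | _⟩ <;> rfl
  · refine PTOn.of_parts hconj (.pair (.fst (.var 0)) (.snd (.snd (.var 0)))) ?_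
    rintro O ⟨c, _ | _ | _ | _⟩ h
    all_goals try simp at h
    exact ⟨(c, _, _), rfl, rfl⟩
  · refine PTOn.of_parts hex (.var 0) ?_
    rintro O ⟨c, _ | _ | _ | ⟨r, C⟩⟩ h
    all_goals try simp at h
    exact ⟨(c, ⟨r⟩, C), rfl, rfl⟩
  · rintro O ⟨c, _ | _ | _ | _⟩ <;> rfl
  · refine PTOn.of_parts htop (.fst (.var 0)) ?_
    rintro O ⟨c, _ | _ | _ | _⟩ h
    all_goals try simp at h
    exact ⟨c, rfl, rfl⟩
  · refine PTOn.of_parts hname (.var 0) ?_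
    rintro O ⟨c, _ | A | _ | _⟩ h
    all_goals try simp at h
    exact ⟨(c, A), rfl, rfl⟩

/-- Structural recursion on concept expressions. -/
theorem concept_rec {f : Orc → γ → ELConcept → β} {t : Orc → γ → β}
    {n : Orc → γ → ConceptName → β} {j : Orc → γ → ELConcept → ELConcept → β → β → β}
    {e : Orc → γ → Role → ELConcept → β → β} (ht : PT t)
    (hn : PT fun O (p : γ × ConceptName) => n O p.1 p.2)
    (hj : PT fun O (p : γ × ELConcept × ELConcept × β × β) =>
      j O p.1 p.2.1 p.2.2.1 p.2.2.2.1 p.2.2.2.2)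
    (he : PT fun O (p : γ × Role × ELConcept × β) => e O p.1 p.2.1 p.2.2.1 p.2.2.2)
    (hft : ∀ O c, f O c .top = t O c) (hfn : ∀ O c A, f O c (.name A) = n O c A)
    (hfj : ∀ O c C D, f O c (.conj C D) = j O c C D (f O c C) (f O c D))
    (hfe : ∀ O c r C, f O c (.ex r C) = e O c ⟨r⟩ C (f O c C))
    (q : ℕ[X]) (hq : ∀ O c C, esize (f O c C) ≤ q.eval (esize c + esize C))
    {c : Orc → δ → γ} {C : Orc → δ → ELConcept} (hc : PT c) (hC : PT C) :
    PT fun O a => f O (c O a) (C O a) := by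
  refine PT.comp₂ (g := f) ?_ hc hC
  let sub' : Orc → γ → ELConcept → List (γ × ELConcept) := fun _ c C => match C with
    | .top => [] | .name _ => [] | .conj C D => [(c, C), (c, D)] | .ex _ C => [(c, C)]
  let g' : Orc → γ × List β → ELConcept → β := fun O c C => match C with
    | .top => t O c.1
    | .name A => n O c.1 A
    | .conj C D => j O c.1 C D (c.2.headD (t O c.1)) (c.2.tail.headD (t O c.1))
    | .ex r C => e O c.1 ⟨r⟩ C (c.2.headD (t O c.1))
  refine recursion (sub := fun O x => sub' O x.1 x.2) (g := fun O x vs => g' O (x.1, vs) x.2)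
    ?_ ?_ ?_ ?_ (fun _ x => esize x.2) ?_ X q (fun O x => ?_)
    (fun O x => (hq O _ _).trans (eval_mono q ?_))
  · exact concept_cases (f := sub') (fst id) (snd id) nil nil
      (cons ((fst id).pair (fst (snd id))) (cons ((fst id).pair (snd (snd id))) nil))
      (cons ((fst id).pair (snd (snd id))) nil)
  · have hh : PT fun O (p : (γ × List β) × ELConcept × ELConcept) => p.1.2.headD (t O p.1.1) :=
      headD (snd (fst id)) (ht.comp (fst (fst id)))
    have hh' : PT fun O (p : (γ × List β) × ELConcept × ELConcept) =>
        p.1.2.tail.headD (t O p.1.1) := headD (tail (snd (fst id))) (ht.comp (fst (fst id)))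
    have hh'' : PT fun O (p : (γ × List β) × Role × ELConcept) => p.1.2.headD (t O p.1.1) :=
      headD (snd (fst id)) (ht.comp (fst (fst id)))
    refine concept_cases (f := g') (c := fun _ (p : (γ × ELConcept) × List β) => (p.1.1, p.2))
      ((fst (fst id)).pair (snd id)) (snd (fst id)) (ht.comp (fst id))
      (hn.comp₂ (fst (fst id)) (snd id)) ?_ ?_
    · exact hj.comp ((fst (fst id)).pair ((fst (snd id)).pair ((snd (snd id)).pair (hh.pair hh'))))
    · exact he.comp ((fst (fst id)).pair ((fst (snd id)).pair ((snd (snd id)).pair hh'')))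
  · rintro O ⟨c, _ | A | ⟨C, D⟩ | ⟨r, C⟩⟩
    · exact hft O c
    · exact hfn O c A
    · exact hfj O c C D
    · exact hfe O c r C
  · rintro O ⟨c, _ | A | ⟨C, D⟩ | ⟨r, C⟩⟩ y hy
    · simp [sub'] at hy
    · simp [sub'] at hy
    · obtain rfl | rfl : y = (c, C) ∨ y = (c, D) := by simpa [sub'] using hy
      all_goals simp; omega
    · obtain rfl : y = (c, C) := by simpa [sub'] using hy
      simp
  · rintro O ⟨c, _ | A | ⟨C, D⟩ | ⟨r, C⟩⟩ <;> simp [sub'] <;> omega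
  · simp
    omega
  · simp

end PT
end ExactLearning

namespace ExactLearning

open Polynomial

/-! ### The functions computed by the learner -/

namespace ELConcept

/-- The concept names that hold at the root of the tree `C`. -/
def labels : ELConcept → List ConceptName
  | top => []
  | name A => [A]
  | conj C D => C.labels ++ D.labels
  | ex _ _ => []

/-- The `r`-successors of the root of the tree `C`. -/
def succ (r : RoleName) : ELConcept → List ELConcept
  | top => []
  | name _ => []
  | conj C D => C.succ r ++ D.succ r
  | ex r' C => if r' = r then [C] else []

/-- The subtrees at the proper descendants of the root. -/
def subtrees : ELConcept → List ELConcept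
  | top => []
  | name _ => []
  | conj C D => C.subtrees ++ D.subtrees
  | ex _ C => C :: C.subtrees

/-- Is there a homomorphism from the tree `C` to the tree `D` that maps root to root? -/
def covers (D : ELConcept) : ELConcept → Bool
  | top => true
  | name A => decide (A ∈ D.labels)
  | conj C C' => D.covers C && D.covers C'
  | ex r C => (D.succ r).any fun D' => covers D' C

/-- The conjunction of a list of concept expressions. -/
def conjs (l : List ELConcept) : ELConcept := l.foldr conj top

/-- The conjunction of a list of concept names. -/
def names (l : List ConceptName) : ELConcept := conjs (l.map name)

/-- The product of two trees. -/
def prod : ELConcept → ELConcept → ELConcept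
  | top, _ => top
  | name A, D => if A ∈ D.labels then name A else top
  | conj C C', D => conj (C.prod D) (C'.prod D)
  | ex r C, D => conjs ((D.succ r).map fun D' => ex r (C.prod D'))

/-- The trees obtained by removing the subtree at a proper descendant of the root. -/
def removals : ELConcept → List ELConcept
  | top => []
  | name _ => []
  | conj C D => C.removals.map (fun C' => conj C' D) ++ D.removals.map (fun D' => conj C D')
  | ex r C => top :: C.removals.map (ex r)

/-- Conjunction without superfluous `⊤`. -/
def smartConj (C D : ELConcept) : ELConcept :=
  if C = top then D else if D = top then C else conj C D

/-- Removes superfluous `⊤`. -/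
def clean : ELConcept → ELConcept
  | top => top
  | name A => name A
  | conj C D => smartConj C.clean D.clean
  | ex r C => ex r C.clean

end ELConcept

open ELConcept

section Learner

variable (O : Orc) (S : List ConceptName)

/-- The names in the signature that the oracle reports to subsume `C`. -/
def entailed (C : ELConcept) : List ConceptName := S.filter fun B => O ⟨C, B⟩

/-- The tree `C` without the labels of the root, where the label of every other node consists
of the names entailed there. -/
def kids : ELConcept → ELConcept
  | .top => .top
  | .name _ => .top
  | .conj C D => .conj (kids C) (kids D)
  | .ex r C => .ex r (.conj (names (entailed O S C)) (kids C))

/-- Adds to the label `ℓ` of the root of the tree `K` what follows in one step from the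
hypothesis given by `L`. -/
def closeStep (L : List ELConcept) (K : ELConcept) (ℓ : List ConceptName) : List ConceptName :=
  S.filter fun B => decide (B ∈ ℓ) ||
    L.any fun C => O ⟨C, B⟩ && (ELConcept.conj (names ℓ) K).covers C

/-- Closes the label `ℓ` of the root of the tree `K` under the hypothesis given by `L`. -/
def closeLabel (L : List ELConcept) (K : ELConcept) (ℓ : List ConceptName) : List ConceptName :=
  (closeStep O S L K)^[S.length] ℓ

/-- The tree `N` with all proper descendants closed under the target and the root closed under the
hypothesis. -/
def candidate (L : List ELConcept) (N : ELConcept) : ELConcept :=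
  .conj (names (closeLabel O S L (kids O S N) (S.filter fun B => decide (B ∈ N.labels))))
    (kids O S N)

/-- Is some name that holds at the root of the tree `C` according to the target missing there? -/
def violated (C : ELConcept) : Bool := S.any fun B => O ⟨C, B⟩ && !decide (B ∈ C.labels)

/-- Removes one subtree such that the target is still violated at the root, if possible. -/
def shrinkStep (C : ELConcept) : ELConcept := ((C.removals.map clean).filter (violated O S)).headD C

/-- Removes subtrees as long as the target is violated at the root. -/
def shrink (C : ELConcept) : ELConcept := (shrinkStep O S)^[C.subtrees.length] C.clean

/-- Is the hypothesis tree `C` to be replaced by its product with `D`? -/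
def refinable (D C : ELConcept) : Bool := violated O S (C.prod D) && !D.covers C

/-- Refines the first possible hypothesis tree with `D`, or appends `D`. -/
def refine (D : ELConcept) : List ELConcept → List ELConcept
  | [] => [D]
  | C :: L => if refinable O S D C then shrink O S (C.prod D) :: L else C :: refine D L

/-- A tree obtained from the left-hand side `C` of a counterexample, at the root of which the
target is violated but not the hypothesis. -/
def violation (L : List ELConcept) (C : ELConcept) : ELConcept :=
  (((C :: C.subtrees).map (candidate O S L)).filter (violated O S)).headD .top

/-- The new hypothesis trees after the counterexample with left-hand side `C`. -/
def learn (L : List ELConcept) (C : ELConcept) : List ELConcept :=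
  refine O S (shrink O S (violation O S L C)) L

/-- The hypothesis given by hypothesis trees. -/
def hypothesis (L : List ELConcept) : List CI :=
  L.flatMap fun C => (entailed O S C).map fun B => ⟨C, B⟩

end Learner

/-! ### The learner runs in polynomial time -/

/-! ### Sizes of the values of the learner's functions -/

section Sizes

theorem esize_labels_le (C : ELConcept) : esize C.labels ≤ 3 * esize C := by
  induction C with
  | conj C D ihC ihD => have := esize_append C.labels D.labels; simp [labels]; omega
  | _ => simp [labels]; try omega

theorem esize_succ_le (r : RoleName) (C : ELConcept) : esize (C.succ r) ≤ esize C := by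
  induction C with
  | conj C D ihC ihD =>
    have := esize_append (C.succ r) (D.succ r)
    simp [succ]
    omega
  | ex r' C ih =>
    simp only [succ]
    split <;> simp
  | _ => simp [succ]

theorem esize_subtrees_le (C : ELConcept) : esize C.subtrees ≤ esize C * esize C := by
  induction C with
  | conj C D ihC ihD =>
    have := esize_append C.subtrees D.subtrees
    have : esize (C.conj D) * esize (C.conj D) ≥ esize C * esize C + esize D * esize D := by
      simp only [esize_conj]
      ring_nf
      omega
    simp only [subtrees]
    omega
  | ex r C ih =>
    simp [subtrees]
    ring_nf at *
    omega
  | _ => simp [subtrees]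

theorem esize_conjs_le (l : List ELConcept) : esize (conjs l) ≤ 3 * esize l := by
  induction l with
  | nil => simp [conjs]
  | cons C l ih =>
    simp only [conjs, List.foldr_cons, esize_conj, esize_cons] at *
    omega

theorem esize_map_name (l : List ConceptName) : esize (l.map ELConcept.name) = esize l := by
  induction l with
  | nil => rfl
  | cons A l ih => simp [ih]

theorem esize_names_le (l : List ConceptName) : esize (names l) ≤ 3 * esize l := by
  have := esize_conjs_le (l.map ELConcept.name)
  rwa [esize_map_name] at this

/-- The slack `3` is the cost of a conjunction and carries the induction through that case. For `∃
r. C` the sum over the `r`-successors of `D` is controlled by the total size of their list. -/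
theorem esize_prod_le (C D : ELConcept) : esize (C.prod D) + 3 ≤ 4 * esize C * esize D := by
  induction C generalizing D with
  | top => have := esize_pos D; simp [prod]; omega
  | name A =>
    have := esize_pos D
    simp only [prod]
    split <;> simp <;> omega
  | conj C C' ih ih' =>
    have h := ih D
    have h' := ih' D
    simp only [prod, esize_conj]
    nlinarith
  | ex r C ih =>
    have key : ∀ l : List ELConcept, esize (conjs (l.map fun D' => ex r (C.prod D'))) + 3 ≤
        4 * esize C * esize l + 2 * esize l := by
      intro l
      induction l with
      | nil => have := esize_pos C; simp [conjs]; omega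
      | cons D' l ihl =>
        have := ih D'
        simp only [conjs, List.map_cons, List.foldr_cons, esize_conj, esize_ex, esize_cons] at *
        nlinarith
    have h1 := key (D.succ r)
    have h2 := esize_succ_le r D
    simp only [prod, esize_ex]
    nlinarith

theorem esize_le_of_mem_removals {C C' : ELConcept} (h : C' ∈ C.removals) :
    esize C' < esize C := by
  induction C generalizing C' with
  | top => simp [removals] at h
  | name A => simp [removals] at h
  | conj C D ihC ihD =>
    simp only [removals, List.mem_append, List.mem_map] at h
    obtain ⟨E, hE, rfl⟩ | ⟨E, hE, rfl⟩ := h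
    · have := ihC hE; simp; omega
    · have := ihD hE; simp; omega
  | ex r C ih =>
    simp only [removals, List.mem_cons, List.mem_map] at h
    obtain rfl | ⟨E, hE, rfl⟩ := h
    · simp
    · have := ih hE; simp; omega

theorem length_removals_le (C : ELConcept) : C.removals.length ≤ esize C := by
  induction C with
  | conj C D ihC ihD => simp [removals]; omega
  | ex r C ih => simp [removals]; omega
  | _ => simp [removals]

theorem esize_clean_le (C : ELConcept) : esize C.clean ≤ esize C := by
  induction C with
  | conj C D ihC ihD =>
    simp only [clean, smartConj]
    split_ifs <;> simp <;> omega
  | ex r C ih => simpa [clean] using ih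
  | _ => simp [clean]

variable (O : Orc) (S : List ConceptName)

theorem esize_kids_le (C : ELConcept) :
    esize (kids O S C) ≤ (3 * esize S + 6) * esize C := by
  induction C with
  | top => simp [kids]
  | name A => simp [kids]
  | conj C D ihC ihD =>
    simp only [kids, esize_conj]
    nlinarith
  | ex r C ih =>
    have h1 := esize_names_le (entailed O S C)
    have h2 : esize (entailed O S C) ≤ _ := PT.esize_filter_le _ _
    simp only [kids, esize_conj, esize_ex]
    nlinarith

/-- Every step returns a sublist of the signature, so nothing accumulates. -/
theorem esize_iterate_closeStep_le (L : List ELConcept) (K : ELConcept) (ℓ : List ConceptName)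
    (n : ℕ) : esize ((closeStep O S L K)^[n] ℓ) ≤ esize ℓ + esize S := by
  cases n with
  | zero => simp
  | succ n =>
    rw [Function.iterate_succ_apply']
    have := PT.esize_filter_le S fun B => decide (B ∈ (closeStep O S L K)^[n] ℓ) ||
      L.any fun C => O ⟨C, B⟩ &&
        (ELConcept.conj (names ((closeStep O S L K)^[n] ℓ)) K).covers C
    exact this.trans (by omega)

theorem shrinkStep_eq (C : ELConcept) : shrinkStep O S C = C ∨
    ∃ D ∈ C.removals, shrinkStep O S C = D.clean ∧ violated O S D.clean = true := by
  unfold shrinkStep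
  cases h : (C.removals.map clean).filter (violated O S) with
  | nil => exact .inl rfl
  | cons D l =>
    have : D ∈ (C.removals.map clean).filter (violated O S) := by simp [h]
    obtain ⟨h1, h2⟩ := List.mem_filter.1 this
    obtain ⟨D, hD, rfl⟩ := List.mem_map.1 h1
    exact .inr ⟨D, hD, rfl, h2⟩

theorem esize_shrinkStep_le (C : ELConcept) : esize (shrinkStep O S C) ≤ esize C := by
  obtain h | ⟨D, hD, h, -⟩ := shrinkStep_eq O S C
  · rw [h]
  · rw [h]
    exact (esize_clean_le D).trans (esize_le_of_mem_removals hD).le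

theorem esize_iterate_shrinkStep_le (C : ELConcept) (n : ℕ) :
    esize ((shrinkStep O S)^[n] C) ≤ esize C := by
  induction n with
  | zero => simp
  | succ n ih =>
    rw [Function.iterate_succ_apply']
    exact (esize_shrinkStep_le O S _).trans ih

theorem esize_shrink_le (C : ELConcept) : esize (shrink O S C) ≤ esize C :=
  (esize_iterate_shrinkStep_le O S _ _).trans (esize_clean_le _)

end Sizes

/-! ### Programs for the learner's functions -/

namespace PT

variable {α : Type} [Enc α]

theorem labels {C : Orc → α → ELConcept} (hC : PT C) : PT fun O a => (C O a).labels :=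
  concept_rec (f := fun _ (_ : Bool) C => C.labels) (t := fun _ _ => []) (n := fun _ _ A => [A])
    (j := fun _ _ _ _ a b => a ++ b) (e := fun _ _ _ _ _ => []) nil (cons (snd id) nil)
    (append (fst (snd (snd (snd id)))) (snd (snd (snd (snd id))))) nil
    (fun _ _ => rfl) (fun _ _ _ => rfl) (fun _ _ _ _ => rfl) (fun _ _ _ _ => rfl) (3 * X)
    (fun _ _ C => (esize_labels_le C).trans (by simp)) PT.true hC

theorem succ {r : Orc → α → Role} {C : Orc → α → ELConcept} (hr : PT r) (hC : PT C) :
    PT fun O a => (C O a).succ (r O a).name :=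
  concept_rec (f := fun _ (r : Role) C => C.succ r.name) (t := fun _ _ => [])
    (n := fun _ _ _ => []) (j := fun _ _ _ _ a b => a ++ b)
    (e := fun _ r r' C _ => if decide (r' = r) then [C] else []) nil nil
    (append (fst (snd (snd (snd id)))) (snd (snd (snd (snd id)))))
    (ite (decide_eq (fst (snd id)) (fst id)) (cons (fst (snd (snd id))) nil) nil)
    (fun _ _ => rfl) (fun _ _ _ => rfl) (fun _ _ _ _ => rfl)
    (fun _ r r' C => by cases r; simp [ELConcept.succ]) X
    (fun _ _ C => (esize_succ_le _ C).trans (by simp)) hr hC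

theorem subtrees {C : Orc → α → ELConcept} (hC : PT C) : PT fun O a => (C O a).subtrees :=
  concept_rec (f := fun _ (_ : Bool) C => C.subtrees) (t := fun _ _ => []) (n := fun _ _ A => [])
    (j := fun _ _ _ _ a b => a ++ b) (e := fun _ _ _ C a => C :: a) nil nil
    (append (fst (snd (snd (snd id)))) (snd (snd (snd (snd id)))))
    (cons (fst (snd (snd id))) (snd (snd (snd id))))
    (fun _ _ => rfl) (fun _ _ _ => rfl) (fun _ _ _ _ => rfl) (fun _ _ _ _ => rfl) (X * X)
    (fun _ _ C => (esize_subtrees_le C).trans (by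
      simp only [eval_mul, eval_X]; gcongr <;> omega)) PT.true hC

theorem conjs {l : Orc → α → List ELConcept} (hl : PT l) : PT fun O a => conjs (l O a) :=
  list_rec (f := fun _ (_ : Bool) l => ELConcept.conjs l) (z := fun _ _ => .top)
    (k := fun _ _ C _ D => .conj C D) top (conj (fst (snd id)) (snd (snd (snd id))))
    (fun _ _ => rfl) (fun _ _ _ _ => rfl) (3 * X)
    (fun _ _ l => (esize_conjs_le l).trans (by simp)) PT.true hl

theorem names {l : Orc → α → List ConceptName} (hl : PT l) : PT fun O a => names (l O a) :=
  conjs (map hl (name (snd id)))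

/-- The arguments of the recursive calls in the definitions of `covers` and `prod`. -/
def pairCalls (D C : ELConcept) : List (ELConcept × ELConcept) :=
  match C with
  | .top => []
  | .name _ => []
  | .conj C C' => [(D, C), (D, C')]
  | .ex r C => (D.succ r).map fun D' => (D', C)

theorem pairCalls_pt : PT fun _ (x : ELConcept × ELConcept) => pairCalls x.1 x.2 :=
  concept_cases (f := fun _ D C => pairCalls D C) (fst id) (snd id) nil nil
    (cons ((fst id).pair (fst (snd id))) (cons ((fst id).pair (snd (snd id))) nil))
    (map (succ (fst (snd id)) (fst id)) ((snd id).pair (snd (snd (fst id)))))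

theorem esize_le_of_mem_pairCalls {x y : ELConcept × ELConcept} (h : y ∈ pairCalls x.1 x.2) :
    esize y ≤ esize x := by
  obtain ⟨D, C⟩ := x
  cases C with
  | top => simp [pairCalls] at h
  | name A => simp [pairCalls] at h
  | conj C C' =>
    obtain rfl | rfl : y = (D, C) ∨ y = (D, C') := by simpa [pairCalls] using h
    all_goals simp; omega
  | ex r C =>
    obtain ⟨D', hD', rfl⟩ := List.mem_map.1 h
    have := (esize_le_of_mem hD').trans (esize_succ_le r D)
    simp
    omega

/-- The product of the two sizes bounds the number of calls: two conjuncts share the size of their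
conjunction, and the successors of the root of the other tree share the size of that tree. -/
theorem sum_pairCalls_le (x : ELConcept × ELConcept) :
    1 + ((pairCalls x.1 x.2).map fun y => esize y.1 * esize y.2).sum ≤ esize x.1 * esize x.2 := by
  obtain ⟨D, C⟩ := x
  have hD := esize_pos D
  cases C with
  | top => simpa [pairCalls] using hD
  | name A => simpa [pairCalls] using hD
  | conj C C' =>
    simp [pairCalls]
    nlinarith
  | ex r C =>
    have key : ∀ l : List ELConcept, ((l.map fun D' => (D', C)).map
        fun y => esize y.1 * esize y.2).sum ≤ esize l * esize C := by
      intro l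
      induction l with
      | nil => simp
      | cons D' l ih =>
        simp only [List.map_cons, List.sum_cons, esize_cons, Nat.add_mul] at *
        omega
    have h1 := key (D.succ r)
    have h2 := Nat.mul_le_mul_right (esize C) (esize_succ_le r D)
    simp only [pairCalls, esize_ex, Nat.mul_add]
    omega

/-- Recursion along the recursive calls in the definitions of `covers` and `prod`. -/
theorem pair_rec {β : Type} [Enc β] {f : ELConcept → ELConcept → β}
    {g : ELConcept → List β → ELConcept → β}
    (hg : PT fun _ (p : (ELConcept × ELConcept) × List β) => g p.1.1 p.2 p.1.2)
    (hf : ∀ D C, f D C = g D ((pairCalls D C).map fun x => f x.1 x.2) C)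
    (q : ℕ[X]) (hq : ∀ D C, esize (f D C) ≤ q.eval (esize D + esize C))
    {D C : Orc → α → ELConcept} (hD : PT D) (hC : PT C) : PT fun O a => f (D O a) (C O a) := by
  refine PT.comp₂ (g := fun _ => f) ?_ hD hC
  refine recursion (g := fun _ x vs => g x.1 vs x.2) pairCalls_pt hg (fun _ x => hf _ _)
    (fun _ x y => esize_le_of_mem_pairCalls) (fun _ y => esize y.1 * esize y.2)
    (fun _ => sum_pairCalls_le) (X * X) q (fun _ x => ?_)
    fun _ x => (hq _ _).trans (eval_mono q (by simp))
  simp only [eval_mul, eval_X, esize_pair]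
  gcongr <;> omega

theorem covers {D C : Orc → α → ELConcept} (hD : PT D) (hC : PT C) :
    PT fun O a => (D O a).covers (C O a) := by
  refine pair_rec (f := ELConcept.covers) (g := fun D vs C => match C with
    | .top => .true | .name A => decide (A ∈ D.labels) | .conj _ _ => vs.all fun b => b
    | .ex _ _ => vs.any fun b => b) ?_ ?_ 3 (fun _ _ => by simpa using esize_bool_le _) hD hC
  · exact concept_cases (f := fun _ (p : ELConcept × List Bool) C => match C with
      | .top => Bool.true | .name A => decide (A ∈ p.1.labels) | .conj _ _ => p.2.all fun b => b
      | .ex _ _ => p.2.any fun b => b)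
      (c := fun _ (p : (ELConcept × ELConcept) × List Bool) => (p.1.1, p.2))
      ((fst (fst id)).pair (snd id)) (snd (fst id)) PT.true
      (mem (snd id) (labels (fst (fst id)))) (all (snd (fst id)) (snd id))
      (any (snd (fst id)) (snd id))
  · intro D C
    cases C <;> simp [ELConcept.covers, pairCalls]
    rfl

theorem prod {D C : Orc → α → ELConcept} (hC : PT C) (hD : PT D) :
    PT fun O a => (C O a).prod (D O a) := by
  refine pair_rec (f := fun D C => C.prod D) (g := fun D vs C => match C with
    | .top => ELConcept.top
    | .name A => if decide (A ∈ D.labels) then ELConcept.name A else ELConcept.top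
    | .conj _ _ => ELConcept.conj (vs.headD ELConcept.top) (vs.tail.headD ELConcept.top)
    | .ex r _ => ELConcept.conjs (vs.map (ELConcept.ex r))) ?_ ?_ (4 * X * X) (fun D C => ?_) hD hC
  · exact concept_cases (f := fun _ (p : ELConcept × List ELConcept) C => match C with
      | .top => ELConcept.top
      | .name A => if decide (A ∈ p.1.labels) then ELConcept.name A else ELConcept.top
      | .conj _ _ => ELConcept.conj (p.2.headD ELConcept.top) (p.2.tail.headD ELConcept.top)
      | .ex r _ => ELConcept.conjs (p.2.map (ELConcept.ex r)))
      (c := fun _ (p : (ELConcept × ELConcept) × List ELConcept) => (p.1.1, p.2))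
      ((fst (fst id)).pair (snd id)) (snd (fst id)) top
      (ite (mem (snd id) (labels (fst (fst id)))) (name (snd id)) top)
      (conj (headD (snd (fst id)) top) (headD (tail (snd (fst id))) top))
      (conjs (map (snd (fst id)) (ex (fst (snd (fst id))) (snd id))))
  · intro D C
    cases C <;> simp [ELConcept.prod, pairCalls]
    rfl
  · have := esize_prod_le C D
    simp only [eval_mul, eval_X, eval_ofNat]
    nlinarith

theorem removals {C : Orc → α → ELConcept} (hC : PT C) : PT fun O a => (C O a).removals :=
  concept_rec (f := fun _ (_ : Bool) C => C.removals) (t := fun _ _ => []) (n := fun _ _ A => [])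
    (j := fun _ _ C D a b => a.map (fun C' => .conj C' D) ++ b.map (fun D' => .conj C D'))
    (e := fun _ _ r _ a => .top :: a.map (.ex r.name)) nil nil
    (append (map (fst (snd (snd (snd id)))) (conj (snd id) (fst (snd (snd (fst id))))))
      (map (snd (snd (snd (snd id)))) (conj (fst (snd (fst id))) (snd id))))
    (cons top (map (snd (snd (snd id))) (ex (fst (snd (fst id))) (snd id))))
    (fun _ _ => rfl) (fun _ _ _ => rfl) (fun _ _ _ _ => rfl) (fun _ _ _ _ => rfl)
    (X * (X + 1) + 1)
    (fun _ _ C => (esize_list_le _ (esize C)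
      fun _ h => (esize_le_of_mem_removals h).le).trans (by
        have := length_removals_le C
        simp only [eval_add, eval_mul, eval_X, eval_one]; gcongr <;> omega)) PT.true hC

theorem smartConj {C D : Orc → α → ELConcept} (hC : PT C) (hD : PT D) :
    PT fun O a => ELConcept.smartConj (C O a) (D O a) :=
  (ite (decide_eq hC top) hD (ite (decide_eq hD top) hC (conj hC hD))).congr fun O a => by
    simp [ELConcept.smartConj]

theorem clean {C : Orc → α → ELConcept} (hC : PT C) : PT fun O a => (C O a).clean :=
  concept_rec (f := fun _ (_ : Bool) C => C.clean) (t := fun _ _ => .top) (n := fun _ _ A => .name A)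
    (j := fun _ _ _ _ a b => ELConcept.smartConj a b) (e := fun _ _ r _ a => .ex r.name a) top
    (name (snd id)) (smartConj (fst (snd (snd (snd id)))) (snd (snd (snd (snd id)))))
    (ex (fst (snd id)) (snd (snd (snd id))))
    (fun _ _ => rfl) (fun _ _ _ => rfl) (fun _ _ _ _ => rfl) (fun _ _ _ _ => rfl) X
    (fun _ _ C => (esize_clean_le C).trans (by simp)) PT.true hC

section

variable {S : Orc → α → List ConceptName} {L : Orc → α → List ELConcept} {C D : Orc → α → ELConcept}

theorem entailed (hS : PT S) (hC : PT C) : PT fun O a => entailed O (S O a) (C O a) :=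
  filter hS (query (hC.comp (fst id)) (snd id))

theorem kids (hS : PT S) (hC : PT C) : PT fun O a => kids O (S O a) (C O a) :=
  concept_rec (f := fun O S C => ExactLearning.kids O S C) (t := fun _ _ => .top)
    (n := fun _ _ _ => .top) (j := fun _ _ _ _ a b => .conj a b)
    (e := fun O S r C a => .ex r.name (.conj (ELConcept.names (ExactLearning.entailed O S C)) a))
    top top (conj (fst (snd (snd (snd id)))) (snd (snd (snd (snd id)))))
    (ex (fst (snd id)) (conj (names (entailed (fst id) (fst (snd (snd id))))) (snd (snd (snd id)))))
    (fun _ _ => rfl) (fun _ _ _ => rfl) (fun _ _ _ _ => rfl) (fun _ _ _ _ => rfl)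
    ((3 * X + 6) * X)
    (fun O S C => (esize_kids_le O S C).trans (by
      simp only [eval_add, eval_mul, eval_X, eval_ofNat]; gcongr <;> omega)) hS hC

theorem closeStep {ℓ : Orc → α → List ConceptName} (hS : PT S) (hL : PT L) (hC : PT C)
    (hℓ : PT ℓ) : PT fun O a => closeStep O (S O a) (L O a) (C O a) (ℓ O a) :=
  filter hS (or (mem (snd id) (hℓ.comp (fst id)))
    (any (hL.comp (fst id)) (and (query (snd id) (snd (fst id)))
      (covers (conj (names (hℓ.comp (fst (fst id)))) (hC.comp (fst (fst id)))) (snd id)))))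

theorem closeLabel {ℓ : Orc → α → List ConceptName} (hS : PT S) (hL : PT L) (hC : PT C)
    (hℓ : PT ℓ) : PT fun O a => closeLabel O (S O a) (L O a) (C O a) (ℓ O a) := by
  refine iterate (f := fun O (c : (List ConceptName × List ELConcept) × ELConcept ×
      List ConceptName) ℓ => ExactLearning.closeStep O c.1.1 c.1.2 c.2.1 ℓ)
    (z := fun O c => c.2.2) ?_ (snd (snd id)) X (fun O c n => ?_)
    (c := fun O a => ((S O a, L O a), (C O a, ℓ O a))) ((hS.pair hL).pair (hC.pair hℓ)) hS
  · exact closeStep (fst (fst (fst id))) (snd (fst (fst id))) (fst (snd (fst id))) (snd id)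
  · refine (esize_iterate_closeStep_le _ _ _ _ _ n).trans ?_
    simp
    omega

theorem candidate (hS : PT S) (hL : PT L) (hC : PT C) :
    PT fun O a => candidate O (S O a) (L O a) (C O a) :=
  conj (names (closeLabel hS hL (kids hS hC)
    (filter hS (mem (snd id) (labels (hC.comp (fst id))))))) (kids hS hC)

theorem violated (hS : PT S) (hC : PT C) : PT fun O a => violated O (S O a) (C O a) :=
  any hS (and (query (hC.comp (fst id)) (snd id)) (not (mem (snd id) (labels (hC.comp (fst id))))))

theorem shrinkStep (hS : PT S) (hC : PT C) : PT fun O a => shrinkStep O (S O a) (C O a) :=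
  headD (filter (map (removals hC) (clean (snd id))) (violated (hS.comp (fst id)) (snd id))) hC

theorem shrink (hS : PT S) (hC : PT C) : PT fun O a => shrink O (S O a) (C O a) := by
  refine iterate (f := fun O (c : List ConceptName × ELConcept) C =>
    ExactLearning.shrinkStep O c.1 C) (z := fun O c => c.2.clean) (shrinkStep (fst (fst id)) (snd id))
    (clean (snd id)) X (fun O c n => ?_) (c := fun O a => (S O a, C O a)) (hS.pair hC) (subtrees hC)
  refine ((esize_iterate_shrinkStep_le _ _ _ n).trans (esize_clean_le _)).trans ?_
  simp
  omega

theorem refinable (hS : PT S) (hD : PT D) (hC : PT C) :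
    PT fun O a => refinable O (S O a) (D O a) (C O a) :=
  and (violated hS (prod hC hD)) (not (covers hD hC))

theorem refine (hS : PT S) (hD : PT D) (hL : PT L) :
    PT fun O a => refine O (S O a) (D O a) (L O a) := by
  refine list_rec (f := fun O (c : List ConceptName × ELConcept) L =>
      ExactLearning.refine O c.1 c.2 L) (z := fun _ c => [c.2])
    (k := fun O c C L v => if ExactLearning.refinable O c.1 c.2 C then
      ExactLearning.shrink O c.1 (C.prod c.2) :: L else C :: v) (cons (snd id) nil)
    (ite (refinable (fst (fst id)) (snd (fst id)) (fst (snd id)))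
      (cons (shrink (fst (fst id)) (prod (fst (snd id)) (snd (fst id)))) (fst (snd (snd id))))
      (cons (fst (snd id)) (snd (snd (snd id)))))
    (fun _ _ => rfl) (fun _ _ _ _ => rfl) (4 * X * X + X + 8) (fun O c L => ?_)
    (c := fun O a => (S O a, D O a)) (hS.pair hD) hL
  obtain ⟨S, D⟩ := c
  -- Only one tree is replaced or added, and its size is bounded by that of a product or of `D`.
  have key : esize (ExactLearning.refine O S D L) ≤ 4 * esize L * esize D + esize L + 3 := by
    induction L with
    | nil => simp [ExactLearning.refine]; nlinarith
    | cons C L ih =>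
      simp only [ExactLearning.refine]
      split
      · have h1 := esize_shrink_le O S (C.prod D)
        have h2 := esize_prod_le C D
        simp only [esize_cons]
        nlinarith
      · simp only [esize_cons]
        nlinarith
  have : 4 * esize L * esize D ≤
      4 * (esize (S, D) + esize L) * (esize (S, D) + esize L) := by
    gcongr
    · omega
    · simp; omega
  simp only [eval_add, eval_mul, eval_X, eval_ofNat]
  omega

theorem learn (hS : PT S) (hL : PT L) (hC : PT C) :
    PT fun O a => learn O (S O a) (L O a) (C O a) :=
  refine hS (shrink hS (headD (filter (map (cons hC (subtrees hC))
    (candidate (hS.comp (fst id)) (hL.comp (fst id)) (snd id)))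
      (violated (hS.comp (fst id)) (snd id))) top)) hL

theorem hypothesis (hS : PT S) (hL : PT L) : PT fun O a => hypothesis O (S O a) (L O a) :=
  flatMap hL (map (entailed (hS.comp (fst id)) (snd id)) (ci (snd (fst id)) (snd id)))

end

end PT
end ExactLearning

namespace ExactLearning

open ELConcept

/-! ### Trees and homomorphisms -/

namespace ELConcept

/-- Which trees map to `D` depends only on the labels and the successors of its root, not on how the
conjunction is bracketed. -/
theorem covers_mono {D D' : ELConcept} (hl : ∀ A ∈ D.labels, A ∈ D'.labels)
    (hs : ∀ r, ∀ E ∈ D.succ r, E ∈ D'.succ r) {C : ELConcept} (h : D.covers C = true) :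
    D'.covers C = true := by
  induction C with
  | top => rfl
  | name A => simpa [covers] using hl A (by simpa [covers] using h)
  | conj C C' ih ih' =>
    simp only [covers, Bool.and_eq_true] at h ⊢
    exact ⟨ih h.1, ih' h.2⟩
  | ex r C ih =>
    simp only [covers, List.any_eq_true] at h ⊢
    obtain ⟨E, hE, h⟩ := h
    exact ⟨E, hs r E hE, h⟩

theorem covers_conj_left {C D E : ELConcept} (h : C.covers E = true) :
    (conj C D).covers E = true :=
  covers_mono (fun A hA => by simp [labels, hA]) (fun r F hF => by simp [succ, hF]) h

theorem covers_conj_right {C D E : ELConcept} (h : D.covers E = true) :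
    (conj C D).covers E = true :=
  covers_mono (fun A hA => by simp [labels, hA]) (fun r F hF => by simp [succ, hF]) h

theorem covers_refl (C : ELConcept) : C.covers C = true := by
  induction C with
  | top => rfl
  | name A => simp [covers, labels]
  | conj C C' ih ih' => simp [covers, covers_conj_left ih, covers_conj_right ih']
  | ex r C ih => simp [covers, succ, ih]

theorem mem_labels_of_covers {C D : ELConcept} (h : D.covers C = true) {A : ConceptName}
    (hA : A ∈ C.labels) : A ∈ D.labels := by
  induction C with
  | top => simp [labels] at hA
  | name B =>
    obtain rfl : A = B := by simpa [labels] using hA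
    simpa [covers] using h
  | conj C C' ih ih' =>
    simp only [covers, Bool.and_eq_true] at h
    rcases List.mem_append.1 hA with hA | hA
    · exact ih h.1 hA
    · exact ih' h.2 hA
  | ex r C ih => simp [labels] at hA

theorem exists_succ_of_covers {C D C' : ELConcept} {r : RoleName} (h : D.covers C = true)
    (hC : C' ∈ C.succ r) : ∃ D' ∈ D.succ r, D'.covers C' = true := by
  induction C with
  | top => simp [succ] at hC
  | name B => simp [succ] at hC
  | conj C₁ C₂ ih ih' =>
    simp only [covers, Bool.and_eq_true] at h
    rcases List.mem_append.1 hC with hC | hC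
    · exact ih h.1 hC
    · exact ih' h.2 hC
  | ex r' C ih =>
    simp only [succ] at hC
    split at hC
    · subst r'
      obtain rfl : C' = C := by simpa using hC
      simpa [covers] using h
    · simp at hC

theorem covers_trans {C D E : ELConcept} (h : D.covers C = true) (h' : C.covers E = true) :
    D.covers E = true := by
  induction E generalizing C D with
  | top => rfl
  | name A =>
    simp only [covers, decide_eq_true_eq] at h' ⊢
    exact mem_labels_of_covers h h'
  | conj E E' ih ih' =>
    simp only [covers, Bool.and_eq_true] at h' ⊢
    exact ⟨ih h h'.1, ih' h h'.2⟩
  | ex r E ih =>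
    simp only [covers, List.any_eq_true] at h' ⊢
    obtain ⟨C', hC', h'⟩ := h'
    obtain ⟨D', hD', h⟩ := exists_succ_of_covers h hC'
    exact ⟨D', hD', ih h h'⟩

theorem mem_labels_conjs {l : List ELConcept} {A : ConceptName} :
    A ∈ (conjs l).labels ↔ ∃ C ∈ l, A ∈ C.labels := by
  induction l with
  | nil => simp [conjs, labels]
  | cons C l ih => simp only [conjs, List.foldr_cons, labels] at *; simp [ih]

theorem mem_succ_conjs {l : List ELConcept} {r : RoleName} {D : ELConcept} :
    D ∈ (conjs l).succ r ↔ ∃ C ∈ l, D ∈ C.succ r := by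
  induction l with
  | nil => simp [conjs, succ]
  | cons C l ih => simp only [conjs, List.foldr_cons, succ] at *; simp [ih]

theorem labels_names (l : List ConceptName) : (names l).labels = l := by
  induction l with
  | nil => rfl
  | cons A l ih => simp only [names, conjs, List.map_cons, List.foldr_cons, labels] at *; simp [ih]

theorem mem_labels_prod {C D : ELConcept} {A : ConceptName} :
    A ∈ (C.prod D).labels ↔ A ∈ C.labels ∧ A ∈ D.labels := by
  induction C with
  | top => simp [prod, labels]
  | name B =>
    simp only [prod]
    split <;> simp [labels] <;> aesop
  | conj C C' ih ih' => simp [prod, labels, ih, ih', or_and_right]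
  | ex r C ih => simp [prod, mem_labels_conjs, labels]

theorem mem_succ_prod {C D E : ELConcept} {r : RoleName} :
    E ∈ (C.prod D).succ r ↔ ∃ C' ∈ C.succ r, ∃ D' ∈ D.succ r, E = C'.prod D' := by
  induction C with
  | top => simp [prod, succ]
  | name B =>
    simp only [prod]
    split <;> simp [succ]
  | conj C C' ih ih' => simp [prod, succ, ih, ih', or_and_right, exists_or]
  | ex r' C ih =>
    simp only [prod, mem_succ_conjs, List.mem_map, exists_exists_and_eq_and, succ]
    by_cases h : r' = r
    · subst h
      simp
    · simp [h]

/-- The universal property of the product. Consequently, an inclusion is applicable at the root of a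
product exactly if it is applicable at the roots of both factors. -/
theorem covers_prod {C D E : ELConcept} :
    (C.prod D).covers E = true ↔ C.covers E = true ∧ D.covers E = true := by
  induction E generalizing C D with
  | top => simp [covers]
  | name A => simp [covers, mem_labels_prod]
  | conj E E' ih ih' => simp only [covers, Bool.and_eq_true, ih, ih']; tauto
  | ex r E ih =>
    simp only [covers, List.any_eq_true, mem_succ_prod]
    constructor
    · rintro ⟨_, ⟨C', hC, D', hD, rfl⟩, h⟩
      exact ⟨⟨C', hC, (ih.1 h).1⟩, ⟨D', hD, (ih.1 h).2⟩⟩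
    · rintro ⟨⟨C', hC, h⟩, ⟨D', hD, h'⟩⟩
      exact ⟨_, ⟨C', hC, D', hD, rfl⟩, ih.2 ⟨h, h'⟩⟩

theorem labels_smartConj (C D : ELConcept) :
    (smartConj C D).labels = C.labels ++ D.labels := by
  unfold smartConj
  split_ifs with h h' <;> simp_all [labels]

theorem succ_smartConj (C D : ELConcept) (r : RoleName) :
    (smartConj C D).succ r = C.succ r ++ D.succ r := by
  unfold smartConj
  split_ifs with h h' <;> simp_all [succ]

theorem labels_clean (C : ELConcept) : C.clean.labels = C.labels := by
  induction C with
  | conj C D ihC ihD => simp [clean, labels_smartConj, labels, ihC, ihD]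
  | _ => rfl

theorem succ_clean (C : ELConcept) (r : RoleName) : C.clean.succ r = (C.succ r).map clean := by
  induction C with
  | conj C D ihC ihD => simp [clean, succ_smartConj, succ, ihC, ihD]
  | ex r' C ih => simp only [clean, succ]; split <;> simp
  | _ => rfl

theorem covers_clean {C E : ELConcept} : C.clean.covers E = C.covers E := by
  induction E generalizing C with
  | top => rfl
  | name A => simp [covers, labels_clean]
  | conj E E' ih ih' => simp [covers, ih, ih']
  | ex r E ih => simp [covers, succ_clean, Function.comp_def, ih]

theorem covers_clean_right (C : ELConcept) : C.covers C.clean = true := by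
  rw [← covers_clean]
  exact covers_refl _

/-- Only subtrees at proper descendants are cut off, so the root survives with its labels. This
keeps a missing name missing. -/
theorem labels_of_mem_removals {C D : ELConcept} (h : D ∈ C.removals) : D.labels = C.labels := by
  induction C generalizing D with
  | top => simp [removals] at h
  | name A => simp [removals] at h
  | conj C C' ih ih' =>
    simp only [removals, List.mem_append, List.mem_map] at h
    obtain ⟨E, hE, rfl⟩ | ⟨E, hE, rfl⟩ := h
    · simp [labels, ih hE]
    · simp [labels, ih' hE]
  | ex r C ih =>
    simp only [removals, List.mem_cons, List.mem_map] at h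
    obtain rfl | ⟨E, hE, rfl⟩ := h <;> rfl

theorem covers_of_mem_removals {C D : ELConcept} (h : D ∈ C.removals) : C.covers D = true := by
  induction C generalizing D with
  | top => simp [removals] at h
  | name A => simp [removals] at h
  | conj C C' ih ih' =>
    simp only [removals, List.mem_append, List.mem_map] at h
    obtain ⟨E, hE, rfl⟩ | ⟨E, hE, rfl⟩ := h
    · simp [covers, covers_conj_left (ih hE), covers_conj_right (covers_refl C')]
    · simp [covers, covers_conj_right (ih' hE), covers_conj_left (covers_refl C)]
  | ex r C ih =>
    simp only [removals, List.mem_cons, List.mem_map] at h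
    obtain rfl | ⟨E, hE, rfl⟩ := h
    · rfl
    · simp [covers, succ, ih hE]

/-! ### Size measures of trees -/

/-- The number of edges of a tree. -/
def edges (C : ELConcept) : ℕ := C.subtrees.length

@[simp] theorem edges_top : edges top = 0 := rfl
@[simp] theorem edges_name (A : ConceptName) : edges (name A) = 0 := rfl
@[simp] theorem edges_conj (C D : ELConcept) : edges (conj C D) = C.edges + D.edges := by
  simp [edges, subtrees]
@[simp] theorem edges_ex (r : RoleName) (C : ELConcept) : edges (ex r C) = C.edges + 1 := by
  simp [edges, subtrees]

/-- The number of occurrences of concept names. -/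
def nameCount : ELConcept → ℕ
  | top => 0
  | name _ => 1
  | conj C D => C.nameCount + D.nameCount
  | ex _ C => C.nameCount

/-- All concept names belong to `S`, and no node has repeated labels. -/
def Reduced (S : List ConceptName) : ELConcept → Prop
  | top => True
  | name A => A ∈ S
  | conj C D => C.Reduced S ∧ D.Reduced S ∧ C.labels.Disjoint D.labels
  | ex _ C => C.Reduced S

variable {S : List ConceptName}

theorem Reduced.nodup {C : ELConcept} (h : C.Reduced S) : C.labels.Nodup := by
  induction C with
  | conj C D ihC ihD => exact (ihC h.1).append (ihD h.2.1) h.2.2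
  | _ => simp [labels]

theorem Reduced.labels_subset {C : ELConcept} (h : C.Reduced S) : C.labels ⊆ S := by
  induction C with
  | conj C D ihC ihD => exact List.append_subset.2 ⟨ihC h.1, ihD h.2.1⟩
  | name A => simpa [labels] using (show A ∈ S from h)
  | _ => simp [labels]

theorem Reduced.length_labels_le {C : ELConcept} (h : C.Reduced S) :
    C.labels.length ≤ S.length := (h.nodup.subperm h.labels_subset).length_le

theorem Reduced.nameCount_le {C : ELConcept} (h : C.Reduced S) :
    C.nameCount ≤ C.labels.length + C.edges * S.length := by
  induction C with
  | top => simp [nameCount]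
  | name A => simp [nameCount, labels]
  | conj C D ihC ihD =>
    have := ihC h.1
    have := ihD h.2.1
    simp only [nameCount, labels, List.length_append, edges_conj, Nat.add_mul]
    omega
  | ex r C ih =>
    have := ih h
    have := Reduced.length_labels_le (C := C) h
    simp only [nameCount, labels, List.length_nil, edges_ex, Nat.add_mul]
    omega

theorem Reduced.of_mem_removals {C D : ELConcept} (h : C.Reduced S) (hD : D ∈ C.removals) :
    D.Reduced S := by
  induction C generalizing D with
  | top => simp [removals] at hD
  | name A => simp [removals] at hD
  | conj C C' ih ih' =>
    simp only [removals, List.mem_append, List.mem_map] at hD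
    obtain ⟨E, hE, rfl⟩ | ⟨E, hE, rfl⟩ := hD
    · exact ⟨ih h.1 hE, h.2.1, by rw [labels_of_mem_removals hE]; exact h.2.2⟩
    · exact ⟨h.1, ih' h.2.1 hE, by rw [labels_of_mem_removals hE]; exact h.2.2⟩
  | ex r C ih =>
    simp only [removals, List.mem_cons, List.mem_map] at hD
    obtain rfl | ⟨E, hE, rfl⟩ := hD
    · trivial
    · exact ih (D := E) h hE

theorem Reduced.clean {C : ELConcept} (h : C.Reduced S) : C.clean.Reduced S := by
  induction C with
  | conj C D ihC ihD =>
    have hC := ihC h.1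
    have hD := ihD h.2.1
    simp only [ELConcept.clean, smartConj]
    split_ifs
    · exact hD
    · exact hC
    · exact ⟨hC, hD, by simpa [labels_clean] using h.2.2⟩
  | ex r C ih => exact ih h
  | _ => exact h

/-- The product is built along its first factor and keeps only names from there, so nothing has to
be known about `D`. -/
theorem Reduced.prod {C : ELConcept} (h : C.Reduced S) (D : ELConcept) :
    (C.prod D).Reduced S := by
  induction C generalizing D with
  | top => trivial
  | name A =>
    simp only [ELConcept.prod]
    split
    · exact h
    · trivial
  | conj C C' ih ih' =>
    refine ⟨ih h.1 D, ih' h.2.1 D, fun A hA hA' => ?_⟩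
    exact h.2.2 (mem_labels_prod.1 hA).1 (mem_labels_prod.1 hA').1
  | ex r C ih =>
    simp only [ELConcept.prod]
    generalize D.succ r = l
    induction l with
    | nil => trivial
    | cons D' l ihl => exact ⟨ih h D', ihl, by simp [labels]⟩

theorem edges_clean (C : ELConcept) : C.clean.edges = C.edges := by
  induction C with
  | conj C D ihC ihD =>
    simp only [clean, smartConj, edges_conj, ← ihC, ← ihD]
    split_ifs with h h' <;> simp_all
  | ex r C ih => simp [clean, ih]
  | _ => rfl

theorem nameCount_clean (C : ELConcept) : C.clean.nameCount = C.nameCount := by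
  induction C with
  | conj C D ihC ihD =>
    simp only [clean, smartConj, nameCount, ← ihC, ← ihD]
    split_ifs with h h' <;> simp_all [nameCount]
  | ex r C ih => simp [clean, nameCount, ih]
  | _ => rfl

theorem edges_lt_of_mem_removals {C D : ELConcept} (h : D ∈ C.removals) : D.edges < C.edges := by
  induction C generalizing D with
  | top => simp [removals] at h
  | name A => simp [removals] at h
  | conj C C' ih ih' =>
    simp only [removals, List.mem_append, List.mem_map] at h
    obtain ⟨E, hE, rfl⟩ | ⟨E, hE, rfl⟩ := h
    · simp [ih hE]
    · simp [ih' hE]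
  | ex r C ih =>
    simp only [removals, List.mem_cons, List.mem_map] at h
    obtain rfl | ⟨E, hE, rfl⟩ := h
    · simp
    · simp [ih hE]

/-- In a clean tree `⊤` occurs only as the whole tree or directly below an edge, so the nodes of the
encoding can be charged to edges and names. -/
theorem esize_clean_le_measures (C : ELConcept) :
    esize C.clean ≤ 6 * C.edges + 4 * C.nameCount + 1 := by
  -- The surplus `3` pays for a conjunction in the induction; only `⊤` itself lacks it.
  suffices h : C.clean = top ∨ esize C.clean + 3 ≤ 6 * C.edges + 4 * C.nameCount by
    rcases h with h | h
    · simp [h]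
    · omega
  induction C with
  | top => exact .inl rfl
  | name A => simp [clean, nameCount]
  | conj C D ihC ihD =>
    simp only [clean, smartConj, edges_conj, nameCount]
    split_ifs with h h'
    · rcases ihD with h' | h'
      · exact .inl h'
      · exact .inr (by omega)
    · rcases ihC with h'' | h''
      · exact .inl h''
      · exact .inr (by omega)
    · have := ihC.resolve_left h
      have := ihD.resolve_left h'
      right
      simp
      omega
  | ex r C ih =>
    right
    rcases ih with h | h
    · simp [clean, h, nameCount]; omega
    · simp [clean, nameCount]; omega

/-- A tree that is covered by `C ⊓ C'` splits into a part covered by `C` and one covered by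
`C'`. -/
theorem exists_split_of_covers_conj {C C' E : ELConcept} (h : (conj C C').covers E = true) :
    ∃ E₁ E₂, C.covers E₁ = true ∧ C'.covers E₂ = true ∧ E₁.edges + E₂.edges = E.edges ∧
      E₁.nameCount + E₂.nameCount = E.nameCount ∧ (E.Reduced S → E₁.Reduced S ∧ E₂.Reduced S) ∧
      (∀ D : ELConcept, D.covers E₁ = true → D.covers E₂ = true → D.covers E = true) ∧
      E.covers E₁ = true ∧ E.covers E₂ = true := by
  induction E with
  | top => exact ⟨top, top, rfl, rfl, rfl, rfl, fun _ => ⟨trivial, trivial⟩, fun _ _ _ => rfl,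
      rfl, rfl⟩
  | name A =>
    simp only [covers, labels, decide_eq_true_eq, List.mem_append] at h
    rcases h with h | h
    · exact ⟨name A, top, by simpa [covers], rfl, rfl, rfl, fun h => ⟨h, trivial⟩,
        fun _ h _ => h, covers_refl _, rfl⟩
    · exact ⟨top, name A, rfl, by simpa [covers], rfl, rfl, fun h => ⟨trivial, h⟩,
        fun _ _ h => h, rfl, covers_refl _⟩
  | conj F G ihF ihG =>
    simp only [covers, Bool.and_eq_true] at h
    obtain ⟨F₁, F₂, f1, f2, f3, f4, f5, f6, f7, f8⟩ := ihF h.1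
    obtain ⟨G₁, G₂, g1, g2, g3, g4, g5, g6, g7, g8⟩ := ihG h.2
    refine ⟨conj F₁ G₁, conj F₂ G₂, by simp [covers, f1, g1], by simp [covers, f2, g2],
      by simp; omega, by simp [nameCount]; omega, fun h => ?_, fun D hD hD' => ?_, ?_, ?_⟩
    · refine ⟨⟨(f5 h.1).1, (g5 h.2.1).1, fun A hA hA' => h.2.2 (mem_labels_of_covers f7 hA)
        (mem_labels_of_covers g7 hA')⟩, ⟨(f5 h.1).2, (g5 h.2.1).2, fun A hA hA' =>
          h.2.2 (mem_labels_of_covers f8 hA) (mem_labels_of_covers g8 hA')⟩⟩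
    · simp only [covers, Bool.and_eq_true] at hD hD' ⊢
      exact ⟨f6 D hD.1 hD'.1, g6 D hD.2 hD'.2⟩
    · simp [covers, covers_conj_left f7, covers_conj_right g7]
    · simp [covers, covers_conj_left f8, covers_conj_right g8]
  | ex r E ih =>
    simp only [covers, succ, List.any_append, Bool.or_eq_true] at h
    rcases h with h | h
    · exact ⟨ex r E, top, by simpa only [covers] using h, rfl, rfl, rfl, fun h => ⟨h, trivial⟩,
        fun _ h _ => h, covers_refl _, rfl⟩
    · exact ⟨top, ex r E, rfl, by simpa only [covers] using h, by simp, by simp [nameCount],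
        fun h => ⟨trivial, h⟩, fun _ _ h => h, rfl, covers_refl _⟩

/-- A tree that is covered by `∃ r. C` has no edge at the root and no label there, or one edge at
the root, or can be made smaller by identifying successors of the root. -/
theorem cases_of_covers_ex {C E : ELConcept} {r : RoleName} (h : (ex r C).covers E = true) :
    (E.edges = 0 ∧ E.nameCount = 0 ∧ ∀ D : ELConcept, D.covers E = true) ∨
    (∃ E₁ : ELConcept, C.covers E₁ = true ∧ E.edges = E₁.edges + 1 ∧
      E.nameCount = E₁.nameCount ∧ (E.Reduced S → E₁.Reduced S) ∧
      (∀ D : ELConcept, D.covers E₁ = true → (ex r D).covers E = true) ∧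
      E.covers (ex r E₁) = true) ∨
    (∃ E₁ : ELConcept, C.covers E₁ = true ∧ E₁.edges + 2 ≤ E.edges ∧
      ∀ D : ELConcept, D.covers E₁ = true → (ex r D).covers E = true) := by
  induction E with
  | top => exact .inl ⟨rfl, rfl, fun _ => rfl⟩
  | name A => simp [covers, labels] at h
  | ex r' E ih =>
    simp only [covers, succ] at h
    split at h
    · subst r'
      refine .inr (.inl ⟨E, by simpa using h, by simp, rfl, fun h => h, fun D hD => ?_,
        covers_refl _⟩)
      simpa [covers, succ] using hD
    · simp at h
  | conj F G ihF ihG =>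
    simp only [covers, Bool.and_eq_true] at h
    rcases ihF h.1 with ⟨f1, f2, f3⟩ | ⟨F₁, f1, f2, f3, f4, f5, f6⟩ | ⟨F₁, f1, f2, f3⟩
    · rcases ihG h.2 with ⟨g1, g2, g3⟩ | ⟨G₁, g1, g2, g3, g4, g5, g6⟩ | ⟨G₁, g1, g2, g3⟩
      · exact .inl ⟨by simp [f1, g1], by simp [nameCount, f2, g2], fun D => by
          simp [covers, f3, g3]⟩
      · exact .inr (.inl ⟨G₁, g1, by simp [f1, g2], by simp [nameCount, f2, g3],
          fun h => g4 h.2.1, fun D hD => by simp [covers, f3, g5 D hD], covers_conj_right g6⟩)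
      · exact .inr (.inr ⟨G₁, g1, by simp; omega, fun D hD => by simp [covers, f3, g3 D hD]⟩)
    · rcases ihG h.2 with ⟨g1, g2, g3⟩ | ⟨G₁, g1, g2, g3, g4, g5, g6⟩ | ⟨G₁, g1, g2, g3⟩
      · exact .inr (.inl ⟨F₁, f1, by simp [g1, f2], by simp [nameCount, g2, f3],
          fun h => f4 h.1, fun D hD => by simp [covers, g3, f5 D hD], covers_conj_left f6⟩)
      -- Both conjuncts have an edge at the root, and `conj F₁ G₁` merges the two successors. It
      -- lacks both edges, while `∃ r` in front of it restores only one.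
      · refine .inr (.inr ⟨conj F₁ G₁, by simp [covers, f1, g1], by simp; omega, fun D hD => ?_⟩)
        simp only [covers, Bool.and_eq_true] at hD ⊢
        exact ⟨f5 D hD.1, g5 D hD.2⟩
      · refine .inr (.inr ⟨conj F₁ G₁, by simp [covers, f1, g1], by simp; omega, fun D hD => ?_⟩)
        simp only [covers, Bool.and_eq_true] at hD ⊢
        exact ⟨f5 D hD.1, g3 D hD.2⟩
    · rcases ihG h.2 with ⟨g1, g2, g3⟩ | ⟨G₁, g1, g2, g3, g4, g5, g6⟩ | ⟨G₁, g1, g2, g3⟩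
      · exact .inr (.inr ⟨F₁, f1, by simp; omega, fun D hD => by simp [covers, g3, f3 D hD]⟩)
      · refine .inr (.inr ⟨conj F₁ G₁, by simp [covers, f1, g1], by simp; omega, fun D hD => ?_⟩)
        simp only [covers, Bool.and_eq_true] at hD ⊢
        exact ⟨f3 D hD.1, g5 D hD.2⟩
      · refine .inr (.inr ⟨conj F₁ G₁, by simp [covers, f1, g1], by simp; omega, fun D hD => ?_⟩)
        simp only [covers, Bool.and_eq_true] at hD ⊢
        exact ⟨f3 D hD.1, g3 D hD.2⟩

/-- If no subtree of `C` can be removed without losing the homomorphism from `E`, then `C` has at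
most as many edges as `E`. -/
theorem edges_le_of_covers {C E : ELConcept} (h : C.covers E = true)
    (hr : ∀ D ∈ C.removals, ¬ D.covers E = true) : C.edges ≤ E.edges := by
  induction C generalizing E with
  | top => simp
  | name A => simp
  | conj C C' ih ih' =>
    -- If a removal in one conjunct still received its part of `E`, then together with the other
    -- conjunct it would receive all of `E`. So minimality passes to both conjuncts.
    obtain ⟨E₁, E₂, h1, h2, h3, -, -, h4, -, -⟩ := exists_split_of_covers_conj (S := []) h
    have := ih h1 fun D hD hc => hr (conj D C') (by simp [removals, hD])
      (h4 _ (covers_conj_left hc) (covers_conj_right h2))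
    have := ih' h2 fun D hD hc => hr (conj C D) (by simp [removals, hD])
      (h4 _ (covers_conj_left h1) (covers_conj_right hc))
    simp
    omega
  | ex r C ih =>
    obtain ⟨-, -, h⟩ | ⟨E₁, h1, h2, -, -, h3, -⟩ | ⟨E₁, h1, h2, h3⟩ :=
      cases_of_covers_ex (S := []) h
    · exact absurd (h top) (hr top (by simp [removals]))
    all_goals
      have := ih h1 fun D hD hc => hr (ex r D) (by simp [removals, hD]) (h3 D hc)
      simp
      omega

theorem nameCount_eq_of_edges_eq_zero {C : ELConcept} (h : C.edges = 0) :
    C.nameCount = C.labels.length := by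
  induction C with
  | conj C D ihC ihD =>
    simp only [edges_conj, Nat.add_eq_zero_iff] at h
    simp [labels, nameCount, ihC h.1, ihD h.2]
  | ex r C ih => simp at h
  | _ => simp [labels, nameCount]

/-- If no subtree of `C` can be removed without losing the homomorphism from `E`, and `E` has at
most as many edges as `C`, then `E` is `C` with some labels removed. -/
theorem nameCount_le_of_covers {C E : ELConcept} (h : C.covers E = true)
    (hr : ∀ D ∈ C.removals, ¬ D.covers E = true) (he : E.edges ≤ C.edges) (hE : E.Reduced S) :
    E.nameCount ≤ C.nameCount ∧ (E.nameCount = C.nameCount → E.covers C = true) := by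
  induction C generalizing E with
  | top =>
    have h0 : E.labels = [] := List.eq_nil_iff_forall_not_mem.2 fun A hA => by
      simpa [labels] using mem_labels_of_covers h hA
    have := nameCount_eq_of_edges_eq_zero (C := E) (by simpa using he)
    simp [this, h0, covers]
  | name A =>
    have h0 : E.labels ⊆ [A] := fun B hB => mem_labels_of_covers h hB
    have h1 := nameCount_eq_of_edges_eq_zero (C := E) (by simpa using he)
    have h2 := (hE.nodup.subperm h0).length_le
    refine ⟨by simpa [h1, nameCount] using h2, fun h3 => ?_⟩
    rw [h1, nameCount] at h3
    obtain ⟨B, hB⟩ := List.length_eq_one_iff.1 h3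
    have : B = A := by simpa [hB] using h0
    simp [covers, hB, this]
  | conj C C' ih ih' =>
    obtain ⟨E₁, E₂, h1, h2, h3, h4, h5, h6, h7, h8⟩ := exists_split_of_covers_conj (S := S) h
    have r1 : ∀ D ∈ C.removals, ¬ D.covers E₁ = true := fun D hD hc =>
      hr (conj D C') (by simp [removals, hD]) (h6 _ (covers_conj_left hc) (covers_conj_right h2))
    have r2 : ∀ D ∈ C'.removals, ¬ D.covers E₂ = true := fun D hD hc =>
      hr (conj C D) (by simp [removals, hD]) (h6 _ (covers_conj_left h1) (covers_conj_right hc))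
    have e1 := edges_le_of_covers h1 r1
    have e2 := edges_le_of_covers h2 r2
    simp only [edges_conj] at he
    obtain ⟨a1, a2⟩ := ih h1 r1 (by omega) (h5 hE).1
    obtain ⟨b1, b2⟩ := ih' h2 r2 (by omega) (h5 hE).2
    simp only [nameCount]
    refine ⟨by omega, fun h => ?_⟩
    simp only [covers, Bool.and_eq_true]
    exact ⟨covers_trans h7 (a2 (by omega)), covers_trans h8 (b2 (by omega))⟩
  | ex r C ih =>
    obtain ⟨-, -, h⟩ | ⟨E₁, h1, h2, h3, h4, h5, h6⟩ | ⟨E₁, h1, h2, h3⟩ :=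
      cases_of_covers_ex (S := S) h
    · exact absurd (h top) (hr top (by simp [removals]))
    · have r1 : ∀ D ∈ C.removals, ¬ D.covers E₁ = true := fun D hD hc =>
        hr (ex r D) (by simp [removals, hD]) (h5 D hc)
      simp only [edges_ex] at he
      obtain ⟨a1, a2⟩ := ih h1 r1 (by omega) (h4 hE)
      simp only [nameCount]
      refine ⟨by omega, fun h => covers_trans h6 ?_⟩
      simpa [covers, succ] using a2 (by omega)
    -- If successors were merged, `E` would have more edges than the tree to which it maps, contrary
    -- to `he`.
    · have := edges_le_of_covers h1 fun D hD hc => hr (ex r D) (by simp [removals, hD]) (h3 D hc)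
      simp only [edges_ex] at he
      omega

end ELConcept

end ExactLearning

namespace ExactLearning

open ELConcept

/-! ### Entailment -/

theorem ext_subset_of_mem_labels (I : Interpretation) {C : ELConcept} {A : ConceptName}
    (h : A ∈ C.labels) : I.ext C ⊆ I.concept A := by
  induction C with
  | top => simp [labels] at h
  | name B =>
    obtain rfl : A = B := by simpa [labels] using h
    exact fun _ h => h
  | conj C D ihC ihD =>
    rintro d ⟨hC, hD⟩
    rcases List.mem_append.1 h with h | h
    · exact ihC h hC
    · exact ihD h hD
  | ex r C ih => simp [labels] at h

theorem exists_role_of_mem_succ (I : Interpretation) {C D : ELConcept} {r : RoleName}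
    (h : D ∈ C.succ r) {d : I.Dom} (hd : d ∈ I.ext C) :
    ∃ d' ∈ I.ext D, (d, d') ∈ I.role r := by
  induction C with
  | top => simp [succ] at h
  | name B => simp [succ] at h
  | conj C C' ih ih' =>
    rcases List.mem_append.1 h with h | h
    · exact ih h hd.1
    · exact ih' h hd.2
  | ex r' C ih =>
    simp only [succ] at h
    split at h
    · subst r'
      obtain rfl : D = C := by simpa using h
      exact hd
    · simp at h

theorem ext_subset_of_covers (I : Interpretation) {C D : ELConcept} (h : D.covers C = true) :
    I.ext D ⊆ I.ext C := by
  induction C generalizing D with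
  | top => exact fun _ _ => trivial
  | name A => exact ext_subset_of_mem_labels I (by simpa [covers] using h)
  | conj C C' ih ih' =>
    simp only [covers, Bool.and_eq_true] at h
    exact fun d hd => ⟨ih h.1 hd, ih' h.2 hd⟩
  | ex r C ih =>
    simp only [covers, List.any_eq_true] at h
    obtain ⟨D', hD', h⟩ := h
    intro d hd
    obtain ⟨d', hd', hr⟩ := exists_role_of_mem_succ I hD' hd
    exact ⟨d', ih h hd', hr⟩

theorem mem_ext_names (I : Interpretation) {l : List ConceptName} {d : I.Dom} :
    d ∈ I.ext (names l) ↔ ∀ A ∈ l, d ∈ I.concept A := by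
  induction l with
  | nil => simp [names, conjs, Interpretation.ext]
  | cons A l ih =>
    simp only [names, conjs, List.map_cons, List.foldr_cons, Interpretation.ext] at *
    simp [ih]

/-- The interpretation whose domain consists of all trees. -/
def treeInterpretation (con : ConceptName → Set ELConcept) : Interpretation where
  Dom := ELConcept
  nonempty := ⟨.top⟩
  concept := con
  role r := {p | p.2 ∈ p.1.succ r}

theorem mem_ext_treeInterpretation {con : ConceptName → Set ELConcept}
    (h : ∀ (D : ELConcept), ∀ A ∈ D.labels, D ∈ con A) {C D : ELConcept}
    (hc : D.covers C = true) : D ∈ (treeInterpretation con).ext C := by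
  induction C generalizing D with
  | top => trivial
  | name A => exact h D A (by simpa [covers] using hc)
  | conj C C' ih ih' =>
    simp only [covers, Bool.and_eq_true] at hc
    exact ⟨ih hc.1, ih' hc.2⟩
  | ex r C ih =>
    simp only [covers, List.any_eq_true] at hc
    obtain ⟨D', hD', hc⟩ := hc
    exact ⟨D', ih hc, hD'⟩

variable {T : TBox}

theorem TBox.entails_of_mem {α : CI} (h : α ∈ T) : T.Entails α := fun _ hI => hI α h

theorem entails_of_mem_labels {C : ELConcept} {A : ConceptName} (h : A ∈ C.labels) :
    T.Entails ⟨C, A⟩ := fun I _ => ext_subset_of_mem_labels I h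

theorem entails_of_covers {C D : ELConcept} {A : ConceptName} (h : D.covers C = true)
    (hC : T.Entails ⟨C, A⟩) : T.Entails ⟨D, A⟩ :=
  fun I hI => (ext_subset_of_covers I h).trans (hC I hI)

/-- Let every name other than `A` hold everywhere and `A` only where it is a label. This is a model
of `T`, because `A` is not a right-hand side. -/
theorem mem_labels_of_entails {C : ELConcept} {A : ConceptName} (hA : A ∉ T.conceptNames)
    (h : T.Entails ⟨C, A⟩) : A ∈ C.labels := by
  have hm : (treeInterpretation fun B => {D | B = A → A ∈ D.labels}).IsModel T := by
    intro α hα D _ hαA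
    exact absurd (Finset.mem_biUnion.2 ⟨α, hα, by simp [← hαA]⟩) hA
  refine h _ hm (mem_ext_treeInterpretation ?_ (covers_refl C)) rfl
  intro D B hB hBA
  exact hBA ▸ hB

/-- All names that the target entails at the root of the tree `C` are labels there. -/
def ClosedAt (T : TBox) (C : ELConcept) : Prop := ∀ A, T.Entails ⟨C, A⟩ → A ∈ C.labels

/-- The tree is closed under the target at all proper descendants of the root. -/
def InnerClosed (T : TBox) : ELConcept → Prop
  | .top => True
  | .name _ => True
  | .conj C D => InnerClosed T C ∧ InnerClosed T D
  | .ex _ C => ClosedAt T C ∧ InnerClosed T C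

theorem InnerClosed.of_mem_succ {C D : ELConcept} {r : RoleName} (h : InnerClosed T C)
    (hD : D ∈ C.succ r) : ClosedAt T D ∧ InnerClosed T D := by
  induction C with
  | top => simp [succ] at hD
  | name B => simp [succ] at hD
  | conj C C' ih ih' =>
    rcases List.mem_append.1 hD with hD | hD
    · exact ih h.1 hD
    · exact ih' h.2 hD
  | ex r' C ih =>
    simp only [succ] at hD
    split at hD
    · obtain rfl : D = C := by simpa using hD
      exact h
    · simp at hD

/-- The remaining nodes keep their labels, and less is entailed there, since the old subtree covers
the new one. -/
theorem InnerClosed.of_mem_removals {C D : ELConcept} (h : InnerClosed T C)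
    (hD : D ∈ C.removals) : InnerClosed T D := by
  induction C generalizing D with
  | top => simp [removals] at hD
  | name A => simp [removals] at hD
  | conj C C' ih ih' =>
    simp only [removals, List.mem_append, List.mem_map] at hD
    obtain ⟨E, hE, rfl⟩ | ⟨E, hE, rfl⟩ := hD
    · exact ⟨ih h.1 hE, h.2⟩
    · exact ⟨h.1, ih' h.2 hE⟩
  | ex r C ih =>
    simp only [removals, List.mem_cons, List.mem_map] at hD
    obtain rfl | ⟨E, hE, rfl⟩ := hD
    · trivial
    · refine ⟨fun A hA => ?_, ih h.2 hE⟩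
      rw [labels_of_mem_removals hE]
      exact h.1 A (entails_of_covers (covers_of_mem_removals hE) hA)

theorem InnerClosed.clean {C : ELConcept} (h : InnerClosed T C) : InnerClosed T C.clean := by
  induction C with
  | conj C D ihC ihD =>
    simp only [ELConcept.clean, smartConj]
    split_ifs
    · exact ihD h.2
    · exact ihC h.1
    · exact ⟨ihC h.1, ihD h.2⟩
  | ex r C ih =>
    refine ⟨fun A hA => ?_, ih h.2⟩
    rw [labels_clean]
    exact h.1 A (entails_of_covers (covers_clean_right C) hA)
  | _ => exact h

/-- A name entailed at a node of the product is entailed at both nodes from which it arose, as these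
cover it. So it is a label of both and hence of the product. -/
theorem InnerClosed.prod {C D : ELConcept} (hC : InnerClosed T C) (hD : InnerClosed T D) :
    InnerClosed T (C.prod D) := by
  induction C generalizing D with
  | top => trivial
  | name A =>
    simp only [ELConcept.prod]
    split <;> trivial
  | conj C C' ih ih' => exact ⟨ih hC.1 hD, ih' hC.2 hD⟩
  | ex r C ih =>
    simp only [ELConcept.prod]
    have := fun D' hD' => hD.of_mem_succ (r := r) (D := D') hD'
    revert this
    generalize D.succ r = l
    intro hl
    induction l with
    | nil => trivial
    | cons D' l ihl =>
      obtain ⟨h1, h2⟩ := hl D' (by simp)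
      refine ⟨⟨fun A hA => mem_labels_prod.2 ⟨hC.1 A ?_, h1 A ?_⟩, ih hC.2 h2⟩,
        ihl fun E hE => hl E (by simp [hE])⟩
      · exact entails_of_covers (covers_prod.1 (covers_refl _)).1 hA
      · exact entails_of_covers (covers_prod.1 (covers_refl _)).2 hA

/-- If the target is violated in a tree, but only at the root, then some inclusion of the target is
violated at the root. -/
theorem InnerClosed.exists_violated {C : ELConcept} (h : InnerClosed T C) (hC : ¬ ClosedAt T C) :
    ∃ α ∈ T, C.covers α.lhs = true ∧ α.rhs ∉ C.labels := by
  by_contra! hn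
  -- Trees that respect the target everywhere: at the root by the second condition, below it by
  -- closure. Successors inherit this property.
  let Good : ELConcept → Prop := fun D =>
    InnerClosed T D ∧ ∀ α ∈ T, D.covers α.lhs = true → α.rhs ∈ D.labels
  -- Trees that are not `Good` receive all names, so no inclusion can fail there; `Good` trees
  -- receive exactly their labels.
  let con : ConceptName → Set ELConcept := fun A => {D | Good D → A ∈ D.labels}
  have hcov : ∀ E D : ELConcept, Good D → D ∈ (treeInterpretation con).ext E →
      D.covers E = true := by
    intro E
    induction E with
    | top => exact fun _ _ _ => rfl
    | name A => exact fun D hD hE => by simpa [covers] using hE hD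
    | conj E E' ih ih' => exact fun D hD hE => by simp [covers, ih D hD hE.1, ih' D hD hE.2]
    | ex r E ih =>
      rintro D hD ⟨D', hE, hr⟩
      have hr : D' ∈ D.succ r := hr
      obtain ⟨h1, h2⟩ := hD.1.of_mem_succ hr
      simp only [covers, List.any_eq_true]
      exact ⟨D', hr, ih D' ⟨h2, fun α hα hc => h1 _ (entails_of_covers hc
        (TBox.entails_of_mem hα))⟩ hE⟩
  have hm : (treeInterpretation con).IsModel T := fun α hα D hD hg =>
    hg.2 α hα (hcov _ D hg hD)
  exact hC fun A hA => hA _ hm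
    (mem_ext_treeInterpretation (con := con) (fun D A hA _ => hA) (covers_refl C)) ⟨h, hn⟩

/-! ### Correctness of the learner -/

/-- The circumstances of a learning session: `O` answers the membership queries for the target
`T`, and `S` lists the concept names in the signature of `T`. -/
structure Session (T : TBox) (O : Orc) (S : List ConceptName) : Prop where
  oracle : ∀ α, O α = true ↔ T.Entails α
  mem_signature : ∀ A, A ∈ S ↔ A ∈ T.conceptNames
  nodup : S.Nodup

variable {O : Orc} {S : List ConceptName}

namespace Session

variable (hs : Session T O S)

include hs

theorem rhs_mem {α : CI} (h : α ∈ T) : α.rhs ∈ S :=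
  (hs.mem_signature _).2 (Finset.mem_biUnion.2 ⟨α, h, by simp⟩)

theorem mem_entailed {C : ELConcept} {A : ConceptName} :
    A ∈ entailed O S C ↔ A ∈ S ∧ T.Entails ⟨C, A⟩ := by
  simp [entailed, hs.oracle]

theorem mem_labels_of_entails {C : ELConcept} {A : ConceptName} (hA : A ∉ S)
    (h : T.Entails ⟨C, A⟩) : A ∈ C.labels :=
  ExactLearning.mem_labels_of_entails (by rwa [hs.mem_signature] at hA) h

theorem violated_iff {C : ELConcept} :
    violated O S C = true ↔ ∃ A ∈ S, T.Entails ⟨C, A⟩ ∧ A ∉ C.labels := by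
  simp [violated, hs.oracle]

theorem violated_of_mem {C : ELConcept} {α : CI} (hα : α ∈ T) (hc : C.covers α.lhs = true)
    (hl : α.rhs ∉ C.labels) : violated O S C = true :=
  hs.violated_iff.2 ⟨α.rhs, hs.rhs_mem hα, entails_of_covers hc (TBox.entails_of_mem hα), hl⟩

theorem exists_of_violated {C : ELConcept} (h : InnerClosed T C) (hv : violated O S C = true) :
    ∃ α ∈ T, C.covers α.lhs = true ∧ α.rhs ∉ C.labels := by
  obtain ⟨A, -, h1, h2⟩ := hs.violated_iff.1 hv
  exact h.exists_violated fun hc => h2 (hc A h1)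

theorem violated_clean (C : ELConcept) : violated O S C.clean = violated O S C := by
  rw [Bool.eq_iff_iff, hs.violated_iff, hs.violated_iff, labels_clean]
  have : ∀ A, T.Entails ⟨C.clean, A⟩ ↔ T.Entails ⟨C, A⟩ := fun A =>
    ⟨entails_of_covers (covers_clean_right C), entails_of_covers (by
      rw [covers_clean]; exact covers_refl C)⟩
  simp [this]

/-! #### Closure of trees -/

omit hs in
theorem labels_kids (C : ELConcept) : (kids O S C).labels = [] := by
  induction C with
  | conj C D ihC ihD => simp [kids, labels, ihC, ihD]
  | _ => rfl

theorem ext_subset_kids {I : Interpretation} (hI : I.IsModel T) (C : ELConcept) :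
    I.ext C ⊆ I.ext (kids O S C) := by
  induction C with
  | top => exact fun _ _ => trivial
  | name A => exact fun _ _ => trivial
  | conj C D ihC ihD => exact fun d hd => ⟨ihC hd.1, ihD hd.2⟩
  | ex r C ih =>
    rintro d ⟨d', hd', hr⟩
    exact ⟨d', ⟨(mem_ext_names I).2 fun A hA => (hs.mem_entailed.1 hA).2 I hI hd', ih hd'⟩, hr⟩

/-- In models of the target, every instance of a subtree is one of its enriched version, so the
latter entails no further names. Those in the signature have been added; any other name is entailed
only as a label. -/
theorem innerClosed_kids (C : ELConcept) : InnerClosed T (kids O S C) := by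
  induction C with
  | top => trivial
  | name A => trivial
  | conj C D ihC ihD => exact ⟨ihC, ihD⟩
  | ex r C ih =>
    refine ⟨fun A hA => ?_, ?_, ih⟩
    · by_cases hAS : A ∈ S
      · have : A ∈ entailed O S C := hs.mem_entailed.2 ⟨hAS, fun I hI d hd => hA I hI
          ⟨(mem_ext_names I).2 fun B hB => (hs.mem_entailed.1 hB).2 I hI hd,
            hs.ext_subset_kids hI C hd⟩⟩
        simp [labels, labels_names, this]
      · exact hs.mem_labels_of_entails hAS hA
    · generalize entailed O S C = l
      induction l with
      | nil => trivial
      | cons A l ihl => exact ⟨trivial, ihl⟩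

omit hs in
theorem reduced_names {l : List ConceptName} (hl : l ⊆ S) (hd : l.Nodup) :
    (names l).Reduced S := by
  induction l with
  | nil => trivial
  | cons A l ih =>
    rw [List.nodup_cons] at hd
    rw [List.cons_subset] at hl
    refine ⟨hl.1, ih hl.2 hd.2, ?_⟩
    change List.Disjoint [A] (names l).labels
    rw [labels_names]
    simpa using hd.1

theorem reduced_kids (C : ELConcept) : (kids O S C).Reduced S := by
  induction C with
  | top => trivial
  | name A => trivial
  | conj C D ihC ihD => exact ⟨ihC, ihD, by simp [labels_kids]⟩
  | ex r C ih =>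
    exact ⟨reduced_names (List.filter_subset_self _) (hs.nodup.filter _), ih, by simp [labels_kids]⟩

/-- Names outside the signature of the target do not matter. -/
theorem entails_restrict {C : ELConcept} {A : ConceptName} (hA : A ∈ S)
    (h : T.Entails ⟨C, A⟩) :
    T.Entails ⟨.conj (names (S.filter fun B => decide (B ∈ C.labels))) (kids O S C), A⟩ := by
  intro I hI d hd
  -- In `J` every name outside the signature holds everywhere; neither the target nor `A` notices
  -- the change.
  let J : Interpretation := { I with concept := fun B => {d | B ∈ S → d ∈ I.concept B} }
  have hJ : ∀ E : ELConcept, (∀ B ∈ E.conceptNames, B ∈ S) → J.ext E = I.ext E := by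
    intro E hE
    induction E with
    | top => rfl
    | name B =>
      have hB : B ∈ S := hE B (by simp [ELConcept.conceptNames])
      ext x
      exact ⟨fun h => h hB, fun h _ => h⟩
    | conj E F ihE ihF =>
      simp only [Interpretation.ext]
      rw [ihE fun B hB => hE B (by simp [ELConcept.conceptNames, hB]),
        ihF fun B hB => hE B (by simp [ELConcept.conceptNames, hB])]
    | ex r E ih =>
      simp only [Interpretation.ext]
      rw [ih hE]
  have hJT : J.IsModel T := by
    intro α hα x hx _
    rw [hJ _ fun B hB => (hs.mem_signature B).2 (Finset.mem_biUnion.2 ⟨α, hα, by simp [hB]⟩)] at hx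
    exact hI α hα hx
  -- Membership in `J` requires only the labels in the signature, and below the root these are among
  -- the names added by `kids`.
  have key : ∀ (E : ELConcept) (x : I.Dom), (∀ B ∈ S, B ∈ E.labels → x ∈ I.concept B) →
      x ∈ I.ext (kids O S E) → x ∈ J.ext E := by
    intro E
    induction E with
    | top => exact fun _ _ _ => trivial
    | name B => exact fun x hl _ hB => hl B hB (by simp [labels])
    | conj E F ihE ihF =>
      exact fun x hl hk => ⟨ihE x (fun B hB hB' => hl B hB (by simp [labels, hB'])) hk.1,
        ihF x (fun B hB hB' => hl B hB (by simp [labels, hB'])) hk.2⟩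
    | ex r E ih =>
      rintro x - ⟨y, ⟨hy1, hy2⟩, hr⟩
      refine ⟨y, ih y (fun B hB hB' => ?_) hy2, hr⟩
      exact (mem_ext_names I).1 hy1 B (hs.mem_entailed.2 ⟨hB, entails_of_mem_labels hB'⟩)
  exact h J hJT (key C d (fun B hB hB' => (mem_ext_names I).1 hd.1 B (by simp [hB, hB'])) hd.2) hA

/-! #### Closure of labels under the hypothesis -/

omit hs in
theorem mem_closeStep {L : List ELConcept} {K : ELConcept} {ℓ : List ConceptName}
    {A : ConceptName} : A ∈ closeStep O S L K ℓ ↔ A ∈ S ∧ (A ∈ ℓ ∨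
      ∃ C ∈ L, O ⟨C, A⟩ = true ∧ (ELConcept.conj (names ℓ) K).covers C = true) := by
  simp [closeStep]

omit hs in
theorem closeLabel_induction {L : List ELConcept} {K : ELConcept} {ℓ : List ConceptName}
    {P : List ConceptName → Prop} (h0 : P ℓ) (hP : ∀ m, P m → P (closeStep O S L K m)) :
    P (closeLabel O S L K ℓ) := by
  unfold closeLabel
  generalize S.length = n
  induction n with
  | zero => exact h0
  | succ n ih => rw [Function.iterate_succ_apply']; exact hP _ ih

omit hs in
/-- The closure of a label is closed. -/
theorem closeStep_closeLabel {L : List ELConcept} {K : ELConcept} {f : ConceptName → Bool} :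
    closeStep O S L K (closeLabel O S L K (S.filter f)) = closeLabel O S L K (S.filter f) := by
  -- Labels are sublists of `S` that only grow, so a step that does not lengthen the label leaves it
  -- fixed.
  have step : ∀ m, (∃ g : ConceptName → Bool, m = S.filter g) →
      (closeStep O S L K m = m ∨ m.length < (closeStep O S L K m).length) := by
    rintro m ⟨g, rfl⟩
    have hg : S.filter g = S.filter fun A => decide (A ∈ S.filter g) :=
      List.filter_congr fun A hA => by simp [hA]
    have hsub : (S.filter g).Sublist (closeStep O S L K (S.filter g)) := by
      conv_lhs => rw [hg]
      exact List.monotone_filter_right _ fun A hA => by simp only [hA, Bool.true_or]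
    rcases hsub.length_le.eq_or_lt with h | h
    · exact .inl (hsub.eq_of_length h).symm
    · exact .inr h
  -- Every step before the fixed point adds a name, so `S.length` steps exhaust the signature.
  have key : ∀ n, (∃ g : ConceptName → Bool, (closeStep O S L K)^[n] (S.filter f) = S.filter g) ∧
      (closeStep O S L K ((closeStep O S L K)^[n] (S.filter f)) =
        (closeStep O S L K)^[n] (S.filter f) ∨
        n < (closeStep O S L K ((closeStep O S L K)^[n] (S.filter f))).length) := by
    intro n
    induction n with
    | zero =>
      refine ⟨⟨f, rfl⟩, (step _ ⟨f, rfl⟩).imp id fun h => ?_⟩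
      exact lt_of_le_of_lt (Nat.zero_le _) h
    | succ n ih =>
      rw [Function.iterate_succ_apply']
      have hg : ∃ g : ConceptName → Bool,
        closeStep O S L K ((closeStep O S L K)^[n] (S.filter f)) = S.filter g := ⟨_, rfl⟩
      refine ⟨hg, ?_⟩
      rcases ih.2 with h | h
      · left
        rw [h, h]
      · rcases step _ hg with h' | h'
        · exact .inl h'
        · exact .inr (by omega)
  obtain ⟨-, h | h⟩ := key S.length
  · exact h
  · exact absurd (List.length_filter_le _ S) (not_le.2 h)


/-! #### Processing a counterexample -/

theorem reduced_candidate (L : List ELConcept) (N : ELConcept) :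
    (candidate O S L N).Reduced S := by
  refine ⟨?_, hs.reduced_kids N, by simp [labels_kids]⟩
  obtain ⟨g, hg⟩ : ∃ g : ConceptName → Bool, closeLabel O S L (kids O S N)
      (S.filter fun B => decide (B ∈ N.labels)) = S.filter g :=
    closeLabel_induction (P := fun ℓ => ∃ g : ConceptName → Bool, ℓ = S.filter g) ⟨_, rfl⟩
      fun m _ => ⟨_, rfl⟩
  rw [hg]
  exact reduced_names (List.filter_subset_self _) (hs.nodup.filter _)

omit hs in
theorem labels_candidate (L : List ELConcept) (N : ELConcept) :
    (candidate O S L N).labels = closeLabel O S L (kids O S N)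
      (S.filter fun B => decide (B ∈ N.labels)) := by
  simp [candidate, labels, labels_names, labels_kids]

theorem innerClosed_candidate (L : List ELConcept) (N : ELConcept) :
    InnerClosed T (candidate O S L N) := by
  refine ⟨?_, hs.innerClosed_kids N⟩
  generalize closeLabel O S L (kids O S N) (S.filter fun B => decide (B ∈ N.labels)) = l
  induction l with
  | nil => trivial
  | cons A l ihl => exact ⟨trivial, ihl⟩

/-- No inclusion of the hypothesis is violated at the root of a candidate. -/
theorem mem_labels_candidate {L : List ELConcept} {N C : ELConcept} (hC : C ∈ L)
    (hc : (candidate O S L N).covers C = true) {A : ConceptName} (hA : A ∈ S)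
    (hCA : T.Entails ⟨C, A⟩) : A ∈ (candidate O S L N).labels := by
  rw [labels_candidate, ← closeStep_closeLabel, mem_closeStep]
  exact ⟨hA, .inr ⟨C, hC, (hs.oracle _).2 hCA, hc⟩⟩

theorem mem_hypothesis {L : List ELConcept} {α : CI} :
    α ∈ hypothesis O S L ↔ α.lhs ∈ L ∧ α.rhs ∈ S ∧ T.Entails α := by
  simp only [hypothesis, List.mem_flatMap, List.mem_map, hs.mem_entailed]
  constructor
  · rintro ⟨C, hC, A, ⟨hA, h⟩, rfl⟩
    exact ⟨hC, hA, h⟩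
  · rintro ⟨hC, hA, h⟩
    exact ⟨α.lhs, hC, α.rhs, ⟨hA, h⟩, rfl⟩

/-- As the candidate is not violated, `A` is a label of its root. These labels arise from those of
`N` by inclusions of the hypothesis, which hold in `I`; what the inclusions need below the root is
supplied by `hk`. -/
theorem ext_subset_of_not_violated {L : List ELConcept} {I : Interpretation}
    (hI : I.IsModel (hypothesis O S L).toFinset) {N : ELConcept}
    (hN : violated O S (candidate O S L N) = false) (hk : I.ext N ⊆ I.ext (kids O S N))
    {A : ConceptName} (hA : A ∈ S) (h : T.Entails ⟨N, A⟩) : I.ext N ⊆ I.concept A := by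
  have h1 : T.Entails ⟨candidate O S L N, A⟩ := by
    intro J hJ d hd
    refine hs.entails_restrict hA h J hJ ⟨(mem_ext_names J).2 ?_, hd.2⟩
    intro B hB
    refine (mem_ext_names J).1 hd.1 B (closeLabel_induction (P := fun ℓ => B ∈ ℓ) hB fun m hm => ?_)
    exact mem_closeStep.2 ⟨(List.mem_filter.1 hB).1, .inl hm⟩
  have h2 : A ∈ (candidate O S L N).labels := by
    by_contra hn
    have := hs.violated_iff.2 ⟨A, hA, h1, hn⟩
    rw [hN] at this
    cases this
  rw [labels_candidate] at h2
  intro d hd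
  suffices hh : ∀ B ∈ closeLabel O S L (kids O S N) (S.filter fun B => decide (B ∈ N.labels)),
      d ∈ I.concept B from hh A h2
  refine closeLabel_induction (P := fun ℓ => ∀ B ∈ ℓ, d ∈ I.concept B) ?_ ?_
  · intro B hB
    simp only [List.mem_filter, decide_eq_true_eq] at hB
    exact ext_subset_of_mem_labels I hB.2 hd
  · intro m hm B hB
    obtain ⟨hBS, hB | ⟨C, hC, hCB, hc⟩⟩ := mem_closeStep.1 hB
    · exact hm B hB
    · have hα : (⟨C, B⟩ : CI) ∈ (hypothesis O S L).toFinset :=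
        List.mem_toFinset.2 (hs.mem_hypothesis.2 ⟨hC, hBS, (hs.oracle _).1 hCB⟩)
      exact hI _ hα (ext_subset_of_covers I hc ⟨(mem_ext_names I).2 hm, hk hd⟩)

/-- A counterexample leads to a tree at the root of which the target is violated. -/
theorem exists_violated_candidate {L : List ELConcept} {α : CI} (hT : T.Entails α)
    (hH : ¬ TBox.Entails (hypothesis O S L).toFinset α) :
    ∃ N ∈ α.lhs :: α.lhs.subtrees, violated O S (candidate O S L N) = true := by
  by_contra! hn
  simp only [Bool.not_eq_true] at hn
  refine hH fun I hI => ?_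
  -- Induction from the leaves up: if no candidate of a proper subtree is violated, the names that
  -- `kids` adds already follow from the hypothesis.
  have key : ∀ C : ELConcept, (∀ N ∈ C.subtrees, violated O S (candidate O S L N) = false) →
      I.ext C ⊆ I.ext (kids O S C) := by
    intro C
    induction C with
    | top => exact fun _ _ _ => trivial
    | name A => exact fun _ _ _ => trivial
    | conj C D ihC ihD =>
      intro h d hd
      exact ⟨ihC (fun N hN => h N (by simp [subtrees, hN])) hd.1,
        ihD (fun N hN => h N (by simp [subtrees, hN])) hd.2⟩
    | ex r C ih =>
      rintro h d ⟨d', hd', hr⟩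
      have hk := ih fun N hN => h N (by simp [subtrees, hN])
      refine ⟨d', ⟨(mem_ext_names I).2 fun A hA => ?_, hk hd'⟩, hr⟩
      obtain ⟨hA, hCA⟩ := hs.mem_entailed.1 hA
      exact hs.ext_subset_of_not_violated hI (h C (by simp [subtrees])) hk hA hCA hd'
  by_cases hA : α.rhs ∈ S
  · exact hs.ext_subset_of_not_violated hI (hn _ (by simp))
      (key _ fun N hN => hn N (by simp [hN])) hA hT
  · exact ext_subset_of_mem_labels I (hs.mem_labels_of_entails hA hT)

theorem violation_spec {L : List ELConcept} {α : CI} (hT : T.Entails α)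
    (hH : ¬ TBox.Entails (hypothesis O S L).toFinset α) :
    violated O S (violation O S L α.lhs) = true ∧
      ∃ N, violation O S L α.lhs = candidate O S L N := by
  obtain ⟨N, hN, hv⟩ := hs.exists_violated_candidate hT hH
  unfold violation
  cases h : ((α.lhs :: α.lhs.subtrees).map (candidate O S L)).filter (violated O S) with
  | nil =>
    rw [List.filter_eq_nil_iff] at h
    exact absurd hv (h _ (List.mem_map_of_mem hN))
  | cons D l =>
    have : D ∈ ((α.lhs :: α.lhs.subtrees).map (candidate O S L)).filter (violated O S) := by
      rw [h]; simp
    obtain ⟨h1, h2⟩ := List.mem_filter.1 this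
    obtain ⟨N, -, rfl⟩ := List.mem_map.1 h1
    exact ⟨h2, N, rfl⟩

/-! #### Minimal trees -/

/-- A tree in which the target is violated, but only at the root. -/
structure Bad (T : TBox) (O : Orc) (S : List ConceptName) (C : ELConcept) : Prop where
  inner : InnerClosed T C
  reduced : C.Reduced S
  violated : ExactLearning.violated O S C = true

/-- A hypothesis tree. -/
structure Good (T : TBox) (O : Orc) (S : List ConceptName) (C : ELConcept) : Prop
    extends Bad T O S C where
  minimal : ∀ D ∈ C.removals, ExactLearning.violated O S D = false
  clean : ∃ D : ELConcept, C = D.clean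

omit hs in
theorem shrinkStep_of_not_minimal {C : ELConcept}
    (h : ¬ ∀ D ∈ C.removals, ExactLearning.violated O S D.clean = false) :
    (shrinkStep O S C).edges < C.edges := by
  push Not at h
  obtain ⟨D, hD, hv⟩ := h
  obtain hC | ⟨E, hE, h1, -⟩ := shrinkStep_eq O S C
  · exfalso
    unfold shrinkStep at hC
    cases h : (C.removals.map ELConcept.clean).filter (ExactLearning.violated O S) with
    | nil =>
      rw [List.filter_eq_nil_iff] at h
      exact h _ (List.mem_map_of_mem hD) (by simpa using hv)
    | cons E l =>
      rw [h, List.headD_cons] at hC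
      have : E ∈ (C.removals.map ELConcept.clean).filter (ExactLearning.violated O S) := by simp [h]
      obtain ⟨F, hF, rfl⟩ := List.mem_map.1 (List.mem_filter.1 this).1
      have := edges_lt_of_mem_removals hF
      rw [← hC, edges_clean] at this
      omega
  · rw [h1, edges_clean]
    exact edges_lt_of_mem_removals hE

/-- A step either changes nothing, and then the tree is minimal, or costs an edge. So as many steps
as there are edges suffice. -/
theorem shrink_spec {C : ELConcept} (h : Bad T O S C) :
    Good T O S (shrink O S C) ∧ (shrink O S C).labels = C.labels ∧
      C.covers (shrink O S C) = true := by
  have key : ∀ n, Bad T O S ((shrinkStep O S)^[n] C.clean) ∧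
      ((shrinkStep O S)^[n] C.clean).labels = C.labels ∧
      C.covers ((shrinkStep O S)^[n] C.clean) = true ∧
      ((∀ D ∈ ((shrinkStep O S)^[n] C.clean).removals,
        ExactLearning.violated O S D.clean = false) ∨
        ((shrinkStep O S)^[n] C.clean).edges + n ≤ C.edges) ∧
      ∃ D : ELConcept, (shrinkStep O S)^[n] C.clean = D.clean := by
    intro n
    induction n with
    | zero => exact ⟨⟨h.inner.clean, h.reduced.clean, by
        rw [Function.iterate_zero, id, hs.violated_clean]; exact h.violated⟩,
        labels_clean C, covers_clean_right C, .inr (edges_clean C).le, C, rfl⟩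
    | succ n ih =>
      rw [Function.iterate_succ_apply']
      generalize (shrinkStep O S)^[n] C.clean = D at *
      obtain ⟨hb, hl, hc, hm, hcl⟩ := ih
      obtain h1 | ⟨E, hE, h1, hv⟩ := shrinkStep_eq O S D
      · rw [h1]
        refine ⟨hb, hl, hc, .inl ?_, hcl⟩
        by_contra hn
        have := shrinkStep_of_not_minimal hn
        rw [h1] at this
        exact lt_irrefl _ this
      · refine ⟨?_, ?_, ?_, ?_, E, h1⟩
        · rw [h1]
          exact ⟨(hb.inner.of_mem_removals hE).clean, (hb.reduced.of_mem_removals hE).clean, hv⟩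
        · rw [h1, labels_clean, labels_of_mem_removals hE, hl]
        · rw [h1]
          exact covers_trans hc (covers_trans (covers_of_mem_removals hE) (covers_clean_right E))
        · right
          rw [h1, edges_clean]
          have := edges_lt_of_mem_removals hE
          rcases hm with hm | hm
          · rw [hm E hE] at hv
            cases hv
          · omega
  obtain ⟨hb, hl, hc, hm, hcl⟩ := key C.edges
  refine ⟨⟨hb, fun D hD => ?_, hcl⟩, hl, hc⟩
  rcases hm with hm | hm
  · rw [← hs.violated_clean]
    exact hm D hD
  -- In this case no edge is left after `C.edges` steps, so there is nothing to remove.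
  · have := edges_lt_of_mem_removals hD
    change (shrink O S C).edges + C.edges ≤ C.edges at hm
    omega

/-- If the left-hand side still mapped to a removal, the removal would be violated as well, because
it has the same root labels. -/
theorem exists_minimal {C : ELConcept} (h : Good T O S C) :
    ∃ α ∈ T, C.covers α.lhs = true ∧ α.rhs ∉ C.labels ∧
      ∀ D ∈ C.removals, ¬ D.covers α.lhs = true := by
  obtain ⟨α, hα, hc, hl⟩ := hs.exists_of_violated h.inner h.violated
  refine ⟨α, hα, hc, hl, fun D hD hc' => ?_⟩
  have := hs.violated_of_mem hα hc' (by rwa [labels_of_mem_removals hD])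
  rw [h.minimal D hD] at this
  cases this

omit hs in
theorem edges_add_one_le_size (C : ELConcept) : C.edges + 1 ≤ C.size := by
  induction C with
  | top => simp [ELConcept.size]
  | name A => simp [ELConcept.size]
  | conj C D ihC ihD => simp [ELConcept.size]; omega
  | ex r C ih => simp [ELConcept.size]; omega

/-- The bound does not involve the counterexample from which the tree arose. This keeps the state of
the learner small. -/
theorem edges_le {C : ELConcept} (h : Good T O S C) : C.edges ≤ T.size := by
  obtain ⟨α, hα, hc, -, hr⟩ := hs.exists_minimal h
  have h1 := edges_le_of_covers hc hr
  have h2 := edges_add_one_le_size α.lhs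
  have h3 : α.size ≤ T.size := Finset.single_le_sum (f := CI.size) (fun _ _ => Nat.zero_le _) hα
  simp only [CI.size] at h3
  omega

theorem nameCount_le {C : ELConcept} (h : Good T O S C) :
    C.nameCount ≤ (T.size + 1) * S.length := by
  have h1 := h.reduced.nameCount_le
  have h2 := h.reduced.length_labels_le
  have h3 := Nat.mul_le_mul_right S.length (hs.edges_le h)
  rw [Nat.add_mul]
  omega

theorem esize_le {C : ELConcept} (h : Good T O S C) :
    esize C ≤ 6 * T.size + 4 * ((T.size + 1) * S.length) + 1 := by
  obtain ⟨D, rfl⟩ := h.clean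
  have h1 := esize_clean_le_measures D
  have h2 := hs.edges_le h
  have h3 := hs.nameCount_le h
  rw [edges_clean] at h2
  rw [nameCount_clean] at h3
  omega

end Session

end ExactLearning

namespace ExactLearning

open ELConcept

variable {T : TBox} {O : Orc} {S : List ConceptName}

/-! ### Progress of the learner -/

/-- A strict bound on the number of occurrences of concept names in hypothesis trees. -/
def nameBound (T : TBox) (S : List ConceptName) : ℕ := (T.size + 1) * S.length + 1

/-- The measure that decreases when a hypothesis tree is refined: lexicographically, the root
loses labels, the tree gains edges, or the tree loses labels. -/
def potential (T : TBox) (S : List ConceptName) (C : ELConcept) : ℕ :=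
  -- On hypothesis trees each weight exceeds the largest possible sum of the terms after it.
  C.labels.length * ((T.size + 1) * nameBound T S) + (T.size - C.edges) * nameBound T S +
    C.nameCount

/-- A bound on the potential of hypothesis trees. -/
def maxPotential (T : TBox) (S : List ConceptName) : ℕ :=
  S.length * ((T.size + 1) * nameBound T S) + T.size * nameBound T S + nameBound T S

/-- A bound on the number of counterexamples that the learner with hypothesis trees `L` still
needs. -/
def remaining (T : TBox) (S : List ConceptName) (L : List ELConcept) : ℕ :=
  -- A tree still to be appended is charged with the maximal potential, and with one for the round
  -- that appends it.
  (L.map (potential T S)).sum + (T.card - L.length) * (maxPotential T S + 1)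

/-- The invariant of the learner: an inclusion of the target that is violated in a hypothesis tree
is not applicable in an earlier one. -/
structure LearnInv (T : TBox) (O : Orc) (S : List ConceptName) (L : List ELConcept) : Prop where
  good : ∀ C ∈ L, Session.Good T O S C
  pairwise : L.Pairwise fun C D => ∀ α ∈ T, D.covers α.lhs = true → α.rhs ∉ D.labels →
    ¬ C.covers α.lhs = true

theorem refine_cases (D : ELConcept) (L : List ELConcept) :
    ((∀ C ∈ L, refinable O S D C = false) ∧ refine O S D L = L ++ [D]) ∨
    ∃ L₁ C L₂, L = L₁ ++ C :: L₂ ∧ (∀ C ∈ L₁, refinable O S D C = false) ∧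
      refinable O S D C = true ∧ refine O S D L = L₁ ++ shrink O S (C.prod D) :: L₂ := by
  induction L with
  | nil => exact .inl ⟨by simp, rfl⟩
  | cons C L ih =>
    cases h : refinable O S D C with
    | true => exact .inr ⟨[], C, L, rfl, by simp, h, by simp [refine, h]⟩
    | false =>
      rcases ih with ⟨h1, h2⟩ | ⟨L₁, E, L₂, rfl, h1, h2, h3⟩
      · exact .inl ⟨by simpa [h] using h1, by simp [refine, h, h2]⟩
      · exact .inr ⟨C :: L₁, E, L₂, rfl, by simpa [h] using h1, h2, by simp [refine, h, h3]⟩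

namespace Session

variable (hs : Session T O S)

include hs

theorem potential_le {C : ELConcept} (h : Good T O S C) : potential T S C ≤ maxPotential T S := by
  have h1 := Nat.mul_le_mul_right ((T.size + 1) * nameBound T S) h.reduced.length_labels_le
  have h2 := Nat.mul_le_mul_right (nameBound T S) (Nat.sub_le T.size C.edges)
  have h3 := hs.nameCount_le h
  have h4 : nameBound T S = (T.size + 1) * S.length + 1 := rfl
  unfold potential maxPotential
  omega

/-- The new tree `E` maps to `C`, so its root labels are among those of `C`. If none is lost, an
inclusion violated in `E` is violated in `C` too; by minimality of `C`, then, `E` maps to no removal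
of `C` and has at least as many edges. If it has equally many, `E` is `C` with labels removed. Some
label is indeed lost, for otherwise `C` would map to `E` and hence to `D`. -/
theorem refine_spec {C D : ELConcept} (hC : Good T O S C) (hD : Bad T O S D)
    (h : refinable O S D C = true) :
    Good T O S (shrink O S (C.prod D)) ∧
      potential T S (shrink O S (C.prod D)) < potential T S C := by
  simp only [refinable, Bool.and_eq_true, Bool.not_eq_true'] at h
  obtain ⟨hg, hl, hc⟩ := hs.shrink_spec
    (C := C.prod D) ⟨hC.inner.prod hD.inner, hC.reduced.prod D, h.1⟩
  refine ⟨hg, ?_⟩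
  obtain ⟨hcC, hcD⟩ : C.covers (C.prod D) = true ∧ D.covers (C.prod D) = true :=
    covers_prod.1 (covers_refl _)
  generalize shrink O S (C.prod D) = E at *
  have hCE := covers_trans hcC hc
  have hDE := covers_trans hcD hc
  have hsub : E.labels ⊆ C.labels := fun A hA => mem_labels_of_covers hCE hA
  have hperm := hg.reduced.nodup.subperm hsub
  have hE := hs.edges_le hg
  have hn := hs.nameCount_le hg
  have hΛ : nameBound T S = (T.size + 1) * S.length + 1 := rfl
  unfold potential
  generalize nameBound T S = Λ at *
  rcases hperm.length_le.eq_or_lt with hlen | hlen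
  · rw [hlen]
    have hlab : ∀ A, A ∈ E.labels ↔ A ∈ C.labels := fun A =>
      (hperm.perm_of_length_le hlen.ge).mem_iff
    obtain ⟨α, hα, hcα, hrα⟩ := hs.exists_of_violated hg.inner hg.violated
    have hr : ∀ F ∈ C.removals, ¬ F.covers E = true := fun F hF hFE => by
      have := hs.violated_of_mem hα (covers_trans hFE hcα)
        (by rwa [labels_of_mem_removals hF, ← hlab])
      rw [hC.minimal F hF] at this
      cases this
    rcases (edges_le_of_covers hCE hr).eq_or_lt with he | he
    · obtain ⟨h1, h2⟩ := nameCount_le_of_covers hCE hr he.ge hg.reduced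
      have h3 : E.nameCount ≠ C.nameCount := fun h3 => by
        have := covers_trans hDE (h2 h3)
        rw [h.2] at this
        cases this
      rw [he]
      omega
    · have : (T.size - E.edges + 1) * Λ ≤ (T.size - C.edges) * Λ :=
        Nat.mul_le_mul_right _ (by omega)
      rw [Nat.add_mul] at this
      omega
  · have h1 : (E.labels.length + 1) * ((T.size + 1) * Λ) ≤ C.labels.length * ((T.size + 1) * Λ) :=
      Nat.mul_le_mul_right _ hlen
    have h2 := Nat.mul_le_mul_right Λ (Nat.sub_le T.size E.edges)
    rw [Nat.add_mul, Nat.add_mul T.size] at h1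
    rw [Nat.add_mul T.size]
    omega

/-- Hypothesis trees violate different inclusions of the target. -/
theorem length_le {L : List ELConcept} (h : LearnInv T O S L) : L.length ≤ T.card := by
  classical
  obtain ⟨hg, hp⟩ := h
  have : Inhabited CI := ⟨⟨.top, 0⟩⟩
  choose! f hf hc hl using fun C hC => hs.exists_of_violated (hg C hC).inner (hg C hC).violated
  have hn : (L.map f).Nodup := by
    rw [List.Nodup, List.pairwise_map]
    -- An inclusion chosen for two trees would be violated in the later one and applicable in the
    -- earlier one.
    refine hp.imp_of_mem fun {C D} hC hD hCD hfg => ?_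
    exact hCD (f D) (hf D hD) (hc D hD) (hl D hD) (hfg ▸ hc C hC)
  have : (L.map f).toFinset ⊆ T := fun α hα => by
    obtain ⟨C, hC, rfl⟩ := List.mem_map.1 (List.mem_toFinset.1 hα)
    exact hf C hC
  have := Finset.card_le_card this
  rwa [List.toFinset_card_of_nodup hn, List.length_map] at this

/-- An inclusion of the target that is violated in the new tree `D` is not applicable in a
hypothesis tree that cannot be refined with `D`. -/
theorem not_covers_of_not_refinable {C D : ELConcept} (h : refinable O S D C = false)
    (hclosed : D.covers C = true → ∀ A ∈ S, T.Entails ⟨C, A⟩ → A ∈ D.labels) {α : CI}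
    (hα : α ∈ T) (hD : D.covers α.lhs = true) (hl : α.rhs ∉ D.labels) :
    ¬ C.covers α.lhs = true := by
  intro hC
  have hv : violated O S (C.prod D) = true := hs.violated_of_mem hα (covers_prod.2 ⟨hC, hD⟩)
    fun hm => hl (mem_labels_prod.1 hm).2
  simp only [refinable, hv, Bool.true_and, Bool.not_eq_false'] at h
  exact hl (hclosed h _ (hs.rhs_mem hα) (entails_of_covers hC (TBox.entails_of_mem hα)))

/-- An appended tree fits in because no tree before it was refinable. If `E` replaces `C`, then `E`
maps to `C`, so nothing new becomes applicable with respect to later trees. With respect to earlier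
ones, an inclusion violated in `E` has its right-hand side missing in `C`, where the old invariant
applies, or in `D`, with which the earlier trees are not refinable. -/
theorem refine_inv {L : List ELConcept} {D : ELConcept} (hL : LearnInv T O S L)
    (hD : Good T O S D)
    (hclosed : ∀ C ∈ L, D.covers C = true → ∀ A ∈ S, T.Entails ⟨C, A⟩ → A ∈ D.labels) :
    LearnInv T O S (refine O S D L) ∧ remaining T S (refine O S D L) < remaining T S L := by
  rcases refine_cases (O := O) (S := S) D L with ⟨h1, h2⟩ | ⟨L₁, C, L₂, rfl, h1, h2, h3⟩
  · have hinv : LearnInv T O S (refine O S D L) := by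
      rw [h2]
      refine ⟨?_, List.pairwise_append.2 ⟨hL.pairwise, List.pairwise_singleton _ _, ?_⟩⟩
      · intro C hC
        rcases List.mem_append.1 hC with hC | hC
        · exact hL.good C hC
        · rwa [List.mem_singleton.1 hC]
      · intro C hC D' hD' α hα hc hl
        obtain rfl := List.mem_singleton.1 hD'
        exact hs.not_covers_of_not_refinable (h1 C hC) (hclosed C hC) hα hc hl
    refine ⟨hinv, ?_⟩
    have hlen := hs.length_le hinv
    have hpot := hs.potential_le hD
    rw [h2] at hlen ⊢
    simp only [List.length_append, List.length_singleton] at hlen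
    obtain ⟨m, hm⟩ := Nat.exists_eq_add_of_le hlen
    have e1 : T.card - L.length = m + 1 := by omega
    have e2 : T.card - (L.length + 1) = m := by omega
    simp only [remaining, List.map_append, List.sum_append, List.map_singleton, List.sum_singleton,
      List.length_append, List.length_singleton, e1, e2, Nat.add_mul m]
    omega
  · obtain ⟨hg, hp⟩ := hs.refine_spec (hL.good C (by simp)) hD.toBad h2
    have hvio := h2
    simp only [refinable, Bool.and_eq_true, Bool.not_eq_true'] at hvio
    obtain ⟨-, hl, hc⟩ := hs.shrink_spec (C := C.prod D)
      ⟨(hL.good C (by simp)).inner.prod hD.inner, (hL.good C (by simp)).reduced.prod D, hvio.1⟩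
    rw [h3]
    generalize shrink O S (C.prod D) = E at *
    have hCE : C.covers E = true := covers_trans (covers_prod.1 (covers_refl _)).1 hc
    have hDE : D.covers E = true := covers_trans (covers_prod.1 (covers_refl _)).2 hc
    refine ⟨⟨?_, ?_⟩, ?_⟩
    · intro F hF
      rcases List.mem_append.1 hF with hF | hF
      · exact hL.good F (by simp [hF])
      · rcases List.mem_cons.1 hF with rfl | hF
        · exact hg
        · exact hL.good F (by simp [hF])
    · obtain ⟨p1, p2, p3⟩ := List.pairwise_append.1 hL.pairwise
      obtain ⟨p4, p5⟩ := List.pairwise_cons.1 p2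
      refine List.pairwise_append.2 ⟨p1, List.pairwise_cons.2 ⟨?_, p5⟩, ?_⟩
      · intro F hF α hα hc' hl' hE
        exact p4 F hF α hα hc' hl' (covers_trans hCE hE)
      · intro F hF G hG α hα hc' hl'
        rcases List.mem_cons.1 hG with rfl | hG
        · rw [hl, mem_labels_prod] at hl'
          by_cases hC : α.rhs ∈ C.labels
          · exact hs.not_covers_of_not_refinable (h1 F hF) (hclosed F (by simp [hF])) hα
              (covers_trans hDE hc') fun hm => hl' ⟨hC, hm⟩
          · exact p3 F hF C (by simp) α hα (covers_trans hCE hc') hC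
        · exact p3 F hF G (by simp [hG]) α hα hc' hl'
    · simp only [remaining, List.map_append, List.sum_append, List.map_cons, List.sum_cons,
        List.length_append, List.length_cons]
      omega

theorem learn_inv {L : List ELConcept} {α : CI} (hL : LearnInv T O S L) (hT : T.Entails α)
    (hH : ¬ TBox.Entails (hypothesis O S L).toFinset α) :
    LearnInv T O S (learn O S L α.lhs) ∧
      remaining T S (learn O S L α.lhs) < remaining T S L := by
  obtain ⟨hv, N, hN⟩ := hs.violation_spec hT hH
  rw [hN] at hv
  obtain ⟨hg, hl, hc⟩ := hs.shrink_spec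
    ⟨hs.innerClosed_candidate L N, hs.reduced_candidate L N, hv⟩
  unfold learn
  rw [hN]
  refine hs.refine_inv hL hg fun C hC hcov A hA hCA => ?_
  rw [hl]
  exact hs.mem_labels_candidate hC (covers_trans hc hcov) hA hCA

end Session

end ExactLearning

namespace ExactLearning

open Polynomial

/-! ### Executions with equivalence queries -/

theorem next_mono (O : Oracle elLhs) (c : Config) :
    c.time ≤ (next O c).time ∧ c.maxCex ≤ (next O c).maxCex := by
  obtain ⟨code, s, t, e, m⟩ := c
  unfold next step
  rcases code with _ | ⟨_ | _ | _ | _ | _ | ⟨x, b⟩ | ⟨x, b⟩, K⟩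
  · simp
  · simp
  · simp; omega
  · simp
  · simp; omega
  · simp; omega
  · dsimp only
    cases elLhs.decodeExample (b.eval s) with
    | none => simp
    | some q => simp; omega
  · dsimp only
    cases elLhs.decodeConcept (b.eval s) with
    | none => simp
    | some h =>
      simp only [Option.map_some, Option.getD_some]
      cases O.eqv e h with
      | none => simp; omega
      | some q => simp; omega

theorem iterate_next_mono (O : Oracle elLhs) (c : Config) {i j : ℕ} (h : i ≤ j) :
    ((next O)^[i] c).time ≤ ((next O)^[j] c).time ∧
      ((next O)^[i] c).maxCex ≤ ((next O)^[j] c).maxCex := by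
  induction j, h using Nat.le_induction with
  | base => exact ⟨le_rfl, le_rfl⟩
  | succ j _ ih =>
    rw [Function.iterate_succ_apply']
    exact ⟨ih.1.trans (next_mono O _).1, ih.2.trans (next_mono O _).2⟩

/-- The execution from `c` reaches `c'`, and up to that point the time is bounded by `B` in terms
of the size of the largest counterexample. -/
def Reaches (O : Oracle elLhs) (B : ℕ → ℕ) (c c' : Config) : Prop :=
  ∃ n, (next O)^[n] c = c' ∧ ∀ i ≤ n, ((next O)^[i] c).time ≤ B ((next O)^[i] c).maxCex

namespace Reaches

variable {O : Oracle elLhs} {B : ℕ → ℕ} {c c' c'' : Config}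

theorem trans (h : Reaches O B c c') (h' : Reaches O B c' c'') : Reaches O B c c'' := by
  obtain ⟨n, rfl, hn⟩ := h
  obtain ⟨n', rfl, hn'⟩ := h'
  refine ⟨n' + n, Function.iterate_add_apply _ _ _ _, fun i hi => ?_⟩
  rcases le_total i n with h | h
  · exact hn i h
  · obtain ⟨j, rfl⟩ := Nat.exists_eq_add_of_le' h
    rw [Function.iterate_add_apply]
    exact hn' j (by omega)

/-- Neither `time` nor `maxCex` ever decreases. So `maxCex` is constant in between, and the last
moment is the worst. -/
theorem of_iterate (h : ∃ n, (next O)^[n] c = c') (hm : c'.maxCex = c.maxCex)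
    (ht : c'.time ≤ B c.maxCex) : Reaches O B c c' := by
  obtain ⟨n, rfl⟩ := h
  refine ⟨n, rfl, fun i hi => ?_⟩
  have h1 := iterate_next_mono O c hi
  have h2 := iterate_next_mono O c (Nat.zero_le i)
  simp only [Function.iterate_zero, id] at h2
  have : ((next O)^[i] c).maxCex = c.maxCex := by omega
  rw [this]
  omega

theorem of_next (h : next O c = c') (ht : c.time ≤ B c.maxCex) (ht' : c'.time ≤ B c'.maxCex) :
    Reaches O B c c' := by
  refine ⟨1, h, fun i hi => ?_⟩
  interval_cases i
  · exact ht
  · rw [Function.iterate_one, h]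
    exact ht'

theorem of_runs {P : Program} {s s' : Store} {t : ℕ} (h : Runs O P s s' t) (K : List Program)
    (t₀ e m : ℕ) (ht : t₀ + t ≤ B m) :
    Reaches O B ⟨P :: K, s, t₀, e, m⟩ ⟨K, s', t₀ + t, e, m⟩ :=
  of_iterate (h K t₀ e m) rfl ht

end Reaches

theorem decode_enc (l : List CI) : TBox.decode (Enc.enc l) = some l.toFinset := by
  have h : (l.map CI.encode).mapM CI.decode = some l := by
    induction l with
    | nil => rfl
    | cons α l ih => simp [List.mapM_cons, CI.decode_encode, ih]
  change TBox.decode (Data.ofList (l.map CI.encode)) = _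
  rw [TBox.decode, Data.toList_ofList]
  simp [h]

theorem decodeConcept_enc (l : List CI) :
    elLhs.decodeConcept (Enc.enc l) = @some elLhs.Concept l.toFinset :=
  decode_enc l

theorem step_eqv_none {F : LearningFramework} {O : Oracle F} {x : ℕ} {b : Expr}
    {K : List Program} {s : Store} {t e m : ℕ} {h : F.Concept}
    (hb : F.decodeConcept (b.eval s) = some h) (hO : O.eqv e h = none) :
    step O ⟨.eqv x b :: K, s, t, e, m⟩ =
      some ⟨K, Function.update s x Data.nil, t + 1 + b.cost s, e + 1, m⟩ := by
  simp [step, hb, hO]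

theorem step_eqv_some {F : LearningFramework} {O : Oracle F} {x : ℕ} {b : Expr}
    {K : List Program} {s : Store} {t e m : ℕ} {h : F.Concept} {q : F.Example}
    (hb : F.decodeConcept (b.eval s) = some h) (hO : O.eqv e h = some q) :
    step O ⟨.eqv x b :: K, s, t, e, m⟩ =
      some ⟨K, Function.update s x (.pair .nil (F.encodeExample q)), t + 1 + b.cost s, e + 1,
        max m (F.exampleSize q)⟩ := by
  simp [step, hb, hO]

theorem next_eqv_none {O : Oracle elLhs} {x : ℕ} {b : Expr} {K : List Program} {s : Store}
    {t e m : ℕ} {l : List CI} (hb : b.eval s = Enc.enc l) (h : O.eqv e l.toFinset = none) :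
    next O ⟨.eqv x b :: K, s, t, e, m⟩ =
      ⟨K, Function.update s x Data.nil, t + 1 + b.cost s, e + 1, m⟩ :=
  congrArg (Option.getD · _) (step_eqv_none (hb ▸ decodeConcept_enc l) h)

theorem next_eqv_some {O : Oracle elLhs} {x : ℕ} {b : Expr} {K : List Program} {s : Store}
    {t e m : ℕ} {l : List CI} {q : CI} (hb : b.eval s = Enc.enc l)
    (h : O.eqv e l.toFinset = some q) :
    next O ⟨.eqv x b :: K, s, t, e, m⟩ =
      ⟨K, Function.update s x (.pair .nil q.encode), t + 1 + b.cost s, e + 1, max m q.size⟩ :=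
  congrArg (Option.getD · _) (step_eqv_some (hb ▸ decodeConcept_enc l) h)

/-! ### The learning program -/

/-- The part of a round of the learner that processes a counterexample. -/
def roundProgram (U : ℕ → Program) : Program :=
  .seq (.assign 5 (.pair (.var 1) (.pair (.var 2) (.fst (.snd (.var 4))))))
    (.seq (U 5) (.seq (.assign 2 (.fst (.var 5))) (.assign 3 (.snd (.var 5)))))

/-- The loop of the learner. Variables: `1` signature, `2` hypothesis trees, `3` hypothesis,
`4` answer to the latest equivalence query. -/
def loopProgram (U : ℕ → Program) : Program :=
  .while (.var 4) (.seq (roundProgram U) (.eqv 4 (.var 3)))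

/-- The learner, given programs `U` that update the hypothesis trees and the hypothesis. -/
def learnProgram (U : ℕ → Program) : Program :=
  .seq (.assign 1 (.fst (.var 0)))
    (.seq (.seq (.eqv 4 (.var 3)) (loopProgram U)) (.assign 0 (.var 3)))

/-- The new hypothesis trees and the new hypothesis after a counterexample. -/
def updateHypothesis (O : Orc) (x : List ConceptName × List ELConcept × ELConcept) :
    List ELConcept × List CI :=
  (learn O x.1 x.2.1 x.2.2, hypothesis O x.1 (learn O x.1 x.2.1 x.2.2))

theorem PT.updateHypothesis : PT updateHypothesis :=
  have h : PT fun O (x : List ConceptName × List ELConcept × ELConcept) =>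
    ExactLearning.learn O x.1 x.2.1 x.2.2 := learn (fst id) (fst (snd id)) (snd (snd id))
  h.pair (hypothesis (fst id) h)

/-- The store represents the state of the learner. -/
structure Represents (s : Store) (O : Orc) (S : List ConceptName) (L : List ELConcept) : Prop where
  sig : s 1 = Enc.enc S
  trees : s 2 = Enc.enc L
  hyp : s 3 = Enc.enc (hypothesis O S L)

theorem runs_roundProgram {O : Oracle elLhs} {U : ℕ → Program} {p : ℕ[X]}
    (hU : ComputesOn (fun _ => Set.univ) updateHypothesis U p) {s : Store} {S : List ConceptName}
    {L : List ELConcept} (hs : Represents s O.mem S L) {q : CI}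
    (h4 : s 4 = .pair .nil q.encode) :
    ∃ s' t, Runs O (roundProgram U) s s' t ∧ Represents s' O.mem S (learn O.mem S L q.lhs) ∧
      t ≤ 12 * esize (S, L, q.lhs) + 5 * p.eval (esize (S, L, q.lhs)) + 30 := by
  have e1 := Runs.assign O s 5 (.pair (.var 1) (.pair (.var 2) (.fst (.snd (.var 4)))))
  obtain ⟨s1, t1, r1, ht1, hv1, hp1, hs1⟩ := hU O 5 (Function.update s 5
    ((Expr.pair (.var 1) (.pair (.var 2) (.fst (.snd (.var 4))))).eval s)) (S, L, q.lhs) trivial (by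
      rw [Function.update_self]
      simp only [Expr.eval, hs.sig, hs.trees, h4]
      rfl)
  have e2 := Runs.assign O s1 2 (.fst (.var 5))
  have e3 := Runs.assign O (Function.update s1 2 ((Expr.fst (.var 5)).eval s1)) 3 (.snd (.var 5))
  refine ⟨_, _, e1.seq (r1.seq (e2.seq e3)), ⟨?_, ?_, ?_⟩, ?_⟩
  · rw [Function.update_of_ne (by decide), Function.update_of_ne (by decide), hp1 1 (by decide),
      Function.update_of_ne (by decide), hs.sig]
  · rw [Function.update_of_ne (by decide), Function.update_self]
    simp only [Expr.eval, hv1]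
    rfl
  · rw [Function.update_self]
    simp only [Expr.eval]
    rw [Function.update_of_ne (by decide), hv1]
    rfl
  · have hc1 : (Expr.pair (.var 1) (.pair (.var 2) (.fst (.snd (.var 4))))).cost s =
        esize S + (esize L + (esize q.lhs + 4 + (esize q.lhs + 2) + esize q.lhs) +
          (esize L + esize q.lhs + 1)) + (esize S + (esize L + esize q.lhs + 1) + 1) := by
      simp only [Expr.cost, Expr.eval, hs.sig, hs.trees, h4]
      change esize S + (esize L + (1 + (esize q.lhs + 1 + 1) + 1 + (esize q.lhs + 1 + 1) +
        esize q.lhs) + (esize L + esize q.lhs + 1)) + (esize S + (esize L + esize q.lhs + 1) + 1) = _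
      omega
    have hc2 : (Expr.fst (.var 5)).cost s1 =
        esize (updateHypothesis O.mem (S, L, q.lhs)) +
          esize (updateHypothesis O.mem (S, L, q.lhs)).1 := by
      simp only [Expr.cost, Expr.eval, hv1]
      rfl
    have hc3 : (Expr.snd (.var 5)).cost (Function.update s1 2 ((Expr.fst (.var 5)).eval s1)) =
        esize (updateHypothesis O.mem (S, L, q.lhs)) +
          esize (updateHypothesis O.mem (S, L, q.lhs)).2 := by
      simp only [Expr.cost, Expr.eval]
      rw [Function.update_of_ne (by decide), hv1]
      rfl
    rw [hc1, hc2, hc3]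
    have := esize_pair (updateHypothesis O.mem (S, L, q.lhs))
    have h5 : esize (S, L, q.lhs) = esize S + (esize L + esize q.lhs + 1) + 1 := rfl
    omega

/-- The execution of the learner from the moment when it poses an equivalence query. -/
theorem reaches_loop {O : Oracle elLhs} {T : TBox} (hO : O.Truthful T) {S : List ConceptName}
    (hs : Session T O.mem S) {U : ℕ → Program} {p ph : ℕ[X]}
    (hU : ComputesOn (fun _ => Set.univ) updateHypothesis U p)
    (hph : ∀ L, esize (hypothesis O.mem S L) ≤ ph.eval (esize (S, L)))
    {W : ℕ → ℕ} (hW : Monotone W)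
    (hWL : ∀ L m (C : ELConcept), LearnInv T O.mem S L → esize C ≤ 3 * m + 1 →
      esize (S, L, C) ≤ W m)
    -- `W m` bounds the input of an update and `Q m` the time of a round when the largest
    -- counterexample has size `m`; at most `R - n` rounds have been made.
    {Q : ℕ → ℕ} (hQ : ∀ m, Q m = 3 * ph.eval (W m) + 16 * W m + 5 * p.eval (W m) + 60)
    {A R : ℕ} (n : ℕ) (L : List ELConcept) (s : Store) (t e m : ℕ)
    (hL : LearnInv T O.mem S L) (hn : remaining T S L = n) (hnR : n ≤ R)
    (hr : Represents s O.mem S L) (ht : t ≤ A + (R - n) * Q m) :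
    ∃ c' l, Reaches O (fun m => A + (R + 1) * Q m)
      ⟨[.eqv 4 (.var 3), loopProgram U, .assign 0 (.var 3)], s, t, e, m⟩ c' ∧
      c'.code = [] ∧ c'.store 0 = Enc.enc l ∧ elLhs.μ (List.toFinset l) = elLhs.μ T := by
  have hQm : Monotone Q := fun a b hab => by
    have h1 := hW hab
    have h2 := eval_mono ph h1
    have h3 := eval_mono p h1
    rw [hQ, hQ]
    omega
  induction n using Nat.strong_induction_on generalizing L s t e m with
  | _ n ih =>
  have hWH : ∀ m, esize (hypothesis O.mem S L) ≤ ph.eval (W m) := fun m =>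
    (hph L).trans (eval_mono ph ((by simp; omega : esize (S, L) ≤ esize (S, L, ELConcept.top)).trans
      (hWL L m .top hL (by simp))))
  have hcost : (Expr.var 3).cost s = esize (hypothesis O.mem S L) := by
    simp only [Expr.cost, hr.hyp]
    rfl
  -- The rounds already made are charged at the new rate `Q m'`, and the present one takes one more
  -- share.
  have hB : ∀ m' x, m ≤ m' → x ≤ Q m' →
      t + x ≤ A + (R - n + 1) * Q m' ∧ t + x ≤ A + (R + 1) * Q m' := by
    intro m' x hm hx
    have h1 := Nat.mul_le_mul_left (R - n) (hQm hm)
    have h2 : (R - n + 1) * Q m' ≤ (R + 1) * Q m' := Nat.mul_le_mul_right _ (by omega)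
    rw [Nat.add_mul, Nat.one_mul] at *
    omega
  have hH := hWH m
  have ht0 := (hB m 0 le_rfl (Nat.zero_le _)).2
  cases hq : O.eqv e (hypothesis O.mem S L).toFinset with
  | none =>
    have hμ := hO.2 e (hypothesis O.mem S L).toFinset
    rw [hq] at hμ
    have r1 := next_eqv_none (x := 4) (b := .var 3) (K := [loopProgram U, .assign 0 (.var 3)])
      (t := t) (m := m) hr.hyp hq
    have r2 : Runs O (loopProgram U) (Function.update s 4 Data.nil) _ _ :=
      Runs.while_false (by simp [Expr.eval])
    have r3 := Runs.assign O (Function.update s 4 Data.nil) 0 (.var 3)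
    have hc4 : (Expr.var 4).cost (Function.update s 4 Data.nil) = 1 := by simp [Expr.cost, Data.size]
    have hc3 : (Expr.var 3).cost (Function.update s 4 Data.nil) =
        esize (hypothesis O.mem S L) := by
      simp only [Expr.cost]
      rw [Function.update_of_ne (by decide), hr.hyp]
      rfl
    rw [hcost] at r1
    rw [hc4] at r2
    rw [hc3] at r3
    have hQ' := hQ m
    refine ⟨_, hypothesis O.mem S L, (Reaches.of_next r1 ht0 ?_).trans
      ((Reaches.of_runs r2 _ _ _ _ ?_).trans (Reaches.of_runs r3 _ _ _ _ ?_)), rfl, ?_, hμ⟩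
    · exact Nat.add_assoc t _ _ ▸ (hB m _ le_rfl (by omega)).2
    · simpa only [Nat.add_assoc] using (hB m _ le_rfl (by omega)).2
    · simpa only [Nat.add_assoc] using (hB m _ le_rfl (by omega)).2
    · dsimp only
      rw [Function.update_self]
      simp only [Expr.eval]
      rw [Function.update_of_ne (by decide), hr.hyp]
  | some q =>
    have hμ := hO.2 e (hypothesis O.mem S L).toFinset
    rw [hq] at hμ
    -- The target entails every inclusion of the hypothesis, so the counterexample can only be one
    -- that the hypothesis misses.
    obtain ⟨hqT, hqH⟩ : T.Entails q ∧ ¬ TBox.Entails (hypothesis O.mem S L).toFinset q := by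
      rcases hμ with ⟨h1, h2⟩ | h
      · refine absurd (fun I hI => h1 I fun α hα => ?_) h2
        exact (hs.mem_hypothesis.1 (List.mem_toFinset.1 hα)).2.2 I hI
      · exact h
    obtain ⟨hL', hrem⟩ := hs.learn_inv hL hqT hqH
    have r1 := next_eqv_some (x := 4) (b := .var 3) (K := [loopProgram U, .assign 0 (.var 3)])
      (t := t) (m := m) hr.hyp hq
    set s₁ := Function.update s 4 (.pair .nil q.encode) with hs₁
    have h4 : s₁ 4 = .pair .nil q.encode := Function.update_self ..
    have hr₁ : Represents s₁ O.mem S L := by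
      constructor
      all_goals rw [hs₁, Function.update_of_ne (by decide)]
      exacts [hr.sig, hr.trees, hr.hyp]
    obtain ⟨s₂, t₂, r2, hr₂, ht₂⟩ := runs_roundProgram hU hr₁ h4
    set m' := max m q.size
    have hqm : esize q.lhs ≤ 3 * m' + 1 := by
      have h1 := esize_concept_le q.lhs
      have h2 : q.size = q.lhs.size + 1 := rfl
      have h3 : q.size ≤ m' := le_max_right _ _
      omega
    have hw := hWL L m' q.lhs hL hqm
    have hp := eval_mono p hw
    have hmm : m ≤ m' := le_max_left _ _
    have hH' := hWH m'
    have hQ' := hQ m'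
    have hqw : esize q.lhs ≤ W m' := le_trans (by simp; omega) hw
    rw [hcost] at r1
    have hc4 : (Expr.var 4).cost s₁ = esize q.lhs + 4 := by
      simp only [Expr.cost, h4]
      change 1 + (esize q.lhs + 1 + 1) + 1 = _
      omega
    have r3 : ∃ n, (next O)^[n] ⟨[loopProgram U, .assign 0 (.var 3)], s₁,
        t + 1 + esize (hypothesis O.mem S L), e + 1, m'⟩ =
        ⟨[.eqv 4 (.var 3), loopProgram U, .assign 0 (.var 3)], s₂,
          t + (1 + esize (hypothesis O.mem S L) + 1 + (esize q.lhs + 4) + 1 + t₂), e + 1, m'⟩ := by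
      refine Runs.prepend (c' := ⟨[.seq (roundProgram U) (.eqv 4 (.var 3)), loopProgram U,
        .assign 0 (.var 3)], s₁, t + 1 + esize (hypothesis O.mem S L) + 1 + (esize q.lhs + 4),
        e + 1, m'⟩) ?_ (Runs.prepend (c' := ⟨[roundProgram U, .eqv 4 (.var 3), loopProgram U,
        .assign 0 (.var 3)], s₁, t + 1 + esize (hypothesis O.mem S L) + 1 + (esize q.lhs + 4) + 1,
        e + 1, m'⟩) rfl ?_)
      · rw [← hc4]
        simp [next, step, loopProgram, Expr.eval, h4]
      · have := r2 [.eqv 4 (.var 3), loopProgram U, .assign 0 (.var 3)]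
          (t + 1 + esize (hypothesis O.mem S L) + 1 + (esize q.lhs + 4) + 1) (e + 1) m'
        simpa only [Nat.add_assoc] using this
    obtain ⟨h5, h6⟩ := hB m' (1 + esize (hypothesis O.mem S L) + 1 + (esize q.lhs + 4) + 1 + t₂)
      hmm (by omega)
    obtain ⟨c', l, h7, h8⟩ := ih (remaining T S (learn O.mem S L q.lhs)) (by omega) _ s₂ _
      (e + 1) m' hL' rfl (by omega) hr₂ (h5.trans (Nat.add_le_add_left
        (Nat.mul_le_mul_right _ (by omega)) _))
    refine ⟨c', l, (Reaches.of_next r1 ht0 ?_).trans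
      ((Reaches.of_iterate r3 rfl h6).trans h7), h8⟩
    exact Nat.add_assoc t _ _ ▸ (hB m' _ hmm (by omega)).2

/-! ### Polynomial bounds -/

theorem card_conceptNames_le (T : TBox) : T.conceptNames.card ≤ T.size := by
  have h : ∀ C : ELConcept, C.conceptNames.card ≤ C.size := fun C => by
    induction C with
    | top => simp [ELConcept.conceptNames]
    | name A => simp [ELConcept.conceptNames, ELConcept.size]
    | conj C D ihC ihD =>
      have := Finset.card_union_le C.conceptNames D.conceptNames
      simp only [ELConcept.conceptNames, ELConcept.size]
      omega
    | ex r C ih => simp only [ELConcept.conceptNames, ELConcept.size]; omega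
  refine Finset.card_biUnion_le.trans (Finset.sum_le_sum fun α _ => ?_)
  exact (Finset.card_insert_le _ _).trans (Nat.add_le_add_right (h _) 1)

theorem card_roleNames_le (T : TBox) : T.roleNames.card ≤ T.size := by
  have h : ∀ C : ELConcept, C.roleNames.card ≤ C.size := fun C => by
    induction C with
    | top => simp [ELConcept.roleNames]
    | name A => simp [ELConcept.roleNames]
    | conj C D ihC ihD =>
      have := Finset.card_union_le C.roleNames D.roleNames
      simp only [ELConcept.roleNames, ELConcept.size]
      omega
    | ex r C ih =>
      have := Finset.card_insert_le r C.roleNames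
      simp only [ELConcept.roleNames, ELConcept.size]
      omega
  refine Finset.card_biUnion_le.trans (Finset.sum_le_sum fun α _ => ?_)
  exact (h _).trans (Nat.le_add_right _ 1)

theorem TBox.card_le_size (T : TBox) : T.card ≤ T.size := by
  rw [Finset.card_eq_sum_ones]
  exact Finset.sum_le_sum fun α _ => Nat.le_add_left 1 _

/-- Bounds are computed in a single variable, for which the sum of target size and counterexample
size is substituted. This loses nothing, as polynomials over `ℕ` are monotone. -/
theorem eval_aeval_add (P : ℕ[X]) (a b : ℕ) :
    MvPolynomial.eval ![a, b] (P.eval₂ MvPolynomial.C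
      (MvPolynomial.X (0 : Fin 2) + MvPolynomial.X 1)) = P.eval (a + b) := by
  rw [Polynomial.hom_eval₂]
  simp [Polynomial.eval₂_eq_sum, Polynomial.eval_eq_sum]

theorem esize_concepts (l : List ConceptName) : esize l = 2 * l.length + 1 := by
  induction l with
  | nil => rfl
  | cons A l ih => simp [ih]; omega

theorem esize_signature (cs : List ConceptName) (rs : List RoleName) :
    (Data.pair (.ofList (cs.map fun A => .atom (.concept A)))
      (.ofList (rs.map fun r => .atom (.role r)))).size = 2 * cs.length + 2 * rs.length + 3 := by
  have h1 := esize_concepts cs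
  have h2 : (Data.ofList (rs.map fun r => Data.atom (.role r))).size = 2 * rs.length + 1 := by
    induction rs with
    | nil => rfl
    | cons r rs ih => simp [Data.ofList, Data.size, ih]; omega
  change esize cs + _ + 1 = _
  omega

/-- A bound on the size of hypothesis trees. -/
noncomputable def treePoly : ℕ[X] := 6 * X + 4 * ((X + 1) * X) + 1

theorem esize_trees_le {T : TBox} {O : Orc} {S : List ConceptName} (hs : Session T O S)
    (hS : S.length ≤ T.size) {L : List ELConcept} (hL : LearnInv T O S L) :
    esize L ≤ T.size * (treePoly.eval T.size + 1) + 1 := by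
  refine (esize_list_le L (treePoly.eval T.size) fun C hC => (hs.esize_le (hL.good C hC)).trans ?_).trans ?_
  · simp only [treePoly, eval_add, eval_mul, eval_X, eval_ofNat, eval_one]
    gcongr
  · have := (hs.length_le hL).trans T.card_le_size
    gcongr

theorem polyTimeLearnable_elLhs : elLhs.PolyTimeLearnable := by
  obtain ⟨U, p, hU⟩ := PT.updateHypothesis
  obtain ⟨ph, hph⟩ : ∃ ph : ℕ[X], ∀ O (x : List ConceptName × List ELConcept),
      esize (hypothesis O x.1 x.2) ≤ ph.eval (esize x) :=
    (PT.hypothesis (PT.fst PT.id) (PT.snd PT.id)).exists_size_le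
  -- `w` bounds the data of a round (signature, trees, counterexample), `q` its time, and `r` the
  -- number of counterexamples; the summand `12 * X + 30` in `P` covers the start.
  let w : ℕ[X] := 2 * X + (X * (treePoly + 1) + 1) + 3 * X + 4
  let q : ℕ[X] := 3 * ph.comp w + 16 * w + 5 * p.comp w + 60
  let nb : ℕ[X] := (X + 1) * X + 1
  let r : ℕ[X] := X * (X * ((X + 1) * nb) + X * nb + nb + 1)
  let P : ℕ[X] := (12 * X + 30) + (r + 1) * q
  refine ⟨learnProgram U, P.eval₂ MvPolynomial.C
    (MvPolynomial.X (0 : Fin 2) + MvPolynomial.X 1), fun T d hd O hO => ?_⟩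
  obtain ⟨cs, rs, hcs, hcsT, hrs, hrsT, rfl⟩ := hd
  have hs : Session T O.mem cs := ⟨hO.1, fun A => by rw [← hcsT, List.mem_toFinset], hcs⟩
  have hlc : cs.length ≤ T.size := by
    rw [← List.toFinset_card_of_nodup hcs, hcsT]
    exact card_conceptNames_le T
  have hlr : rs.length ≤ T.size := by
    rw [← List.toFinset_card_of_nodup hrs, hrsT]
    exact card_roleNames_le T
  let W : ℕ → ℕ := fun m => w.eval (T.size + m)
  let Q : ℕ → ℕ := fun m => q.eval (T.size + m)
  have hW : Monotone W := fun a b hab => eval_mono w (Nat.add_le_add_left hab _)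
  have hWL : ∀ L m (C : ELConcept), LearnInv T O.mem cs L → esize C ≤ 3 * m + 1 →
      esize (cs, L, C) ≤ W m := fun L m C hL hC => by
    have h1 := esize_trees_le hs hlc hL
    have h2 : T.size * (treePoly.eval T.size + 1) ≤
        (T.size + m) * (treePoly.eval (T.size + m) + 1) := by
      have := eval_mono treePoly (Nat.le_add_right T.size m)
      gcongr
      omega
    simp only [W, w, esize_pair, esize_concepts, eval_add, eval_mul, eval_X, eval_ofNat, eval_one]
    omega
  have hQ : ∀ m, Q m = 3 * ph.eval (W m) + 16 * W m + 5 * p.eval (W m) + 60 := fun m => by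
    simp only [Q, q, W, eval_add, eval_mul, eval_ofNat, eval_comp]
  set s₀ : Store := (Config.init (learnProgram U) (Data.pair
    (.ofList (cs.map fun A => .atom (.concept A))) (.ofList (rs.map fun r => .atom (.role r))))).store
    with hs₀
  set d := Data.pair (.ofList (cs.map fun A => .atom (.concept A)))
    (.ofList (rs.map fun r => .atom (.role r))) with hd
  have hdsize : d.size ≤ 4 * T.size + 3 := by
    rw [hd, esize_signature]
    omega
  have h00 : s₀ 0 = d := by simp [hs₀, Config.init]
  have h0 : ∀ j, j ≠ 0 → s₀ j = Data.nil := fun j hj => by simp [hs₀, Config.init, hj]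
  have e1 := Runs.assign O s₀ 1 (.fst (.var 0))
  have hc1 : (Expr.fst (.var 0)).cost s₀ ≤ 8 * T.size + 6 := by
    have := d.size_fst_le
    simp only [Expr.cost, Expr.eval, h00]
    omega
  set s₁ := Function.update s₀ 1 ((Expr.fst (.var 0)).eval s₀) with hs₁
  have hr : Represents s₁ O.mem cs [] := by
    refine ⟨?_, ?_, ?_⟩
    · rw [hs₁, Function.update_self]
      simp only [Expr.eval, h00]
      rfl
    -- `nil` represents the empty list, so the learner starts without trees and with the empty
    -- hypothesis.
    · rw [hs₁, Function.update_of_ne (by decide), h0 2 (by decide)]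
      rfl
    · rw [hs₁, Function.update_of_ne (by decide), h0 3 (by decide)]
      rfl
  have hinit : ∃ n, (next O)^[n] (Config.init (learnProgram U) d) =
      ⟨[.eqv 4 (.var 3), loopProgram U, .assign 0 (.var 3)], s₁,
        0 + 1 + (1 + (Expr.fst (.var 0)).cost s₀) + 1 + 1, 0, 0⟩ :=
    Runs.prepend rfl (Runs.chain (e1 _ _ _ _) (Runs.prepend rfl (Runs.prepend rfl ⟨0, rfl⟩)))
  have hL₀ : LearnInv T O.mem cs [] := ⟨by simp, List.Pairwise.nil⟩
  obtain ⟨c', l, hreach, hcode, hstore, hμ⟩ := reaches_loop (Q := Q) (A := 12 * T.size + 30) hO hs hU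
    (fun L => hph O.mem (cs, L)) hW hWL hQ _ [] s₁
    (0 + 1 + (1 + (Expr.fst (.var 0)).cost s₀) + 1 + 1) 0 0 hL₀ rfl le_rfl hr (by omega)
  obtain ⟨n, hn, hB⟩ := (Reaches.of_iterate hinit rfl (by
    change 0 + 1 + (1 + (Expr.fst (.var 0)).cost s₀) + 1 + 1 ≤ _ + _
    omega)).trans hreach
  have hrun : ∀ i, run O (learnProgram U) d i = (next O)^[i] (Config.init (learnProgram U) d) :=
    fun i => rfl
  have hhalt : ∀ i, (next O)^[i] c' = c' := fun i => by
    have : next O c' = c' := by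
      obtain ⟨code, _, _, _, _⟩ := c'
      obtain rfl : code = [] := hcode
      rfl
    exact Function.iterate_fixed this i
  refine ⟨⟨n, l.toFinset, ?_, ?_, hμ⟩, fun i => ?_⟩
  · rw [hrun, hn, hcode]
  · rw [hrun, hn, hstore, decodeConcept_enc]
  have key : ((next O)^[i] (Config.init (learnProgram U) d)).time ≤
      12 * T.size + 30 + (remaining T cs [] + 1) *
        Q ((next O)^[i] (Config.init (learnProgram U) d)).maxCex := by
    -- A halted configuration is kept forever, so the bound at the moment of halting covers all
    -- later ones.
    rcases le_total i n with h | h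
    · exact hB i h
    · obtain ⟨j, rfl⟩ := Nat.exists_eq_add_of_le' h
      rw [Function.iterate_add_apply, hn, hhalt, ← hn]
      exact hB n le_rfl
  rw [hrun]
  generalize (next O)^[i] (Config.init (learnProgram U) d) = c at key ⊢
  refine key.trans ?_
  rw [eval_aeval_add]
  change _ ≤ P.eval (T.size + c.maxCex)
  have hrem : remaining T cs [] ≤ r.eval (T.size + c.maxCex) := by
    have hN : T.size ≤ T.size + c.maxCex := Nat.le_add_right _ _
    have hlc' := hlc.trans hN
    have hcard := T.card_le_size.trans hN
    simp only [remaining, maxPotential, nameBound, r, nb, eval_add, eval_mul, eval_X, eval_one,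
      List.map_nil, List.sum_nil, List.length_nil, Nat.sub_zero, Nat.zero_add]
    gcongr
  have h1 := Nat.mul_le_mul_right (Q c.maxCex) (Nat.add_le_add_right hrem 1)
  simp only [P, eval_add, eval_mul, eval_X, eval_ofNat, eval_one]
  change _ ≤ _ + (r.eval (T.size + c.maxCex) + 1) * Q c.maxCex
  omega

end ExactLearning

theorem theorem3 : ExactLearning.elLhs.PolyTimeLearnable :=
  ExactLearning.polyTimeLearnable_elLhs
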